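/- **Corollary (Infinite degree limit of the MC ansatz energy).** Let $G=(V,E)$ be a finite nonempty $(D+1)$-regular graph with $m$ edges and girth $>2p+1$, where $p\ge 1$, with a qubit on every vertex. For real $\boldsymbol\gamma=(\gamma_1,\dots,\gamma_p)$, $\boldsymbol\beta=(\beta_1,\dots,\beta_p)$, which do not depend on $D$, the MC ansatz prepares $$|\boldsymbol\gamma,\boldsymbol\beta\rangle=e^{-i\beta_pB}e^{-i\gamma_pC}\cdots e^{-i\beta_1B}e^{-i\gamma_1C}|+\rangle^{\otimes V},\qquad B=\sum_{v\in V}X_v,\qquad C=-\frac1{\sqrt D}\sum_{(u,v)\in E}Z_uZ_v .$$ Consider the Hamiltonians $$H_{QMC}=\tfrac12\sum_{(u,v)\in E}(I-X_uX_v-Y_uY_v-Z_uZ_v),\quad H_{XY}=\tfrac12\sum_{(u,v)\in E}(I-Y_uY_v-Z_uZ_v),\quad H_{EPR}=\tfrac12\sum_{(u,v)\in E}(I+X_uX_v-Y_uY_v+Z_uZ_v),$$ and let the normalized energy $\nu_p(D,H)$ be defined by $\langle\boldsymbol\gamma,\boldsymbol\beta|H|\boldsymbol\gamma,\boldsymbol\beta\rangle/m=\tfrac12+\nu_p(D,H)/\sqrt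 D$. Let $D\to\infty$; all limits are uniform over the graphs $G$ as above, and are the same for all of them. Then: 1. The limit of $\langle\boldsymbol\gamma,\boldsymbol\beta|H_{EPR}|\boldsymbol\gamma,\boldsymbol\beta\rangle/m$ exists and is at most the energy per edge $\langle 0|^{\otimes V}H_{EPR}|0\rangle^{\otimes V}/m$ of the all-zeros state (ZERO). 2. The limits $\nu_p(XY)=\lim_{D\to\infty}\nu_p(D,H_{XY})\in\mathbb R$ and $\nu_p(QMC)=\lim_{D\to\infty}\nu_p(D,H_{QMC})\in[-\infty,\infty]$ exist, and $\nu_p(QMC)\le\nu_p(XY)$. 3. $\displaystyle \nu_p(XY)=\frac i2\sum_{j=-p}^{p}\Gamma_j\Big[\big(G^{(p)}_{0,j}\big)^2-\big(G'^{(p)}_{0,j}\big)^2\Big].$ Here bitstrings $\boldsymbol a=(a_1,\dots,a_p,a_0,a_{-p},\dots,a_{-1})$ run over $\{\pm1\}^{2p+1}$, $\boldsymbol\Gamma=(\gamma_1,\dots,\gamma_p,0,-\gamma_p,\dots,-\gamma_1)$ is indexed in the same way, $$f(\boldsymbol a)=\tfrac12\langle a_1|e^{i\beta_1X}|a_2\rangle\cdots\langle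 a_{p-1}|e^{i\beta_{p-1}X}|a_p\rangle\langle a_p|e^{i\beta_pX}|a_0\rangle\langle a_0|e^{-i\beta_pX}|a_{-p}\rangle\langle a_{-p}|e^{-i\beta_{p-1}X}|a_{-(p-1)}\rangle\cdots\langle a_{-2}|e^{-i\beta_1X}|a_{-1}\rangle,$$ with $|a\rangle$ the $Z$-eigenstate of eigenvalue $a$; $f'(\boldsymbol a)$ is obtained from $f(\boldsymbol a)$ by replacing the factor $\langle a_p|e^{i\beta_pX}|a_0\rangle$ by $\langle a_p|e^{i\beta_pX}|-a_0\rangle$; and, for $-p\le j,k\le p$, $G^{(0)}_{j,k}=G'^{(0)}_{j,k}=1$ and, for $m\ge1$, $$G^{(m)}_{j,k}=\sum_{\boldsymbol a}f(\boldsymbol a)\,a_ja_k\exp\Big[-\tfrac12\sum_{j',k'}\Gamma_{j'}\Gamma_{k'}a_{j'}a_{k'}G^{(m-1)}_{j',k'}\Big],\qquad G'^{(m)}_{j,k}=\sum_{\boldsymbol a}f'(\boldsymbol a)\,a_ja_k\exp\Big[-\tfrac12\sum_{j',k'}\Gamma_{j'}\Gamma_{k'}a_{j'}a_{k'}G^{(m-1)}_{j',k'}\Big].$$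 Finally, the iteration (the matrices $G^{(p)}$, $G'^{(p)}$ and the number in item 3, from the input $p,\boldsymbol\gamma,\boldsymbol\beta$) can be evaluated in $O(p^24^p)$ time and $O(4^p)$ space, and it can be evaluated in $O(p^44^p)$ time and $O(p^2)$ space, on a random access machine with exact complex arithmetic (unit cost for $+,-,\times,\exp$ and for operations on integers of $O(p)$ bits; space is the number of complex memory cells). -/

import Mathlib

open scoped Topology

universe u

noncomputable section

namespace MCAnsatz

/-! ### Qubits

The computational basis of one qubit is labelled by the eigenvalue of the Pauli `Z` operator: the
label `1 : ℤˣ` is the ket `|0⟩` and the label `-1 : ℤˣ` is the ket `|1⟩`. -/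

/-- The complex number `1` or `-1`. -/
def sgn (a : ℤˣ) : ℂ := ((a : ℤ) : ℂ)

/-- `X|b⟩ = |-b⟩`. -/
def pauliX : Matrix ℤˣ ℤˣ ℂ := Matrix.of fun a b => if a = -b then 1 else 0

/-- `Y|b⟩ = i b |-b⟩`. -/
def pauliY : Matrix ℤˣ ℤˣ ℂ := Matrix.of fun a b => if a = -b then Complex.I * sgn b else 0

/-- `Z|b⟩ = b |b⟩`. -/
def pauliZ : Matrix ℤˣ ℤˣ ℂ := Matrix.diagonal sgn

section Graphs

variable {V : Type u} [Fintype V] [DecidableEq V]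

/-- The operator acting as the one-qubit operator `A` on the qubit at `u` and as the identity on
all other qubits. -/
def opAt (A : Matrix ℤˣ ℤˣ ℂ) (u : V) : Matrix (V → ℤˣ) (V → ℤˣ) ℂ :=
  Matrix.of fun x y => if ∀ v, v ≠ u → x v = y v then A (x u) (y u) else 0

/-- The sum of `A_u A_v` over all edges `(u,v)`. The double sum visits every edge in both
directions (the two contributions agree), whence the factor `1/2`. -/
def edgeSum (G : SimpleGraph V) [DecidableRel G.Adj] (A : Matrix ℤˣ ℤˣ ℂ) :
    Matrix (V → ℤˣ) (V → ℤˣ) ℂ :=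
  (1 / 2 : ℂ) • ∑ u : V, ∑ v ∈ G.neighborFinset u, opAt A u * opAt A v

/-- Real coefficients of the interaction `c_I I I + c_X X X + c_Y Y Y + c_Z Z Z`. -/
structure Couplings where
  cI : ℝ
  cX : ℝ
  cY : ℝ
  cZ : ℝ

/-- Quantum MaxCut. -/
def QMC : Couplings := ⟨1 / 2, -1 / 2, -1 / 2, -1 / 2⟩

/-- The XY model in the convention that keeps the `YY` and `ZZ` terms. -/
def XY : Couplings := ⟨1 / 2, 0, -1 / 2, -1 / 2⟩

/-- The EPR model. -/
def EPR : Couplings := ⟨1 / 2, 1 / 2, -1 / 2, 1 / 2⟩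

/-- The two-local Hamiltonian on the graph `G` with couplings `c`. -/
def hamiltonian (c : Couplings) (G : SimpleGraph V) [DecidableRel G.Adj] :
    Matrix (V → ℤˣ) (V → ℤˣ) ℂ :=
  (c.cI : ℂ) • edgeSum G 1 + (c.cX : ℂ) • edgeSum G pauliX
    + (c.cY : ℂ) • edgeSum G pauliY + (c.cZ : ℂ) • edgeSum G pauliZ

/-- The state `|+⟩ ⊗ ⋯ ⊗ |+⟩`. -/
def plusState : (V → ℤˣ) → ℂ := fun _ => ∏ _v : V, ((1 / Real.sqrt 2 : ℝ) : ℂ)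

/-- The state `|0⟩ ⊗ ⋯ ⊗ |0⟩` (prepared by the algorithm ZERO). -/
def zeroState : (V → ℤˣ) → ℂ := fun x => ∏ v : V, if x v = 1 then 1 else 0

/-- The mixer `B = ∑ X_v`. -/
def mixer : Matrix (V → ℤˣ) (V → ℤˣ) ℂ := ∑ v : V, opAt pauliX v

/-- The phaser `C = -(1/√D) ∑ Z_u Z_v`, the sum being over the edges. -/
def phaser (G : SimpleGraph V) [DecidableRel G.Adj] (D : ℕ) : Matrix (V → ℤˣ) (V → ℤˣ) ℂ :=
  ((-(1 / Real.sqrt D) : ℝ) : ℂ) • edgeSum G pauliZ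

/-- The state `e^{-i β_p B} e^{-i γ_p C} ⋯ e^{-i β_1 B} e^{-i γ_1 C} |+⟩^{⊗ n}` of the MC ansatz.
The angles `γ_j`, `β_j` of layer `j = 1, …, p` are `γ (j-1)`, `β (j-1)`. -/
def mcState (G : SimpleGraph V) [DecidableRel G.Adj] (D : ℕ) {p : ℕ} (γ β : Fin p → ℝ) :
    (V → ℤˣ) → ℂ :=
  Fin.foldl p
    (fun ψ j =>
      (NormedSpace.exp ((-Complex.I * (β j : ℂ)) • (mixer (V := V)))).mulVec
        ((NormedSpace.exp ((-Complex.I * (γ j : ℂ)) • phaser G D)).mulVec ψ))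
    plusState

/-- The energy per edge `⟨ψ|H|ψ⟩ / m` (the expectation is real because `H` is Hermitian). -/
def energyPerEdge (c : Couplings) (G : SimpleGraph V) [DecidableRel G.Adj]
    (ψ : (V → ℤˣ) → ℂ) : ℝ :=
  (dotProduct (star ψ) ((hamiltonian c G).mulVec ψ)).re / (G.edgeFinset.card : ℝ)

/-- The normalized energy `ν_p(D, H, MC, γ, β)`, defined on a `(D+1)`-regular graph by
`⟨H⟩ / m = c_I + ν / √D`. -/
def nu (c : Couplings) (G : SimpleGraph V) [DecidableRel G.Adj] (D : ℕ) {p : ℕ}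
    (γ β : Fin p → ℝ) : ℝ :=
  Real.sqrt D * (energyPerEdge c G (mcState G D γ β) - c.cI)

end Graphs

/-- `L` is the limit of the quantity `F`, as `D → ∞`, over the nonempty finite `(D+1)`-regular graphs
of girth larger than `2p+1`: for every neighbourhood of `L` and all large `D`, the value of `F` on
every such graph lies in the neighbourhood. The limit may be infinite. -/
def IsDegreeLimit (p : ℕ)
    (F : (V : Type u) → [Fintype V] → [DecidableEq V] → (G : SimpleGraph V) →
      [DecidableRel G.Adj] → (D : ℕ) → ℝ)
    (L : EReal) : Prop :=
  ∀ U ∈ 𝓝 L, ∀ᶠ D : ℕ in Filter.atTop,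
    ∀ (V : Type u) [Fintype V] [DecidableEq V] [Nonempty V] (G : SimpleGraph V)
      [DecidableRel G.Adj],
      G.IsRegularOfDegree (D + 1) → ((2 * p + 1 : ℕ) : ℕ∞) < G.egirth → (F V G D : EReal) ∈ U

/-! ### The infinite degree iteration

The `2p+1` labels `1, …, p, 0, -p, …, -1` of the bitstrings are represented, in this order,
by the positions `0, …, 2p` in `Fin (2p+1)`: the label `j ∈ {1, …, p}` is at position `j - 1`, the
label `0` at position `p`, and the label `-j` at position `2p + 1 - j`. -/

section Iteration

variable {p : ℕ}

/-- A `±1`-valued bitstring of length `2p+1`. -/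
abbrev Bits (p : ℕ) := Fin (2 * p + 1) → ℤˣ

/-- The position of the label `0`. -/
def mid (p : ℕ) : Fin (2 * p + 1) := ⟨p, by omega⟩

/-- The vector `Γ = (γ_1, …, γ_p, 0, -γ_p, …, -γ_1)`. -/
def Gam (γ : Fin p → ℝ) (j : Fin (2 * p + 1)) : ℝ :=
  if h : (j : ℕ) < p then γ ⟨j, h⟩
  else if h' : p < (j : ℕ) then -γ ⟨2 * p - j, by omega⟩
  else 0

/-- The matrix element `⟨a| e^{i θ X} |b⟩`. -/
def rot (θ : ℝ) (a b : ℤˣ) : ℂ :=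
  (NormedSpace.exp ((Complex.I * (θ : ℂ)) • pauliX) : Matrix ℤˣ ℤˣ ℂ) a b

/-- `½ ∏_j ⟨l_j|e^{iβ_j X}|l_{j+1}⟩ · ∏_j ⟨r_{-(j+1)}|e^{-iβ_j X}|r_{-j}⟩` over `j = 1, …, p`, with
the labels `p+1` and `-(p+1)` read as the label `0`. -/
def weight (β : Fin p → ℝ) (l r : Bits p) : ℂ :=
  (1 / 2 : ℂ)
    * (∏ i : Fin p, rot (β i) (l ⟨i, by omega⟩) (l ⟨i + 1, by omega⟩))
    * ∏ i : Fin p, rot (-β i) (r ⟨2 * p - 1 - i, by omega⟩) (r ⟨2 * p - i, by omega⟩)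

/-- The function `f`. -/
def f (β : Fin p → ℝ) (a : Bits p) : ℂ := weight β a a

/-- The function `f'`: as `f`, but with `-a_0` for `a_0` in `⟨a_p|e^{iβ_p X}|a_0⟩`. -/
def f' (β : Fin p → ℝ) (a : Bits p) : ℂ :=
  weight β (Function.update a (mid p) (-(a (mid p)))) a

/-- `exp(-½ ∑_{j,k} Γ_j Γ_k a_j a_k M_{j,k})`. -/
def gaussFactor (γ : Fin p → ℝ) (M : Matrix (Fin (2 * p + 1)) (Fin (2 * p + 1)) ℂ)
    (a : Bits p) : ℂ :=
  Complex.exp (-(1 / 2 : ℂ) *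
    ∑ j, ∑ k, (Gam γ j : ℂ) * (Gam γ k : ℂ) * sgn (a j) * sgn (a k) * M j k)

/-- The matrices `G^{(m)}`. -/
def GMat (γ β : Fin p → ℝ) : ℕ → Matrix (Fin (2 * p + 1)) (Fin (2 * p + 1)) ℂ
  | 0 => Matrix.of fun _ _ => 1
  | m + 1 => Matrix.of fun j k =>
      ∑ a : Bits p, f β a * sgn (a j) * sgn (a k) * gaussFactor γ (GMat γ β m) a

/-- The matrices `G'^{(m)}`. -/
def GMat' (γ β : Fin p → ℝ) : ℕ → Matrix (Fin (2 * p + 1)) (Fin (2 * p + 1)) ℂ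
  | 0 => Matrix.of fun _ _ => 1
  | m + 1 => Matrix.of fun j k =>
      ∑ a : Bits p, f' β a * sgn (a j) * sgn (a k) * gaussFactor γ (GMat γ β m) a

/-- `(i/2) ∑_j Γ_j [(G^{(p)}_{0,j})² - (G'^{(p)}_{0,j})²]`. -/
def nuXYFormula (γ β : Fin p → ℝ) : ℂ :=
  Complex.I / 2 *
    ∑ j, (Gam γ j : ℂ) * ((GMat γ β p (mid p) j) ^ 2 - (GMat' γ β p (mid p) j) ^ 2)

end Iteration

/-! ### Machine model

A uniform random access machine with exact complex arithmetic. A program text is fixed once and for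
all and has finitely many integer registers; its memory is an array of complex cells, addressed by
integer expressions. Every arithmetic operation, memory access, constant, test, assignment and loop
step costs one unit of time. Besides time we record the number of memory cells in use and the
largest integer that occurs, so that the integers can be required to fit into `O(p)`-bit words. -/

/-- Expressions over the integer registers (subtraction is truncated, `/` and `%` round down). -/
inductive IntExpr where
  | lit (n : ℕ)
  | reg (r : ℕ)
  | add (a b : IntExpr)
  | sub (a b : IntExpr)
  | mul (a b : IntExpr)
  | div (a b : IntExpr)
  | mod (a b : IntExpr)

/-- Expressions over the complex memory. There is no test on complex numbers. -/
inductive CxExpr where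
  | rat (q : ℚ)
  | imag
  | load (addr : IntExpr)
  | add (a b : CxExpr)
  | sub (a b : CxExpr)
  | mul (a b : CxExpr)
  | exp (a : CxExpr)

/-- Programs. `ite e P Q` runs `P` if `e` is nonzero and `Q` if `e` is zero. `loop r e P` evaluates
`e` once, to `n` say, and then runs `P` for `r = 0, 1, …, n - 1`. -/
inductive Prog where
  | skip
  | assign (r : ℕ) (e : IntExpr)
  | store (addr : IntExpr) (val : CxExpr)
  | seq (P Q : Prog)
  | ite (e : IntExpr) (P Q : Prog)
  | loop (r : ℕ) (e : IntExpr) (P : Prog)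

/-- The contents of the integer registers and of the complex memory. -/
structure State where
  reg : ℕ → ℕ
  mem : ℕ → ℂ

/-- Overwrite one integer register. -/
def State.setReg (s : State) (r n : ℕ) : State := ⟨Function.update s.reg r n, s.mem⟩

/-- Overwrite one memory cell. -/
def State.setMem (s : State) (i : ℕ) (z : ℂ) : State := ⟨s.reg, Function.update s.mem i z⟩

namespace IntExpr

/-- Value. -/
def eval (s : State) : IntExpr → ℕ
  | lit n => n
  | reg r => s.reg r
  | add a b => a.eval s + b.eval s
  | sub a b => a.eval s - b.eval s
  | mul a b => a.eval s * b.eval s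
  | div a b => a.eval s / b.eval s
  | mod a b => a.eval s % b.eval s

/-- Time to evaluate. -/
def time : IntExpr → ℕ
  | lit _ => 1
  | reg _ => 1
  | add a b => a.time + b.time + 1
  | sub a b => a.time + b.time + 1
  | mul a b => a.time + b.time + 1
  | div a b => a.time + b.time + 1
  | mod a b => a.time + b.time + 1

/-- The largest integer occurring in the evaluation. -/
def peak (s : State) : IntExpr → ℕ
  | lit n => n
  | reg r => s.reg r
  | add a b => max (max (a.peak s) (b.peak s)) (a.eval s + b.eval s)
  | sub a b => max (max (a.peak s) (b.peak s)) (a.eval s - b.eval s)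
  | mul a b => max (max (a.peak s) (b.peak s)) (a.eval s * b.eval s)
  | div a b => max (max (a.peak s) (b.peak s)) (a.eval s / b.eval s)
  | mod a b => max (max (a.peak s) (b.peak s)) (a.eval s % b.eval s)

end IntExpr

namespace CxExpr

/-- Value. -/
def eval (s : State) : CxExpr → ℂ
  | rat q => (q : ℂ)
  | imag => Complex.I
  | load addr => s.mem (addr.eval s)
  | add a b => a.eval s + b.eval s
  | sub a b => a.eval s - b.eval s
  | mul a b => a.eval s * b.eval s
  | exp a => Complex.exp (a.eval s)

/-- Time to evaluate. -/
def time : CxExpr → ℕ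
  | rat _ => 1
  | imag => 1
  | load addr => addr.time + 1
  | add a b => a.time + b.time + 1
  | sub a b => a.time + b.time + 1
  | mul a b => a.time + b.time + 1
  | exp a => a.time + 1

/-- One plus the largest address read in the evaluation (`0` if none is read). -/
def cells (s : State) : CxExpr → ℕ
  | rat _ => 0
  | imag => 0
  | load addr => addr.eval s + 1
  | add a b => max (a.cells s) (b.cells s)
  | sub a b => max (a.cells s) (b.cells s)
  | mul a b => max (a.cells s) (b.cells s)
  | exp a => a.cells s

/-- The largest integer occurring in the evaluation. -/
def peak (s : State) : CxExpr → ℕ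
  | rat _ => 0
  | imag => 0
  | load addr => addr.peak s
  | add a b => max (a.peak s) (b.peak s)
  | sub a b => max (a.peak s) (b.peak s)
  | mul a b => max (a.peak s) (b.peak s)
  | exp a => a.peak s

end CxExpr

/-- The state after `n` passes through a loop with counter register `r` and the given body. -/
def iterBody (r : ℕ) (body : State → State) (s : State) : ℕ → State
  | 0 => s
  | n + 1 => body ((iterBody r body s n).setReg r n)

namespace Prog

/-- The final state. -/
def run : Prog → State → State
  | skip, s => s
  | assign r e, s => s.setReg r (e.eval s)
  | store addr val, s => s.setMem (addr.eval s) (val.eval s)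
  | seq P Q, s => Q.run (P.run s)
  | ite e P Q, s => if e.eval s ≠ 0 then P.run s else Q.run s
  | loop r e P, s => iterBody r P.run s (e.eval s)

/-- The running time. -/
def time : Prog → State → ℕ
  | skip, _ => 1
  | assign _ e, _ => e.time + 1
  | store addr val, _ => addr.time + val.time + 1
  | seq P Q, s => P.time s + Q.time (P.run s)
  | ite e P Q, s => e.time + 1 + if e.eval s ≠ 0 then P.time s else Q.time s
  | loop r e P, s =>
      e.time + 1 +
        ∑ i ∈ Finset.range (e.eval s), (1 + P.time ((iterBody r P.run s i).setReg r i))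

/-- One plus the largest memory address accessed during the run (`0` if there is none). Up to the
constant number of integer registers this is the space used. -/
def cells : Prog → State → ℕ
  | skip, _ => 0
  | assign _ _, _ => 0
  | store addr val, s => max (addr.eval s + 1) (val.cells s)
  | seq P Q, s => max (P.cells s) (Q.cells (P.run s))
  | ite e P Q, s => if e.eval s ≠ 0 then P.cells s else Q.cells s
  | loop r e P, s =>
      (Finset.range (e.eval s)).sup fun i => P.cells ((iterBody r P.run s i).setReg r i)

/-- The largest integer occurring during the run. -/
def peak : Prog → State → ℕ
  | skip, _ => 0
  | assign _ e, s => e.peak s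
  | store addr val, s => max (addr.peak s) (val.peak s)
  | seq P Q, s => max (P.peak s) (Q.peak (P.run s))
  | ite e P Q, s => max (e.peak s) (if e.eval s ≠ 0 then P.peak s else Q.peak s)
  | loop r e P, s =>
      max (e.peak s)
        ((Finset.range (e.eval s)).sup fun i => P.peak ((iterBody r P.run s i).setReg r i))

end Prog

/-- The initial state on the input `(p, γ, β)`: register `0` holds `p`, the cells `0, …, 2p-1` hold
`γ_1, …, γ_p, β_1, …, β_p`, and everything else is zero. -/
def inputState {p : ℕ} (γ β : Fin p → ℝ) : State where
  reg := fun r => if r = 0 then p else 0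
  mem := fun i =>
    if h : i < p then ((γ ⟨i, h⟩ : ℝ) : ℂ)
    else if h' : i - p < p then ((β ⟨i - p, h'⟩ : ℝ) : ℂ)
    else 0

/-- The memory holds the result of the iteration: the number `nuXYFormula γ β` in cell `0`, followed
by the entries of `G^{(p)}` and then those of `G'^{(p)}`, row by row. -/
def HoldsResult {p : ℕ} (γ β : Fin p → ℝ) (s : State) : Prop :=
  s.mem 0 = nuXYFormula γ β ∧
  ∀ j k : Fin (2 * p + 1),
    s.mem (1 + (j * (2 * p + 1) + k)) = GMat γ β p j k ∧
    s.mem (1 + (2 * p + 1) ^ 2 + (j * (2 * p + 1) + k)) = GMat' γ β p j k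

/-- One program evaluates the iteration for all depths `p ≥ 1` and all angles, in time
`O(T p)`, using `O(S p)` memory cells and integers of `O(p)` bits. -/
def EvaluableIn (T S : ℕ → ℕ) : Prop :=
  ∃ (P : Prog) (K : ℕ), ∀ p : ℕ, 1 ≤ p → ∀ γ β : Fin p → ℝ,
    HoldsResult γ β (P.run (inputState γ β)) ∧
    P.time (inputState γ β) ≤ K * T p ∧
    P.cells (inputState γ β) ≤ K * S p ∧
    P.peak (inputState γ β) ≤ 2 ^ (K * p)

end MCAnsatz

end

/-! In the Heisenberg picture each layer enlarges the support of an observable by one neighbourhood,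
so the expectation of a two-qubit operator on an edge depends only on the ball of radius p around
that edge (`expect_layeredState_congr`). Girth larger than 2p+1 makes this ball a pair of D-ary
trees joined at their roots (`exists_levels`). Hence all edges of all admissible graphs give the
same number, a function of D alone (`expect_edge`), and the limits are uniform over the graphs.

To compute the number, insert basis states between all gates. Each qubit acquires a bitstring of
length 2p+1 (bra history, middle, ket history); its mixers give the weight f, and each edge gives
exp(-(i/√D) Σ Γ_j a_j b_j) (`expect_layeredState`). Summing the trees from the leaves inwards yields
the recursion `treeFactor`: the subtrees below a vertex contribute the D-th power of one average
over a child.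

Three properties of the recursion carry the proof. Causality: strings that are not symmetric under j
↔ -j cancel in pairs, so a subtree is normalized exactly (`sum_levelWeight_treeFactor`). Parity:
sums of terms odd under a ↦ -a vanish. Positivity: the factor is a positive semidefinite kernel of
the two halves of the string (`treeFactor_isGram`). By causality and parity the average is 1 -
(1/2D) Σ Γ_j Γ_k a_j a_k G_{jk} + O(1/D²), and its D-th power tends to the Gaussian factor with
error O(1/D) (`treeFactor_sub_limitFactor`).

At the root edge, inserting Z or Y makes the weights odd: the term of order zero vanishes, and the
coefficient of 1/√D is a sum of Γ_j times squared correlations, which is the formula for the XY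
energy. Inserting X keeps the weights even, so ⟨XX⟩ = x_D² + O(1/D), where x_D is the mean of X at a
single root; by positivity it is real and |x_D| ≤ 1. With x the limit of x_D, the EPR energy tends
to (1 + x²)/2 ≤ 1, the value of the all-zeros state. For QMC the additional term -½ √D ⟨XX⟩ tends to
-∞ if x ≠ 0, and to 0 if x = 0, because then x_D = O(1/D).

For the complexity bounds explicit programs are verified. In small space every bitstring is
processed separately. The fast step uses that the quadratic form at all strings is the
Walsh–Hadamard transform of its coefficients placed at the masks 2^j + 2^k, and that the next matrix
is read off at the same masks from a second transform. Negating one table entry turns f into f', so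
the same step also computes G'. -/

noncomputable section

namespace MCAnsatz

/-! ### Tensor products of one-qubit operators -/

/-- The exponential of a multiple of an involution. -/
theorem exp_smul_involution {m : Type*} [Fintype m] [DecidableEq m] {E : Matrix m m ℂ}
    (hE : E * E = 1) (z : ℂ) :
    NormedSpace.exp (z • E) =
      ((Complex.exp z + Complex.exp (-z)) / 2) • (1 : Matrix m m ℂ)
        + ((Complex.exp z - Complex.exp (-z)) / 2) • E := by
  let _ : NormedRing (Matrix m m ℂ) := Matrix.linftyOpNormedRing
  let _ : NormedAlgebra ℂ (Matrix m m ℂ) := Matrix.linftyOpNormedAlgebra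
  -- Functional calculus for the involution: the spectral projections are (1 ± E)/2, and `φ` assigns
  -- the two coordinates to the eigenvalues 1 and -1. It sends (z, -z) to z E, and the exponential
  -- on ℂ × ℂ is componentwise.
  let φ : ℂ × ℂ →+* Matrix m m ℂ :=
    { toFun := fun a => ((a.1 + a.2) / 2) • (1 : Matrix m m ℂ) + ((a.1 - a.2) / 2) • E
      map_one' := by simp
      map_zero' := by simp
      map_add' := fun a b => by simp only [Prod.fst_add, Prod.snd_add]; module
      map_mul' := fun a b => by
        simp only [Prod.fst_mul, Prod.snd_mul, mul_add, add_mul, Matrix.smul_mul, Matrix.mul_smul,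
          one_mul, mul_one, hE]
        module }
  have hφ : Continuous φ := by
    change Continuous fun a : ℂ × ℂ =>
      ((a.1 + a.2) / 2) • (1 : Matrix m m ℂ) + ((a.1 - a.2) / 2) • E
    fun_prop
  have h := NormedSpace.map_exp φ hφ (z, -z)
  have h1 : φ (z, -z) = z • E := by
    change ((z + -z) / 2) • (1 : Matrix m m ℂ) + ((z - -z) / 2) • E = z • E
    module
  rw [h1] at h
  refine h.symm.trans ?_
  change (((NormedSpace.exp (z, -z) : ℂ × ℂ).1 + (NormedSpace.exp (z, -z) : ℂ × ℂ).2) / 2) • _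
    + (((NormedSpace.exp (z, -z) : ℂ × ℂ).1 - (NormedSpace.exp (z, -z) : ℂ × ℂ).2) / 2) • E = _
  rw [Prod.fst_exp, Prod.snd_exp, ← Complex.exp_eq_exp_ℂ]

theorem sgn_neg (a : ℤˣ) : sgn (-a) = -sgn a := by simp [sgn]

theorem sgn_mul_self (a : ℤˣ) : sgn a * sgn a = 1 := by
  rcases Int.units_eq_one_or a with rfl | rfl <;> simp [sgn]

theorem star_sgn (a : ℤˣ) : (starRingEnd ℂ) (sgn a) = sgn a := by simp [sgn]

theorem sum_units (F : ℤˣ → ℂ) : ∑ a, F a = F 1 + F (-1) := by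
  rw [show (Finset.univ : Finset ℤˣ) = {1, -1} from rfl, Finset.sum_pair (by decide)]

theorem pauliX_mul_self : pauliX * pauliX = 1 := by
  ext a b
  rw [Matrix.mul_apply, sum_units]
  rcases Int.units_eq_one_or a with rfl | rfl <;> rcases Int.units_eq_one_or b with rfl | rfl <;>
    simp [pauliX]

/-- The bits enter only through the product of their signs. Flipping both changes nothing, and
flipping one changes the sign of the second exponential, which is how f' is later obtained from the
tables of f. -/
theorem rot_eq (θ : ℝ) (a b : ℤˣ) :
    rot θ a b = (1 / 2) * (Complex.exp (Complex.I * θ)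
      + sgn a * sgn b * Complex.exp (-(Complex.I * θ))) := by
  rw [rot, exp_smul_involution pauliX_mul_self]
  rcases Int.units_eq_one_or a with rfl | rfl <;> rcases Int.units_eq_one_or b with rfl | rfl <;>
    simp [pauliX, sgn] <;> ring

theorem rot_comm (θ : ℝ) (a b : ℤˣ) : rot θ a b = rot θ b a := by
  rw [rot_eq, rot_eq, mul_comm (sgn a)]

theorem rot_neg_neg (θ : ℝ) (a b : ℤˣ) : rot θ (-a) (-b) = rot θ a b := by
  simp only [rot_eq, sgn_neg]; ring_nf

theorem rot_zero (a b : ℤˣ) : rot 0 a b = if a = b then 1 else 0 := by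
  rw [rot_eq]
  rcases Int.units_eq_one_or a with rfl | rfl <;> rcases Int.units_eq_one_or b with rfl | rfl <;>
    simp [sgn] <;> norm_num

theorem star_rot (θ : ℝ) (a b : ℤˣ) : (starRingEnd ℂ) (rot θ a b) = rot (-θ) a b := by
  rw [rot_eq, rot_eq]
  simp only [map_mul, map_add, star_sgn, ← Complex.exp_conj, map_neg, Complex.conj_I,
    Complex.conj_ofReal, map_div₀, map_one, map_ofNat]
  push_cast
  ring_nf

section Tensor

variable {V : Type u} [Fintype V] [DecidableEq V]

/-- The tensor product of one-qubit operators. -/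
def tens (A : V → Matrix ℤˣ ℤˣ ℂ) : Matrix (V → ℤˣ) (V → ℤˣ) ℂ :=
  Matrix.of fun x y => ∏ v, A v (x v) (y v)

theorem tens_mul (A B : V → Matrix ℤˣ ℤˣ ℂ) : tens A * tens B = tens (fun v => A v * B v) := by
  ext x y
  simp only [tens, Matrix.mul_apply, Matrix.of_apply, ← Finset.prod_mul_distrib]
  rw [Finset.prod_univ_sum, Fintype.piFinset_univ]

theorem tens_one : tens (fun _ : V => (1 : Matrix ℤˣ ℤˣ ℂ)) = 1 := by
  ext x y
  simp only [tens, Matrix.of_apply, Matrix.one_apply, funext_iff]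
  rw [Finset.prod_ite_zero]
  simp

theorem opAt_eq_tens (A : Matrix ℤˣ ℤˣ ℂ) (u : V) :
    opAt A u = tens (Function.update (fun _ => 1) u A) := by
  ext x y
  simp only [opAt, tens, Matrix.of_apply]
  rw [← Finset.mul_prod_erase _ _ (Finset.mem_univ u), Function.update_self]
  have : ∏ v ∈ Finset.univ.erase u,
      (Function.update (fun _ => (1 : Matrix ℤˣ ℤˣ ℂ)) u A v) (x v) (y v)
      = ∏ v ∈ Finset.univ.erase u, if x v = y v then 1 else 0 := by
    refine Finset.prod_congr rfl fun v hv => ?_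
    rw [Function.update_of_ne (Finset.ne_of_mem_erase hv), Matrix.one_apply]
  rw [this, Finset.prod_ite_zero]
  simp

theorem opAt_mul (A B : Matrix ℤˣ ℤˣ ℂ) (u : V) : opAt A u * opAt B u = opAt (A * B) u := by
  simp only [opAt_eq_tens, tens_mul]
  congr 1; funext v
  by_cases h : v = u
  · subst h; simp
  · simp [h]

theorem opAt_one (u : V) : opAt 1 u = 1 := by
  rw [opAt_eq_tens, Function.update_eq_self_iff.2 rfl, tens_one]

theorem opAt_commute (A B : Matrix ℤˣ ℤˣ ℂ) {u v : V} (h : u ≠ v) :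
    Commute (opAt A u) (opAt B v) := by
  simp only [Commute, SemiconjBy, opAt_eq_tens, tens_mul]
  congr 1; funext w
  by_cases hu : w = u
  · subst hu; simp [h]
  · by_cases hv : w = v
    · subst hv; simp [hu]
    · simp [hu, hv]

theorem opAt_mul_opAt (A B : Matrix ℤˣ ℤˣ ℂ) {u v : V} (h : u ≠ v) :
    opAt A u * opAt B v = tens (Function.update (Function.update (fun _ => 1) u A) v B) := by
  simp only [opAt_eq_tens, tens_mul]
  congr 1; funext w
  by_cases hv : w = v
  · subst hv; simp [h.symm]
  · by_cases hu : w = u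
    · subst hu; simp [h]
    · simp [hu, hv]

theorem exp_smul_opAt_pauliX (z : ℂ) (u : V) :
    NormedSpace.exp (z • opAt pauliX u) = opAt (NormedSpace.exp (z • pauliX)) u := by
  rw [exp_smul_involution pauliX_mul_self, exp_smul_involution]
  · rw [← opAt_one u]
    ext x y
    simp only [opAt, Matrix.add_apply, Matrix.smul_apply, Matrix.of_apply]
    split_ifs <;> simp
  · rw [opAt_mul, pauliX_mul_self, opAt_one]

theorem exp_sum_opAt_pauliX (c : V → ℂ) :
    NormedSpace.exp (∑ v, c v • opAt pauliX v) = tens fun v => NormedSpace.exp (c v • pauliX) := by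
  suffices h : ∀ S : Finset V, NormedSpace.exp (∑ v ∈ S, c v • opAt pauliX v)
      = tens fun v => if v ∈ S then NormedSpace.exp (c v • pauliX) else 1 by
    simpa using h Finset.univ
  intro S
  induction S using Finset.induction_on with
  | empty => simp [tens_one, NormedSpace.exp_zero]
  | insert a S ha ih =>
    rw [Finset.sum_insert ha, Matrix.exp_add_of_commute, ih, exp_smul_opAt_pauliX, opAt_eq_tens,
      tens_mul]
    · congr 1; funext v
      by_cases h : v = a
      · subst h; simp [ha]
      · simp [h]
    · refine Commute.sum_right _ _ _ fun v hv => ?_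
      refine Commute.smul_right (Commute.smul_left (opAt_commute _ _ ?_) _) _
      rintro rfl; exact ha hv

end Tensor

/-! ### Light cones -/

section LightCone

variable {V : Type u} [Fintype V] [DecidableEq V]

theorem opAt_conjTranspose (A : Matrix ℤˣ ℤˣ ℂ) (u : V) : (opAt A u).conjTranspose = opAt A.conjTranspose u := by
  ext x y
  simp only [opAt, Matrix.conjTranspose_apply, Matrix.of_apply, eq_comm (a := y _)]
  split_ifs <;> simp

theorem pauliX_conjTranspose : pauliX.conjTranspose = pauliX := by
  ext a b
  simp only [pauliX, Matrix.conjTranspose_apply, Matrix.of_apply]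
  rcases Int.units_eq_one_or a with rfl | rfl <;> rcases Int.units_eq_one_or b with rfl | rfl <;>
    simp

theorem pauliZ_conjTranspose : pauliZ.conjTranspose = pauliZ := by
  rw [pauliZ, Matrix.diagonal_conjTranspose]
  congr 1; funext a; exact star_sgn a

theorem exp_conjTranspose_mul_exp {m : Type*} [Fintype m] [DecidableEq m] {R : Matrix m m ℂ}
    (hR : R.conjTranspose = -R) :
    (NormedSpace.exp R).conjTranspose * NormedSpace.exp R = 1 := by
  rw [← Matrix.exp_conjTranspose, hR, ← Matrix.exp_add_of_commute]
  · simp [NormedSpace.exp_zero]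
  · exact (Commute.refl R).neg_left

/-- A skew-Hermitian summand of the generator that commutes with `O` does not affect the
conjugate of `O`. -/
theorem conj_exp_eq_of_commute {m : Type*} [Fintype m] [DecidableEq m] {A R A' O : Matrix m m ℂ}
    (hA : A = R + A') (hRA : Commute R A') (hR : R.conjTranspose = -R) (hRO : Commute O R) :
    (NormedSpace.exp A).conjTranspose * O * NormedSpace.exp A
      = (NormedSpace.exp A').conjTranspose * O * NormedSpace.exp A' := by
  have h : Commute O (NormedSpace.exp R) := hRO.exp_right
  rw [hA, Matrix.exp_add_of_commute _ _ hRA, Matrix.conjTranspose_mul]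
  calc _ = (NormedSpace.exp A').conjTranspose * ((NormedSpace.exp R).conjTranspose
        * (O * NormedSpace.exp R)) * NormedSpace.exp A' := by simp only [Matrix.mul_assoc]
    _ = _ := by
        rw [h.eq, ← Matrix.mul_assoc (Matrix.conjTranspose _) _ O, exp_conjTranspose_mul_exp hR,
          Matrix.one_mul]

/-- The generator of a mixer with vertex-dependent angles. -/
def mixGen (b : V → ℝ) : Matrix (V → ℤˣ) (V → ℤˣ) ℂ :=
  ∑ v, (-Complex.I * (b v : ℂ)) • opAt pauliX v

/-- The energy `½ ∑ J_{uv} Z_u Z_v`. -/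
def coupling (J : V → V → ℝ) : Matrix (V → ℤˣ) (V → ℤˣ) ℂ :=
  (1 / 2 : ℂ) • ∑ u, ∑ v, (J u v : ℂ) • (opAt pauliZ u * opAt pauliZ v)

/-- The generator of a phaser with general couplings. -/
def phaseGen (J : V → V → ℝ) (g : ℝ) : Matrix (V → ℤˣ) (V → ℤˣ) ℂ :=
  (-Complex.I * (g : ℂ)) • coupling J

/-- One layer of the ansatz with vertex-dependent angles and general couplings. -/
def layer (J : V → V → ℝ) (b : V → ℝ) (g : ℝ) : Matrix (V → ℤˣ) (V → ℤˣ) ℂ :=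
  NormedSpace.exp (mixGen b) * NormedSpace.exp (phaseGen J g)

/-- The ansatz state with vertex-dependent angles and general couplings. -/
def layeredState (J : V → V → ℝ) {p : ℕ} (b : Fin p → V → ℝ) (γ : Fin p → ℝ) : (V → ℤˣ) → ℂ :=
  Fin.foldl p (fun ψ j => (layer J (b j) (γ j)).mulVec ψ) plusState

/-- `O` acts trivially outside `S`: it commutes with all one-qubit operators there. -/
def LocalOn (O : Matrix (V → ℤˣ) (V → ℤˣ) ℂ) (S : Set V) : Prop :=
  ∀ w ∉ S, ∀ A, Commute O (opAt A w)

theorem mixGen_add (b b' : V → ℝ) : mixGen (b + b') = mixGen b + mixGen b' := by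
  simp only [mixGen, ← Finset.sum_add_distrib, ← add_smul, Pi.add_apply]
  refine Finset.sum_congr rfl fun v _ => ?_
  congr 1; push_cast; ring

theorem coupling_add (J J' : V → V → ℝ) : coupling (J + J') = coupling J + coupling J' := by
  simp only [coupling, ← smul_add, ← Finset.sum_add_distrib, ← add_smul, Pi.add_apply]
  push_cast; rfl

theorem opAt_commute_self (A : Matrix ℤˣ ℤˣ ℂ) (u v : V) : Commute (opAt A u) (opAt A v) := by
  by_cases h : u = v
  · subst h; exact Commute.refl _
  · exact opAt_commute _ _ h

theorem mixGen_commute (b b' : V → ℝ) : Commute (mixGen b) (mixGen b') :=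
  Commute.sum_left _ _ _ fun _ _ => Commute.sum_right _ _ _ fun _ _ =>
    ((opAt_commute_self _ _ _).smul_left _).smul_right _

theorem commute_coupling {M : Matrix (V → ℤˣ) (V → ℤˣ) ℂ} {J : V → V → ℝ}
    (h : ∀ u v, J u v ≠ 0 → Commute M (opAt pauliZ u) ∧ Commute M (opAt pauliZ v)) :
    Commute M (coupling J) := by
  refine Commute.smul_right (Commute.sum_right _ _ _ fun u _ => Commute.sum_right _ _ _ fun v _ => ?_) _
  by_cases h0 : J u v = 0
  · simp [h0]
  · exact ((h u v h0).1.mul_right (h u v h0).2).smul_right _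

theorem coupling_commute (J J' : V → V → ℝ) : Commute (coupling J) (coupling J') :=
  commute_coupling fun u v _ => by
    constructor <;>
    exact (commute_coupling fun _ _ _ => ⟨opAt_commute_self _ _ _, opAt_commute_self _ _ _⟩).symm

theorem mixGen_conjTranspose (b : V → ℝ) : (mixGen b).conjTranspose = -mixGen b := by
  simp [mixGen, Matrix.conjTranspose_sum, opAt_conjTranspose, pauliX_conjTranspose]

theorem coupling_conjTranspose (J : V → V → ℝ) : (coupling J).conjTranspose = coupling J := by
  simp only [coupling, Matrix.conjTranspose_smul, Matrix.conjTranspose_sum,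
    Matrix.conjTranspose_mul, opAt_conjTranspose, pauliZ_conjTranspose]
  congr 1
  · simp
  · refine Finset.sum_congr rfl fun u _ => Finset.sum_congr rfl fun v _ => ?_
    rw [(opAt_commute_self pauliZ v u).eq]; simp

theorem phaseGen_conjTranspose (J : V → V → ℝ) (g : ℝ) :
    (phaseGen J g).conjTranspose = -phaseGen J g := by
  simp [phaseGen, coupling_conjTranspose]

/-- The difference of the two generators is a mixer supported outside `S`, so it commutes with `O`.
The same argument for phasers allows the couplings without an end in `S` to be changed. -/
theorem conj_mix_congr {O : Matrix (V → ℤˣ) (V → ℤˣ) ℂ} {S : Set V} (hO : LocalOn O S)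
    {b b' : V → ℝ} (h : ∀ v ∈ S, b v = b' v) :
    (NormedSpace.exp (mixGen b)).conjTranspose * O * NormedSpace.exp (mixGen b)
      = (NormedSpace.exp (mixGen b')).conjTranspose * O * NormedSpace.exp (mixGen b') := by
  refine conj_exp_eq_of_commute (R := mixGen (b - b')) ?_ (mixGen_commute _ _)
    (mixGen_conjTranspose _) ?_
  · rw [← mixGen_add, sub_add_cancel]
  · refine Commute.sum_right _ _ _ fun v _ => ?_
    by_cases hv : v ∈ S
    · simp [h v hv]
    · exact (hO v hv _).smul_right _

theorem conj_phase_congr {O : Matrix (V → ℤˣ) (V → ℤˣ) ℂ} {S : Set V} (hO : LocalOn O S)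
    {J J' : V → V → ℝ} (h : ∀ u v, u ∈ S ∨ v ∈ S → J u v = J' u v) (g : ℝ) :
    (NormedSpace.exp (phaseGen J g)).conjTranspose * O * NormedSpace.exp (phaseGen J g)
      = (NormedSpace.exp (phaseGen J' g)).conjTranspose * O * NormedSpace.exp (phaseGen J' g) := by
  refine conj_exp_eq_of_commute (R := phaseGen (J - J') g) ?_
    ((coupling_commute _ _).smul_left _ |>.smul_right _) (phaseGen_conjTranspose _ _) ?_
  · rw [phaseGen, phaseGen, phaseGen, ← smul_add, ← coupling_add, sub_add_cancel]
  · refine (commute_coupling fun u v huv => ?_).smul_right _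
    by_cases hs : u ∈ S ∨ v ∈ S
    · exact absurd (by simp [h u v hs]) huv
    · push Not at hs
      exact ⟨hO u hs.1 _, hO v hs.2 _⟩

/-- Angles outside `S` may be set to zero without changing the conjugate, and the truncated
generator commutes with every one-qubit operator off `S`: mixers do not spread the support. -/
theorem LocalOn.conj_mix {O : Matrix (V → ℤˣ) (V → ℤˣ) ℂ} {S : Set V} (hO : LocalOn O S)
    (b : V → ℝ) :
    LocalOn ((NormedSpace.exp (mixGen b)).conjTranspose * O * NormedSpace.exp (mixGen b)) S := by
  classical
  intro w hw A
  have hb : ∀ v ∈ S, b v = (fun v => if v ∈ S then b v else 0) v := fun v hv => by simp [hv]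
  rw [conj_mix_congr hO hb]
  set b' : V → ℝ := fun v => if v ∈ S then b v else 0 with hb'
  have h1 : Commute (mixGen b') (opAt A w) := by
    refine Commute.sum_left _ _ _ fun v _ => ?_
    by_cases hv : v ∈ S
    · exact (opAt_commute _ _ (by rintro rfl; exact hw hv)).smul_left _
    · simp [hb', hv]
  rw [← Matrix.exp_conjTranspose, mixGen_conjTranspose]
  exact ((h1.neg_left.exp_left).mul_left (hO w hw A)).mul_left h1.exp_left

/-- Once the couplings that do not meet `S` are discarded, the remaining ones live inside `T`: a
phaser spreads the support by one step. -/
theorem LocalOn.conj_phase {O : Matrix (V → ℤˣ) (V → ℤˣ) ℂ} {S T : Set V} (hO : LocalOn O S)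
    (hST : S ⊆ T) {J : V → V → ℝ}
    (h : ∀ u v, J u v ≠ 0 → u ∈ S ∨ v ∈ S → u ∈ T ∧ v ∈ T) (g : ℝ) :
    LocalOn ((NormedSpace.exp (phaseGen J g)).conjTranspose * O * NormedSpace.exp (phaseGen J g))
      T := by
  classical
  intro w hw A
  have hJ : ∀ u v, u ∈ S ∨ v ∈ S → J u v = (fun u v => if u ∈ S ∨ v ∈ S then J u v else 0) u v :=
    fun u v huv => by simp [huv]
  rw [conj_phase_congr hO hJ]
  set J' : V → V → ℝ := fun u v => if u ∈ S ∨ v ∈ S then J u v else 0 with hJ'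
  have h1 : Commute (phaseGen J' g) (opAt A w) := by
    refine (Commute.symm (commute_coupling fun u v huv => ?_)).smul_left _
    have hs : u ∈ S ∨ v ∈ S := by
      by_contra hs; simp [hJ', hs] at huv
    have hT := h u v (by simpa [hJ', hs] using huv) hs
    exact ⟨opAt_commute _ _ (by rintro rfl; exact hw hT.1),
      opAt_commute _ _ (by rintro rfl; exact hw hT.2)⟩
  rw [← Matrix.exp_conjTranspose, phaseGen_conjTranspose]
  exact ((h1.neg_left.exp_left).mul_left (hO w (fun hS => hw (hST hS)) A)).mul_left h1.exp_left

/-- The expectation value of `O`. -/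
def expect (ψ : (V → ℤˣ) → ℂ) (O : Matrix (V → ℤˣ) (V → ℤˣ) ℂ) : ℂ :=
  dotProduct (star ψ) (O.mulVec ψ)

theorem expect_mulVec (U O : Matrix (V → ℤˣ) (V → ℤˣ) ℂ) (ψ : (V → ℤˣ) → ℂ) :
    expect (U.mulVec ψ) O = expect ψ (U.conjTranspose * O * U) := by
  rw [expect, expect, Matrix.star_mulVec, ← Matrix.dotProduct_mulVec, Matrix.mulVec_mulVec,
    Matrix.mulVec_mulVec, Matrix.mul_assoc]

theorem layeredState_zero (J : V → V → ℝ) (b : Fin 0 → V → ℝ) (γ : Fin 0 → ℝ) :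
    layeredState J b γ = plusState :=
  Fin.foldl_zero _ _

theorem layeredState_succ (J : V → V → ℝ) {p : ℕ} (b : Fin (p + 1) → V → ℝ) (γ : Fin (p + 1) → ℝ) :
    layeredState J b γ = (layer J (b (Fin.last p)) (γ (Fin.last p))).mulVec
      (layeredState J (fun j => b j.castSucc) fun j => γ j.castSucc) :=
  Fin.foldl_succ_last _ _

/-- Only the angles and couplings inside the light cone contribute to an expectation value. -/
theorem expect_layeredState_congr {B : ℕ → Set V} (hB : Monotone B) {J J' : V → V → ℝ} {P : ℕ}
    (hJ : ∀ k < P, ∀ u v, J u v ≠ 0 → u ∈ B k ∨ v ∈ B k → u ∈ B (k + 1) ∧ v ∈ B (k + 1))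
    (hJJ : ∀ k < P, ∀ u v, u ∈ B k ∨ v ∈ B k → J u v = J' u v) :
    ∀ (p k : ℕ) (_ : k + p ≤ P) (b b' : Fin p → V → ℝ)
      (_ : ∀ j, ∀ k < P, ∀ v ∈ B k, b j v = b' j v) (γ : Fin p → ℝ)
      (O : Matrix (V → ℤˣ) (V → ℤˣ) ℂ) (_ : LocalOn O (B k)),
      expect (layeredState J b γ) O = expect (layeredState J' b' γ) O := by
  intro p
  induction p with
  | zero => intros; rw [layeredState_zero, layeredState_zero]
  | succ p ih =>
    intro k hk b b' hb γ O hO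
    rw [layeredState_succ, layeredState_succ, expect_mulVec, expect_mulVec]
    -- The last layer is the first to be conjugated into the observable, its mixer before its
    -- phaser. The result is local on `B (k + 1)`, and the earlier layers fall to the induction
    -- hypothesis there.
    have hconj : ∀ (J : V → V → ℝ) (b : V → ℝ) (g : ℝ), (layer J b g).conjTranspose * O * layer J b g
        = (NormedSpace.exp (phaseGen J g)).conjTranspose
          * ((NormedSpace.exp (mixGen b)).conjTranspose * O * NormedSpace.exp (mixGen b))
          * NormedSpace.exp (phaseGen J g) := fun J b g => by
      simp only [layer, Matrix.conjTranspose_mul, Matrix.mul_assoc]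
    have hmix := hO.conj_mix (b (Fin.last p))
    have hO' := hmix.conj_phase (hB (Nat.le_succ k)) (hJ k (by omega)) (γ (Fin.last p))
    have heq : (layer J (b (Fin.last p)) (γ (Fin.last p))).conjTranspose * O
          * layer J (b (Fin.last p)) (γ (Fin.last p))
        = (layer J' (b' (Fin.last p)) (γ (Fin.last p))).conjTranspose * O
          * layer J' (b' (Fin.last p)) (γ (Fin.last p)) := by
      rw [hconj, hconj, conj_phase_congr hmix (hJJ k (by omega)),
        conj_mix_congr hO (hb (Fin.last p) k (by omega))]
    rw [← heq, hconj]
    exact ih (k + 1) (by omega) (fun j => b j.castSucc) (fun j => b' j.castSucc)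
      (fun j => hb j.castSucc) (fun j => γ j.castSucc) _ hO'

end LightCone

/-! ### Sums over histories -/

section PathSum

variable {V : Type u} [Fintype V] [DecidableEq V]

/-- The value of the coupling energy on a computational basis state. -/
def isingEnergy (J : V → V → ℝ) (x : V → ℤˣ) : ℂ :=
  (1 / 2 : ℂ) * ∑ u, ∑ v, (J u v : ℂ) * (sgn (x u) * sgn (x v))

theorem opAt_pauliZ (u : V) : opAt pauliZ u = Matrix.diagonal fun x => sgn (x u) := by
  ext x y
  simp only [opAt, pauliZ, Matrix.diagonal_apply, Matrix.of_apply]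
  by_cases h : x = y
  · subst h; simp
  · rw [if_neg h]
    split_ifs with h1 h2
    · exact absurd (funext fun v => if hv : v = u then hv ▸ h2 else h1 v hv) h
    · rfl
    · rfl

theorem coupling_eq_diagonal (J : V → V → ℝ) : coupling J = Matrix.diagonal (isingEnergy J) := by
  have h : ∀ u v, (J u v : ℂ) • (opAt pauliZ u * opAt pauliZ v)
      = Matrix.diagonal fun x => (J u v : ℂ) * (sgn (x u) * sgn (x v)) := fun u v => by
    rw [opAt_pauliZ, opAt_pauliZ, Matrix.diagonal_mul_diagonal, ← Matrix.diagonal_smul]; rfl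
  ext x y
  simp only [coupling, h, Matrix.smul_apply, Matrix.sum_apply]
  by_cases hxy : x = y
  · subst hxy; simp [isingEnergy]
  · simp [hxy]

theorem layer_apply (J : V → V → ℝ) (b : V → ℝ) (g : ℝ) (x y : V → ℤˣ) :
    layer J b g x y = (∏ v, rot (-b v) (x v) (y v)) * Complex.exp (-(Complex.I * g * isingEnergy J y)) := by
  have h1 : NormedSpace.exp (phaseGen J g)
      = Matrix.diagonal fun x => Complex.exp (-(Complex.I * g * isingEnergy J x)) := by
    rw [phaseGen, coupling_eq_diagonal, ← Matrix.diagonal_smul, Matrix.exp_diagonal]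
    congr 1; funext x
    rw [Pi.coe_exp, ← Complex.exp_eq_exp_ℂ]
    simp
  rw [layer, h1, Matrix.mul_diagonal, mixGen, exp_sum_opAt_pauliX]
  congr 1
  simp only [tens, Matrix.of_apply, rot]
  refine Finset.prod_congr rfl fun v _ => ?_
  rw [show Complex.I * ((-b v : ℝ) : ℂ) = -Complex.I * b v by push_cast; ring]

/-- The amplitude of a history `X 0, X 1, …, X p` of the whole register. -/
def amplitude (J : V → V → ℝ) {p : ℕ} (b : Fin p → V → ℝ) (γ : Fin p → ℝ)
    (X : Fin (p + 1) → V → ℤˣ) : ℂ :=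
  (∏ _v : V, ((1 / Real.sqrt 2 : ℝ) : ℂ)) * ∏ j : Fin p,
    ((∏ v, rot (-b j v) (X j.succ v) (X j.castSucc v))
      * Complex.exp (-(Complex.I * γ j * isingEnergy J (X j.castSucc))))

theorem sum_snoc {α : Type*} [Fintype α] {p : ℕ} (F : (Fin (p + 1) → α) → ℂ) :
    ∑ X, F X = ∑ z, ∑ x, F (Fin.snoc (α := fun _ => α) x z) := by
  rw [← (Fin.snocEquiv fun _ : Fin (p + 1) => α).sum_comp, Fintype.sum_prod_type]
  rfl

theorem layeredState_apply (J : V → V → ℝ) {p : ℕ} (b : Fin p → V → ℝ) (γ : Fin p → ℝ)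
    (y : V → ℤˣ) :
    layeredState J b γ y
      = ∑ x : Fin p → V → ℤˣ, amplitude J b γ (Fin.snoc (α := fun _ => V → ℤˣ) x y) := by
  induction p generalizing y with
  | zero => simp [layeredState_zero, plusState, amplitude]
  | succ p ih =>
    rw [layeredState_succ, Matrix.mulVec, dotProduct, sum_snoc]
    refine Finset.sum_congr rfl fun z _ => ?_
    rw [ih, Finset.mul_sum]
    refine Finset.sum_congr rfl fun x _ => ?_
    rw [layer_apply, amplitude, amplitude, Fin.prod_univ_castSucc (n := p)]
    have h1 : ∀ j : Fin (p + 1), (Fin.snoc (Fin.snoc x z : Fin (p + 1) → V → ℤˣ) y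
        : Fin (p + 2) → V → ℤˣ) j.castSucc = (Fin.snoc x z : Fin (p + 1) → V → ℤˣ) j :=
      fun j => Fin.snoc_castSucc _ _ _
    simp only [h1, Fin.succ_castSucc, Fin.succ_last, Fin.snoc_last]
    ring

/-- Assemble a bitstring from its left half, its middle and its right half. -/
def joinBits {α : Type*} {p : ℕ} (l : Fin p → α) (y : α) (r : Fin p → α) (i : Fin (2 * p + 1)) : α :=
  if h : (i : ℕ) < p then l ⟨i, h⟩
  else if h' : p < (i : ℕ) then r ⟨2 * p - i, by omega⟩
  else y

theorem joinBits_mid {α : Type*} {p : ℕ} (l : Fin p → α) (y : α) (r : Fin p → α) :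
    joinBits l y r (mid p) = y := by
  simp [joinBits, mid]

theorem joinBits_left {α : Type*} {p : ℕ} (l : Fin p → α) (y : α) (r : Fin p → α) (i : Fin p) :
    joinBits l y r ⟨i, by omega⟩ = l i := by
  simp [joinBits]

theorem joinBits_right {α : Type*} {p : ℕ} (l : Fin p → α) (y : α) (r : Fin p → α) (i : Fin p) :
    joinBits l y r ⟨2 * p - i, by omega⟩ = r i := by
  have h1 : ¬ (2 * p - (i : ℕ) < p) := by omega
  have h2 : p < 2 * p - (i : ℕ) := by omega
  simp only [joinBits, h1, h2, dif_pos, dif_neg, not_false_eq_true]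
  congr 1; ext; simp; omega

/-- Bitstrings are triples of a left half, a middle and a right half. -/
def joinEquiv (α : Type*) (p : ℕ) : (Fin p → α) × α × (Fin p → α) ≃ (Fin (2 * p + 1) → α) where
  toFun t := joinBits t.1 t.2.1 t.2.2
  invFun a := (fun i => a ⟨i, by omega⟩, a (mid p), fun i => a ⟨2 * p - i, by omega⟩)
  left_inv t := by
    refine Prod.ext (funext fun i => joinBits_left _ _ _ i)
      (Prod.ext (joinBits_mid _ _ _) (funext fun i => joinBits_right _ _ _ i))
  right_inv a := by
    funext i
    simp only [joinBits]
    split_ifs with h1 h2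
    · rfl
    · congr 1; ext; simp; omega
    · congr 1; ext; simp [mid]; omega

theorem sum_joinBits {α : Type*} [Fintype α] {p : ℕ} (F : (Fin (2 * p + 1) → α) → ℂ) :
    ∑ a, F a = ∑ l, ∑ y, ∑ r, F (joinBits l y r) := by
  rw [← (joinEquiv α p).sum_comp]
  simp only [Fintype.sum_prod_type]
  rfl

/-- Cutting a string at its middle separates the bra history `l`, ending in `z`, from the ket
history `r`, ending in `y`. The right half is stored mirrored, so both histories run from the
outside in. -/
theorem weight_joinBits {p : ℕ} (β : Fin p → ℝ) (l r : Fin p → ℤˣ) (z y : ℤˣ) :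
    weight β (Function.update (joinBits l y r) (mid p) z) (joinBits l y r)
      = (1 / 2) * (∏ i : Fin p, rot (β i) ((Fin.snoc l z : Fin (p + 1) → ℤˣ) i.castSucc)
          ((Fin.snoc l z : Fin (p + 1) → ℤˣ) i.succ))
        * ∏ i : Fin p, rot (-β i) ((Fin.snoc r y : Fin (p + 1) → ℤˣ) i.succ)
          ((Fin.snoc r y : Fin (p + 1) → ℤˣ) i.castSucc) := by
  have hl : ∀ i (hi : i < p + 1), Function.update (joinBits l y r) (mid p) z ⟨i, by omega⟩
      = (Fin.snoc l z : Fin (p + 1) → ℤˣ) ⟨i, hi⟩ := fun i hi => by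
    by_cases h : i < p
    · rw [Function.update_of_ne (fun h' => by simp [mid, Fin.ext_iff] at h'; omega), joinBits_left _ _ _ ⟨i, h⟩]
      exact (Fin.snoc_castSucc (α := fun _ => ℤˣ) z l ⟨i, h⟩).symm
    · obtain rfl : i = p := by omega
      exact (Function.update_self _ _ _).trans (Fin.snoc_last (α := fun _ => ℤˣ) z l).symm
  have hr : ∀ i (hi : i < p + 1), joinBits l y r ⟨2 * p - i, by omega⟩
      = (Fin.snoc r y : Fin (p + 1) → ℤˣ) ⟨i, hi⟩ := fun i hi => by
    by_cases h : i < p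
    · rw [joinBits_right _ _ _ ⟨i, h⟩]
      exact (Fin.snoc_castSucc (α := fun _ => ℤˣ) y r ⟨i, h⟩).symm
    · obtain rfl : i = p := by omega
      refine Eq.trans ?_ (Fin.snoc_last (α := fun _ => ℤˣ) y r).symm
      refine Eq.trans (congrArg _ (Fin.ext ?_)) (joinBits_mid l y r)
      simp [mid]; omega
  rw [weight]
  congr 2
  · congr 1
    funext i
    rw [hl i (by omega), hl (i + 1) (by omega)]; rfl
  · funext i
    have := hr (i + 1) (by omega)
    rw [hr i (by omega)]
    simp only [show 2 * p - 1 - (i : ℕ) = 2 * p - (i + 1) by omega]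
    rw [this]; rfl

/-- Γ is odd under reflection of the positions and zero in the middle, so positions i and 2p - i
contribute as a pair. -/
theorem sum_Gam_mul {p : ℕ} (γ : Fin p → ℝ) (F : Fin (2 * p + 1) → ℂ) :
    ∑ j, (Gam γ j : ℂ) * F j
      = ∑ i : Fin p, (γ i : ℂ) * (F ⟨i, by omega⟩ - F ⟨2 * p - i, by omega⟩) := by
  have h : ∀ j, (Gam γ j : ℂ) = ∑ i : Fin p, (γ i : ℂ) *
      ((if j = ⟨i, by omega⟩ then 1 else 0) - (if j = ⟨2 * p - i, by omega⟩ then 1 else 0)) := by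
    intro j
    simp only [Gam]
    split_ifs with h1 h2
    · rw [Finset.sum_eq_single ⟨j, h1⟩]
      · simp [Fin.ext_iff, show (j : ℕ) ≠ 2 * p - j by omega]
      · intro i _ hi
        have : (j : ℕ) ≠ i := fun h => hi (Fin.ext h.symm)
        simp [Fin.ext_iff, this, show (j : ℕ) ≠ 2 * p - i by omega]
      · simp
    · rw [Finset.sum_eq_single ⟨2 * p - j, by omega⟩]
      · rw [if_neg fun h => by simp [Fin.ext_iff] at h; omega,
          if_pos (Fin.ext (by simp; omega))]
        push_cast; ring
      · intro i _ hi
        have : (j : ℕ) ≠ 2 * p - i := fun h => hi (Fin.ext (by simp; omega))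
        simp [Fin.ext_iff, this, show (j : ℕ) ≠ i by omega]
      · simp
    · rw [Finset.sum_eq_zero]
      · simp
      · intro i _
        simp [Fin.ext_iff, show (j : ℕ) ≠ i by omega, show (j : ℕ) ≠ 2 * p - i by omega]
  simp only [h, Finset.sum_mul]
  rw [Finset.sum_comm]
  refine Finset.sum_congr rfl fun i _ => ?_
  simp only [mul_assoc, ← Finset.mul_sum, sub_mul, Finset.sum_sub_distrib, ite_mul, one_mul,
    zero_mul, Finset.sum_ite_eq', Finset.mem_univ, if_true]

/-- The one-qubit operator `|b⟩ ↦ c(b)|εb⟩`. -/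
def signedFlip (ε : ℤˣ) (c : ℤˣ → ℂ) : Matrix ℤˣ ℤˣ ℂ :=
  Matrix.of fun a b => if a = ε * b then c b else 0

theorem expect_tens_signedFlip (ψ : (V → ℤˣ) → ℂ) (ε : V → ℤˣ) (c : V → ℤˣ → ℂ) :
    expect ψ (tens fun v => signedFlip (ε v) (c v))
      = ∑ y : V → ℤˣ, (∏ v, c v (y v)) * ((starRingEnd ℂ) (ψ fun v => ε v * y v) * ψ y) := by
  simp only [expect, dotProduct, Matrix.mulVec, Finset.mul_sum]
  rw [Finset.sum_comm]
  refine Finset.sum_congr rfl fun y _ => ?_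
  rw [Finset.sum_eq_single fun v => ε v * y v]
  · simp only [tens, signedFlip, Matrix.of_apply, if_true, Pi.star_apply, RCLike.star_def]
    ring
  · intro x _ hx
    obtain ⟨v, hv⟩ := Function.ne_iff.1 hx
    have : tens (fun v => signedFlip (ε v) (c v)) x y = 0 :=
      Finset.prod_eq_zero (Finset.mem_univ v) (by simp [signedFlip, hv])
    simp [this]
  · simp

/-- The expectation value of a product operator as a sum over the histories of all qubits. -/
theorem expect_layeredState (J : V → V → ℝ) {p : ℕ} (b : Fin p → V → ℝ) (γ : Fin p → ℝ)
    (ε : V → ℤˣ) (c : V → ℤˣ → ℂ) :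
    expect (layeredState J b γ) (tens fun v => signedFlip (ε v) (c v))
      = ∑ σ : V → Bits p, (∏ v, (c v (σ v (mid p)) * weight (fun j => b j v)
          (Function.update (σ v) (mid p) (ε v * σ v (mid p))) (σ v)))
        * Complex.exp (Complex.I * ∑ j, (Gam γ j : ℂ) * isingEnergy J fun v => σ v j) := by
  -- A string at every vertex is the same as a configuration of the register at every position. The
  -- middle configuration `y` links the two histories: the ket ends in `y` and the bra in `ε y`.
  rw [expect_tens_signedFlip, ← (Equiv.piComm fun (_ : Fin (2 * p + 1)) (_ : V) => ℤˣ).sum_comp,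
    sum_joinBits, Finset.sum_comm]
  refine Finset.sum_congr rfl fun y _ => ?_
  rw [layeredState_apply, layeredState_apply, map_sum, Finset.sum_mul_sum, Finset.mul_sum]
  refine Finset.sum_congr rfl fun l _ => ?_
  rw [Finset.mul_sum]
  refine Finset.sum_congr rfl fun r _ => ?_
  have hj : ∀ v, ((Equiv.piComm fun (_ : Fin (2 * p + 1)) (_ : V) => ℤˣ) (joinBits l y r)) v
      = joinBits (fun j => l j v) (y v) (fun j => r j v) := fun v => by
    funext i
    change joinBits l y r i v = _
    simp only [joinBits]
    split_ifs <;> rfl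
  have hs : ∀ (x : Fin p → V → ℤˣ) (z : V → ℤˣ) (i : Fin (p + 1)) (v : V),
      (Fin.snoc x z : Fin (p + 1) → V → ℤˣ) i v
        = (Fin.snoc (fun j => x j v) (z v) : Fin (p + 1) → ℤˣ) i := fun x z i v => by
    refine Fin.lastCases ?_ (fun j => ?_) i
    · simp only [Fin.snoc_last]
    · simp only [Fin.snoc_castSucc]
  have hE : ∀ x, (starRingEnd ℂ) (isingEnergy J x) = isingEnergy J x := fun x => by
    simp only [isingEnergy, map_mul, map_sum, star_sgn, Complex.conj_ofReal, map_div₀, map_one,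
      map_ofNat]
  simp only [hj, joinBits_mid, weight_joinBits, sum_Gam_mul, joinBits_left, joinBits_right]
  have hconj : (starRingEnd ℂ) (amplitude J b γ
        (Fin.snoc (α := fun _ => V → ℤˣ) l fun v => ε v * y v))
      = (∏ _v : V, ((1 / Real.sqrt 2 : ℝ) : ℂ)) * ∏ j : Fin p,
        ((∏ v, rot (b j v) ((Fin.snoc (fun j => l j v) (ε v * y v) : Fin (p + 1) → ℤˣ) j.castSucc)
            ((Fin.snoc (fun j => l j v) (ε v * y v) : Fin (p + 1) → ℤˣ) j.succ))
          * Complex.exp (Complex.I * γ j * isingEnergy J (l j))) := by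
    rw [amplitude, map_mul, map_prod, map_prod]
    congr 1
    · simp only [Complex.conj_ofReal]
    · refine Finset.prod_congr rfl fun j _ => ?_
      rw [map_mul, map_prod, ← Complex.exp_conj, map_neg, map_mul, map_mul, hE, Complex.conj_I,
        Complex.conj_ofReal, Fin.snoc_castSucc]
      congr 1
      · refine Finset.prod_congr rfl fun v _ => ?_
        rw [star_rot, neg_neg, rot_comm, hs, Fin.snoc_castSucc]
      · congr 1; ring
  have hhalf : (∏ _v : V, ((1 / Real.sqrt 2 : ℝ) : ℂ)) * (∏ _v : V, ((1 / Real.sqrt 2 : ℝ) : ℂ))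
      = ∏ _v : V, (1 / 2 : ℂ) := by
    rw [← Finset.prod_mul_distrib]
    refine Finset.prod_congr rfl fun v _ => ?_
    rw [← Complex.ofReal_mul, div_mul_div_comm, Real.mul_self_sqrt (by norm_num)]
    push_cast; ring
  rw [hconj, amplitude]
  have hexp : Complex.exp (Complex.I * ∑ i : Fin p, (γ i : ℂ)
        * (isingEnergy J (fun v => l i v) - isingEnergy J (fun v => r i v)))
      = (∏ i : Fin p, Complex.exp (Complex.I * γ i * isingEnergy J (l i)))
        * ∏ i : Fin p, Complex.exp (-(Complex.I * γ i * isingEnergy J (r i))) := by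
    rw [← Complex.exp_sum, ← Complex.exp_sum, ← Complex.exp_add, ← Finset.sum_add_distrib,
      Finset.mul_sum]
    congr 1
    refine Finset.sum_congr rfl fun i _ => ?_
    ring
  rw [hexp]
  simp only [Finset.prod_mul_distrib, ← hhalf, hs, Fin.snoc_castSucc]
  simp only [Finset.prod_comm (s := (Finset.univ : Finset (Fin p)))]
  ring

end PathSum

/-! ### Summation over trees -/

section Elimination

variable {V : Type u} [Fintype V] [DecidableEq V] {α : Type*} [Fintype α]

theorem prod_update_mul (g : V → α → ℂ) (w : V) (σ : V → α) (b : α) :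
    (∏ x, g x (Function.update σ w b x)) * g w (σ w) = (∏ x, g x (σ x)) * g w b := by
  rw [← Finset.mul_prod_erase _ _ (Finset.mem_univ w), ← Finset.mul_prod_erase _ (fun x => g x (σ x))
    (Finset.mem_univ w), Function.update_self]
  have : ∏ x ∈ Finset.univ.erase w, g x (Function.update σ w b x)
      = ∏ x ∈ Finset.univ.erase w, g x (σ x) :=
    Finset.prod_congr rfl fun x hx => by rw [Function.update_of_ne (Finset.ne_of_mem_erase hx)]
  rw [this]; ring

/-- Averaging over one variable does not change a product expectation. -/
theorem sum_prod_average (g : V → α → ℂ) (w : V) (hw : ∑ b, g w b = 1) (Φ : (V → α) → ℂ) :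
    ∑ σ, (∏ x, g x (σ x)) * Φ σ
      = ∑ σ, (∏ x, g x (σ x)) * ∑ b, g w b * Φ (Function.update σ w b) := by
  -- Adjoin an independent copy of the variable at `w`, of total weight one, and exchange it with
  -- the original.
  let e : (V → α) × α ≃ (V → α) × α := Function.Involutive.toPerm
    (fun s => (Function.update s.1 w s.2, s.1 w)) fun s => by simp
  calc _ = ∑ σ, ∑ b, (∏ x, g x (σ x)) * g w b * Φ σ := by
        refine Finset.sum_congr rfl fun σ _ => ?_
        rw [← Finset.sum_mul, ← Finset.mul_sum, hw, mul_one]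
    _ = ∑ s : (V → α) × α, (∏ x, g x (s.1 x)) * g w s.2 * Φ s.1 := by
        rw [Fintype.sum_prod_type]
    _ = ∑ s : (V → α) × α, (∏ x, g x (s.1 x)) * g w s.2 * Φ (Function.update s.1 w s.2) := by
        rw [← e.sum_comp]
        refine Finset.sum_congr rfl fun s _ => ?_
        change (∏ x, g x (Function.update s.1 w s.2 x)) * g w (s.1 w)
          * Φ (Function.update s.1 w s.2) = _
        rw [prod_update_mul]
    _ = _ := by
        rw [Fintype.sum_prod_type]
        refine Finset.sum_congr rfl fun σ _ => ?_
        rw [Finset.mul_sum]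
        exact Finset.sum_congr rfl fun b _ => mul_assoc _ _ _

/-- Summation over all variables in `L`, each of which is coupled to one variable outside `L`. -/
theorem sum_prod_eliminate (g : V → α → ℂ) (par : V → V) (φ : V → α → α → ℂ) (L : Finset V) :
    (∀ w ∈ L, ∑ b, g w b = 1) → (∀ w ∈ L, par w ∉ L) → ∀ F : (V → α) → ℂ,
      (∀ w ∈ L, ∀ σ b, F (Function.update σ w b) = F σ) →
      ∑ σ, (∏ x, g x (σ x)) * (F σ * ∏ w ∈ L, φ w (σ w) (σ (par w)))
        = ∑ σ, (∏ x, g x (σ x)) * (F σ * ∏ w ∈ L, ∑ b, g w b * φ w b (σ (par w))) := by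
  induction L using Finset.induction_on with
  | empty => intros; simp
  | insert a L ha ih =>
    intro hg hpar F hF
    have hne : ∀ w ∈ insert a L, ∀ w' ∈ insert a L, par w ≠ w' :=
      fun w hw w' hw' h => hpar w hw (h ▸ hw')
    have haL : ∀ w ∈ L, a ≠ w := fun w hw h => ha (h ▸ hw)
    have h1 := ih (fun w hw => hg w (Finset.mem_insert_of_mem hw))
      (fun w hw h => hpar w (Finset.mem_insert_of_mem hw) (Finset.mem_insert_of_mem h))
      (fun σ => F σ * φ a (σ a) (σ (par a))) (fun w hw σ b => by
        rw [hF w (Finset.mem_insert_of_mem hw), Function.update_of_ne (haL w hw),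
          Function.update_of_ne (hne a (Finset.mem_insert_self _ _) w
            (Finset.mem_insert_of_mem hw))])
    simp only [Finset.prod_insert ha]
    simp only [mul_assoc] at h1
    rw [h1, sum_prod_average g a (hg a (Finset.mem_insert_self _ _))]
    refine Finset.sum_congr rfl fun σ _ => ?_
    congr 1
    have hrest : ∀ b, ∏ w ∈ L, ∑ c, g w c * φ w c (Function.update σ a b (par w))
        = ∏ w ∈ L, ∑ c, g w c * φ w c (σ (par w)) := fun b =>
      Finset.prod_congr rfl fun w hw => by
        rw [Function.update_of_ne (hne w (Finset.mem_insert_of_mem hw) a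
          (Finset.mem_insert_self _ _))]
    simp only [hF a (Finset.mem_insert_self _ _), Function.update_self, hrest,
      Function.update_of_ne (hne a (Finset.mem_insert_self _ _) a (Finset.mem_insert_self _ _))]
    rw [Finset.sum_mul, Finset.mul_sum]
    exact Finset.sum_congr rfl fun b _ => by ring

/-- Expanding Ψ in indicator functions of the two values makes each summand a product over the
vertices, in which every vertex other than `u` and `v` contributes its total weight 1. -/
theorem sum_prod_pair [DecidableEq α] (g : V → α → ℂ) {u v : V} (huv : u ≠ v)
    (hg : ∀ w, w ≠ u → w ≠ v → ∑ b, g w b = 1) (Ψ : α → α → ℂ) :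
    ∑ σ : V → α, (∏ x, g x (σ x)) * Ψ (σ u) (σ v) = ∑ a, ∑ b, g u a * g v b * Ψ a b := by
  have h1 : ∀ a b, ∑ σ : V → α, (∏ x, g x (σ x)) * ((if σ u = a then 1 else 0)
      * (if σ v = b then 1 else 0)) = g u a * g v b := fun a b => by
    have h2 : ∀ σ : V → α, (∏ x, g x (σ x)) * ((if σ u = a then 1 else 0)
        * (if σ v = b then 1 else 0)) = ∏ x, (g x (σ x) * (if x = u then (if σ x = a then 1 else 0)
          else if x = v then (if σ x = b then 1 else 0) else 1)) := fun σ => by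
      rw [Finset.prod_mul_distrib]
      congr 1
      rw [← Finset.mul_prod_erase _ _ (Finset.mem_univ u), if_pos rfl,
        ← Finset.mul_prod_erase _ _ (Finset.mem_erase.2 ⟨huv.symm, Finset.mem_univ v⟩),
        if_neg huv.symm, if_pos rfl, Finset.prod_eq_one, mul_one]
      intro x hx
      rw [Finset.mem_erase, Finset.mem_erase] at hx
      rw [if_neg hx.2.1, if_neg hx.1]
    simp only [h2]
    have h3 := Finset.prod_univ_sum (fun _ : V => (Finset.univ : Finset α))
      (fun x y => g x y * (if x = u then (if y = a then (1 : ℂ) else 0)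
        else if x = v then (if y = b then 1 else 0) else 1))
    rw [Fintype.piFinset_univ] at h3
    rw [← h3, ← Finset.mul_prod_erase _ _ (Finset.mem_univ u),
      ← Finset.mul_prod_erase _ _ (Finset.mem_erase.2 ⟨huv.symm, Finset.mem_univ v⟩),
      Finset.prod_eq_one]
    · simp [huv.symm]
    · intro x hx
      rw [Finset.mem_erase, Finset.mem_erase] at hx
      simp only [if_neg hx.2.1, if_neg hx.1, mul_one]
      exact hg x hx.2.1 hx.1
  calc _ = ∑ σ : V → α, ∑ a, ∑ b, ((∏ x, g x (σ x)) * ((if σ u = a then 1 else 0)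
        * (if σ v = b then 1 else 0))) * Ψ a b := by
        refine Finset.sum_congr rfl fun σ _ => ?_
        simp
    _ = _ := by
        rw [Finset.sum_comm]
        refine Finset.sum_congr rfl fun a _ => ?_
        rw [Finset.sum_comm]
        refine Finset.sum_congr rfl fun b _ => ?_
        rw [← Finset.sum_mul, h1]

/-- The factor contributed by a subtree of depth `m` with branching number `D`, where `gl i` is the
weight of the vertices above subtrees of depth `i`. -/
def branchFactor (K : α → α → ℂ) (gl : ℕ → α → ℂ) (D : ℕ) : ℕ → α → ℂ
  | 0 => fun _ => 1
  | m + 1 => fun a => (∑ b, gl m b * (K b a * branchFactor K gl D m b)) ^ D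

theorem branchFactor_succ (K : α → α → ℂ) (gl : ℕ → α → ℂ) (D m : ℕ) (a : α) :
    branchFactor K gl D (m + 1) a
      = (∑ b, gl m b * (K b a * branchFactor K gl D m b)) ^ D := rfl

/-- After `j` rounds the `j` outermost levels are summed out, and every vertex at level `P - j`
carries the factor of its whole subtree. Weights and factors are indexed by the height above the
leaves. Vertices beyond level `P` are not touched. -/
theorem sum_prod_levels (K : α → α → ℂ) (gl : ℕ → α → ℂ) {D P : ℕ} (g : V → α → ℂ)
    (lev : V → ℕ) (par : V → V) (hg : ∀ w, 1 ≤ lev w → lev w ≤ P → g w = gl (P - lev w))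
    (hsum : ∀ m, ∑ b, gl m b = 1)
    (hpar : ∀ w, 1 ≤ lev w → lev w ≤ P → lev (par w) + 1 = lev w)
    (hdeg : ∀ x, lev x < P →
      (Finset.univ.filter fun w => lev w = lev x + 1 ∧ par w = x).card = D)
    (K0 : (V → α) → ℂ) (hK0 : ∀ w, 1 ≤ lev w → ∀ σ b, K0 (Function.update σ w b) = K0 σ) (j : ℕ)
    (hj : j ≤ P) :
    ∑ σ, (∏ x, g x (σ x)) * (K0 σ * ∏ w with 1 ≤ lev w ∧ lev w ≤ P, K (σ w) (σ (par w)))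
      = ∑ σ, (∏ x, g x (σ x)) * (K0 σ * (∏ w with 1 ≤ lev w ∧ lev w ≤ P - j,
          K (σ w) (σ (par w))) * ∏ w with lev w = P - j, branchFactor K gl D j (σ w)) := by
  induction j with
  | zero => simp [branchFactor]
  | succ j ih =>
    rw [ih (by omega)]
    set k := P - (j + 1) with hk
    have hk1 : P - j = k + 1 := by omega
    have hPk : P - (k + 1) = j := by omega
    rw [hk1]
    have hdisj : Disjoint (Finset.univ.filter fun w => 1 ≤ lev w ∧ lev w ≤ k)
        (Finset.univ.filter fun w => lev w = k + 1) :=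
      Finset.disjoint_filter.2 fun w _ h1 h2 => by omega
    have hunion : (Finset.univ.filter fun w => 1 ≤ lev w ∧ lev w ≤ k + 1)
        = (Finset.univ.filter fun w => 1 ≤ lev w ∧ lev w ≤ k)
          ∪ Finset.univ.filter fun w => lev w = k + 1 := by
      ext w; simp; omega
    have h1 := sum_prod_eliminate g par (fun _ b a => K b a * branchFactor K gl D j b)
      (Finset.univ.filter fun w => lev w = k + 1)
      (fun w hw => by
        simp only [Finset.mem_filter_univ] at hw
        rw [hg w (by omega) (by omega), hsum])
      (fun w hw h => by
        simp only [Finset.mem_filter_univ] at hw h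
        have := hpar w (by omega) (by omega)
        omega)
      (fun σ => K0 σ * ∏ w with 1 ≤ lev w ∧ lev w ≤ k, K (σ w) (σ (par w)))
      (fun w hw σ b => by
        simp only [Finset.mem_filter_univ] at hw
        rw [hK0 w (by omega)]
        congr 1
        refine Finset.prod_congr rfl fun x hx => ?_
        simp only [Finset.mem_filter_univ] at hx
        have := hpar x hx.1 (by omega)
        rw [Function.update_of_ne (by rintro rfl; omega),
          Function.update_of_ne (by rintro rfl; omega)])
    have h2 : ∀ σ : V → α, K0 σ * (∏ w with 1 ≤ lev w ∧ lev w ≤ k + 1, K (σ w) (σ (par w)))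
          * ∏ w with lev w = k + 1, branchFactor K gl D j (σ w)
        = K0 σ * (∏ w with 1 ≤ lev w ∧ lev w ≤ k, K (σ w) (σ (par w)))
          * ∏ w with lev w = k + 1, K (σ w) (σ (par w)) * branchFactor K gl D j (σ w) :=
      fun σ => by
        rw [hunion, Finset.prod_union hdisj, Finset.prod_mul_distrib]; ring
    simp only [h2]
    rw [h1]
    refine Finset.sum_congr rfl fun σ _ => ?_
    congr 2
    -- Group level k + 1 by parents: the D children of a vertex give equal factors, whence the D-th
    -- power in `branchFactor`.
    rw [← Finset.prod_fiberwise_of_maps_to (t := Finset.univ.filter fun w => lev w = k) (g := par)]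
    · refine Finset.prod_congr rfl fun x hx => ?_
      simp only [Finset.mem_filter_univ] at hx
      rw [Finset.filter_filter, ← hx, branchFactor_succ, Finset.prod_congr rfl
        (g := fun _ => ∑ b, gl j b * (K b (σ x) * branchFactor K gl D j b)), Finset.prod_const,
        hdeg x (by omega)]
      intro w hw
      simp only [Finset.mem_filter_univ] at hw
      rw [hg w (by omega) (by omega), hw.2, hw.1, show P - (lev x + 1) = j by omega]
    · intro w hw
      simp only [Finset.mem_filter_univ] at hw ⊢
      have := hpar w (by omega) (by omega)
      omega

end Elimination

/-! ### Neighbourhoods of an edge in a graph of large girth -/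

section Girth

variable {V : Type u}

/-- The vertices at distance at most `k` from `u` or `v`. -/
def edgeBall (G : SimpleGraph V) (u v : V) : ℕ → Set V
  | 0 => {u, v}
  | k + 1 => {w | w ∈ edgeBall G u v k ∨ ∃ x ∈ edgeBall G u v k, G.Adj x w}

variable {G : SimpleGraph V} {u v : V}

theorem edgeBall_mono : Monotone (edgeBall G u v) :=
  monotone_nat_of_le_succ fun _ _ h => Or.inl h

theorem exists_walk_to_root {k : ℕ} {w : V} (hw : w ∈ edgeBall G u v k) :
    ∃ r ∈ ({u, v} : Set V), ∃ q : G.Walk w r, q.length ≤ k ∧ ∀ z ∈ q.support, z ∈ edgeBall G u v k := by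
  induction k generalizing w with
  | zero => exact ⟨w, hw, SimpleGraph.Walk.nil, le_rfl, by simpa using hw⟩
  | succ k ih =>
    rcases hw with hw | ⟨x, hx, hxw⟩
    · obtain ⟨r, hr, q, hq, hs⟩ := ih hw
      exact ⟨r, hr, q, by omega, fun z hz => Or.inl (hs z hz)⟩
    · obtain ⟨r, hr, q, hq, hs⟩ := ih hx
      refine ⟨r, hr, SimpleGraph.Walk.cons hxw.symm q, by simpa using hq, fun z hz => ?_⟩
      rw [SimpleGraph.Walk.support_cons, List.mem_cons] at hz
      rcases hz with rfl | hz
      · exact Or.inr ⟨x, hx, hxw⟩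
      · exact Or.inl (hs z hz)

/-- Walk from `x` to a root, across the edge `uv` if necessary, and out to `y`: k + 1 + k steps.
Staying inside the ball is what later guarantees that the walk avoids a given edge. -/
theorem exists_walk_in_edgeBall (huv : G.Adj u v) {k : ℕ} {x y : V} (hx : x ∈ edgeBall G u v k)
    (hy : y ∈ edgeBall G u v k) :
    ∃ q : G.Walk x y, q.length ≤ 2 * k + 1 ∧ ∀ z ∈ q.support, z ∈ edgeBall G u v k := by
  obtain ⟨r, hr, q, hq, hqs⟩ := exists_walk_to_root hx
  obtain ⟨r', hr', q', hq', hqs'⟩ := exists_walk_to_root hy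
  have h0 : ∀ z ∈ ({u, v} : Set V), z ∈ edgeBall G u v k := fun z hz =>
    edgeBall_mono (Nat.zero_le k) hz
  obtain ⟨m, hm, hms⟩ : ∃ m : G.Walk r r', m.length ≤ 1 ∧ ∀ z ∈ m.support, z ∈ edgeBall G u v k := by
    by_cases h : r = r'
    · subst h
      exact ⟨SimpleGraph.Walk.nil, by simp, by simpa using h0 r hr⟩
    · have hadj : G.Adj r r' := by
        rcases hr with rfl | rfl <;> rcases hr' with rfl | rfl
        · exact absurd rfl h
        · exact huv
        · exact huv.symm
        · exact absurd rfl h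
      refine ⟨SimpleGraph.Walk.cons hadj SimpleGraph.Walk.nil, by simp, ?_⟩
      simpa using ⟨h0 r hr, h0 r' hr'⟩
  refine ⟨q.append (m.append q'.reverse), ?_, fun z hz => ?_⟩
  · simp only [SimpleGraph.Walk.length_append, SimpleGraph.Walk.length_reverse]; omega
  · simp only [SimpleGraph.Walk.mem_support_append_iff, SimpleGraph.Walk.support_reverse,
      List.mem_reverse] at hz
    rcases hz with hz | hz | hz
    exacts [hqs z hz, hms z hz, hqs' z hz]

/-- In a graph of large girth the ends of an edge are not joined by another short walk. -/
theorem false_of_short_walk {N : ℕ} (hG : (N : ℕ∞) < G.egirth) {x y : V} (h : G.Adj x y)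
    (q : G.Walk y x) (hq : q.length + 1 ≤ N) (he : s(x, y) ∉ q.edges) : False := by
  classical
  have hc : (SimpleGraph.Walk.cons h q.bypass).IsCycle :=
    (SimpleGraph.Walk.cons_isCycle_iff _ _).2
      ⟨q.bypass_isPath, fun h' => he (q.edges_bypass_subset_edges h')⟩
  have h1 := SimpleGraph.egirth_le_length hc
  have h2 := q.length_bypass_le_length
  have h3 := lt_of_lt_of_le hG h1
  rw [SimpleGraph.Walk.length_cons, Nat.cast_lt] at h3
  omega

/-- Two parents of `w`, joined inside the ball, would close a cycle through `w` of length at most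
(2k + 1) + 2 ≤ 2P + 1. -/
theorem parent_unique {P : ℕ} (hG : ((2 * P + 1 : ℕ) : ℕ∞) < G.egirth) (huv : G.Adj u v) {k : ℕ}
    (hk : k < P) {w x y : V} (hw : w ∉ edgeBall G u v k) (hx : x ∈ edgeBall G u v k)
    (hy : y ∈ edgeBall G u v k) (hxw : G.Adj x w) (hyw : G.Adj y w) : x = y := by
  by_contra hne
  obtain ⟨q, hq, hs⟩ := exists_walk_in_edgeBall huv hx hy
  refine false_of_short_walk hG hxw.symm (q.append (SimpleGraph.Walk.cons hyw SimpleGraph.Walk.nil)) ?_ ?_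
  · simp only [SimpleGraph.Walk.length_append, SimpleGraph.Walk.length_cons,
      SimpleGraph.Walk.length_nil]
    omega
  · rw [SimpleGraph.Walk.edges_append, List.mem_append]
    rintro (h | h)
    · exact hw (hs w (q.fst_mem_support_of_mem_edges h))
    · simp only [SimpleGraph.Walk.edges_cons, SimpleGraph.Walk.edges_nil, List.mem_singleton,
        Sym2.eq_iff] at h
      rcases h with ⟨rfl, -⟩ | ⟨-, h⟩
      · exact hw hy
      · exact hne h

/-- Such an edge would close a cycle of length at most (2k + 1) + 3 ≤ 2P. Edges inside level P
itself are not excluded; they do no harm, because the couplings of the light cone have an end below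
level P. -/
theorem not_adj_of_same_level {P : ℕ} (hG : ((2 * P + 1 : ℕ) : ℕ∞) < G.egirth) (huv : G.Adj u v)
    {k : ℕ} (hk : k + 1 < P) {w w' : V} (hw : w ∉ edgeBall G u v k) (hw' : w' ∉ edgeBall G u v k)
    (hw1 : w ∈ edgeBall G u v (k + 1)) (hw1' : w' ∈ edgeBall G u v (k + 1)) : ¬ G.Adj w w' := by
  intro hadj
  obtain ⟨x, hx, hxw⟩ := hw1.resolve_left hw
  obtain ⟨x', hx', hxw'⟩ := hw1'.resolve_left hw'
  obtain ⟨q, hq, hs⟩ := exists_walk_in_edgeBall huv hx hx'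
  refine false_of_short_walk hG hadj.symm
    (SimpleGraph.Walk.cons hxw.symm (q.append (SimpleGraph.Walk.cons hxw' SimpleGraph.Walk.nil))) ?_ ?_
  · simp only [SimpleGraph.Walk.length_append, SimpleGraph.Walk.length_cons,
      SimpleGraph.Walk.length_nil]
    omega
  · rw [SimpleGraph.Walk.edges_cons, SimpleGraph.Walk.edges_append, List.mem_cons, List.mem_append]
    simp only [SimpleGraph.Walk.edges_cons, SimpleGraph.Walk.edges_nil, List.mem_singleton,
      Sym2.eq_iff]
    rintro ((⟨h, -⟩ | ⟨h, -⟩) | h | ⟨⟨h, -⟩ | ⟨-, h⟩⟩)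
    · exact hadj.ne h.symm
    · exact hw' (h ▸ hx)
    · exact hw' (hs _ (q.fst_mem_support_of_mem_edges h))
    · exact hw' (h ▸ hx')
    · exact hw (h ▸ hx')

/-- The neighbourhood of radius `P` of an edge of a `(D+1)`-regular graph of girth larger than
`2P+1` is a pair of `D`-ary trees. -/
theorem exists_levels [Fintype V] [DecidableEq V] [DecidableRel G.Adj] {P D : ℕ}
    (hG : ((2 * P + 1 : ℕ) : ℕ∞) < G.egirth) (hreg : G.IsRegularOfDegree (D + 1))
    (huv : G.Adj u v) :
    ∃ (lev : V → ℕ) (par : V → V),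
      (∀ w, lev w = 0 ↔ w = u ∨ w = v) ∧
      (∀ w, 1 ≤ lev w → lev w ≤ P → lev (par w) + 1 = lev w ∧ G.Adj w (par w)) ∧
      (∀ x, lev x < P → (Finset.univ.filter fun w => lev w = lev x + 1 ∧ par w = x).card = D) ∧
      (∀ a b, G.Adj a b → lev a < P → lev b ≤ lev a + 1) ∧
      ∀ a b, G.Adj a b → lev a < P ∨ lev b < P → (a = u ∧ b = v) ∨ (a = v ∧ b = u) ∨
        (1 ≤ lev a ∧ lev a ≤ P ∧ par a = b) ∨ (1 ≤ lev b ∧ lev b ≤ P ∧ par b = a) := by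
  classical
  -- The distance to the edge. Vertices that lie in no ball receive the dummy value P + 1, beyond
  -- all levels of interest.
  let lev : V → ℕ := fun w => if h : ∃ k, w ∈ edgeBall G u v k then Nat.find h else P + 1
  have hlev : ∀ w k, k ≤ P → (lev w ≤ k ↔ w ∈ edgeBall G u v k) := by
    intro w k hk
    simp only [lev]
    split_ifs with h
    · rw [Nat.find_le_iff]
      exact ⟨fun ⟨m, hm, hm'⟩ => edgeBall_mono hm hm', fun h => ⟨k, le_rfl, h⟩⟩
    · exact ⟨fun h' => by omega, fun h' => absurd ⟨k, h'⟩ h⟩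
  have hadjlev : ∀ a b, G.Adj a b → lev a < P → lev b ≤ lev a + 1 := fun a b hab ha =>
    (hlev b _ (by omega)).2 (Or.inr ⟨a, (hlev a _ (by omega)).1 le_rfl, hab⟩)
  have h0 : ∀ w, lev w = 0 ↔ w = u ∨ w = v := fun w => by
    rw [← Nat.le_zero, hlev w 0 (Nat.zero_le _)]; rfl
  have hex : ∀ w, 1 ≤ lev w → lev w ≤ P → ∃ x, lev x + 1 = lev w ∧ G.Adj w x := by
    intro w h1 h2
    obtain ⟨k, hk⟩ : ∃ k, lev w = k + 1 := ⟨lev w - 1, by omega⟩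
    have hmem := (hlev w (k + 1) (by omega)).1 (by omega)
    have hnot : w ∉ edgeBall G u v k := fun h => by
      have := (hlev w k (by omega)).2 h
      omega
    obtain ⟨x, hx, hxw⟩ := hmem.resolve_left hnot
    have hx' := (hlev x k (by omega)).2 hx
    have := hadjlev x w hxw (by omega)
    exact ⟨x, by omega, hxw.symm⟩
  let par : V → V := fun w => if h : ∃ x, lev x + 1 = lev w ∧ G.Adj w x then h.choose else w
  have hpar : ∀ w, 1 ≤ lev w → lev w ≤ P → lev (par w) + 1 = lev w ∧ G.Adj w (par w) := by
    intro w h1 h2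
    have h := hex w h1 h2
    simp only [par, dif_pos h]
    exact h.choose_spec
  have hparu : ∀ w x, lev w ≤ P → lev x < lev w → G.Adj w x → par w = x := by
    intro w x h1 h2 hwx
    have hp := hpar w (by omega) h1
    have hw1 := hadjlev x w hwx.symm (by omega)
    refine parent_unique hG huv (k := lev x) (w := w) (by omega) (fun h => ?_)
      ((hlev _ _ (by omega)).1 (by omega)) ((hlev _ _ (by omega)).1 le_rfl) hp.2.symm hwx.symm
    have := (hlev w (lev x) (by omega)).2 h
    omega
  have hsame : ∀ a b, G.Adj a b → lev a = lev b → lev a < P →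
      (a = u ∧ b = v) ∨ (a = v ∧ b = u) := by
    intro a b hab h1 h2
    rcases Nat.eq_zero_or_pos (lev a) with h | h
    · have hb : lev b = 0 := by omega
      have hne := hab.ne
      rcases (h0 a).1 h with rfl | rfl <;> rcases (h0 b).1 hb with rfl | rfl
      · exact absurd rfl hne
      · exact Or.inl ⟨rfl, rfl⟩
      · exact Or.inr ⟨rfl, rfl⟩
      · exact absurd rfl hne
    · obtain ⟨k, hk⟩ : ∃ k, lev a = k + 1 := ⟨lev a - 1, by omega⟩
      refine absurd hab (not_adj_of_same_level hG huv (k := k) (by omega) (fun h' => ?_)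
        (fun h' => ?_) ((hlev _ _ (by omega)).1 (by omega)) ((hlev _ _ (by omega)).1 (by omega)))
      · have := (hlev a k (by omega)).2 h'; omega
      · have := (hlev b k (by omega)).2 h'; omega
  refine ⟨lev, par, h0, hpar, ?_, hadjlev, ?_⟩
  · intro x hx
    have hset : (Finset.univ.filter fun w => lev w = lev x + 1 ∧ par w = x)
        = (G.neighborFinset x).filter fun w => lev x < lev w := by
      ext w
      simp only [Finset.mem_filter, SimpleGraph.mem_neighborFinset]
      constructor
      · rintro ⟨-, h1, h2⟩
        have := hpar w (by omega) (by omega)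
        exact ⟨h2 ▸ this.2.symm, by omega⟩
      · rintro ⟨h1, h2⟩
        have := hadjlev x w h1 hx
        exact ⟨Finset.mem_univ w, by omega, hparu w x (by omega) h2 h1.symm⟩
    -- Exactly one neighbour of `x` is not further out: the parent, or the other root if `x` is a
    -- root. Of D + 1 neighbours this leaves D children.
    have hone : ∃ y, (G.neighborFinset x).filter (fun w => ¬ lev x < lev w) = {y} := by
      rcases Nat.eq_zero_or_pos (lev x) with h | h
      · have key : ∀ y, G.Adj x y → lev y = 0 → ∀ w, G.Adj x w → ¬ lev x < lev w → w = y := by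
          intro y hxy hy w hxw hw
          rcases hsame x w hxw (by omega) hx with ⟨h1, h2⟩ | ⟨h1, h2⟩ <;>
          rcases hsame x y hxy (by omega) hx with ⟨h3, h4⟩ | ⟨h3, h4⟩
          · rw [h2, h4]
          · exact absurd (h1.symm.trans h3) huv.ne
          · exact absurd (h3.symm.trans h1) huv.ne
          · rw [h2, h4]
        obtain ⟨y, hxy, hy⟩ : ∃ y, G.Adj x y ∧ lev y = 0 := by
          rcases (h0 x).1 h with rfl | rfl
          · exact ⟨v, huv, (h0 v).2 (Or.inr rfl)⟩
          · exact ⟨u, huv.symm, (h0 u).2 (Or.inl rfl)⟩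
        refine ⟨y, Finset.eq_singleton_iff_unique_mem.2 ⟨?_, fun w hw => ?_⟩⟩
        · simp [hxy, hy]
        · simp only [Finset.mem_filter, SimpleGraph.mem_neighborFinset] at hw
          exact key y hxy hy w hw.1 hw.2
      · have hp := hpar x h hx.le
        refine ⟨par x, Finset.eq_singleton_iff_unique_mem.2 ⟨?_, fun w hw => ?_⟩⟩
        · simp only [Finset.mem_filter, SimpleGraph.mem_neighborFinset]
          exact ⟨hp.2, by omega⟩
        · simp only [Finset.mem_filter, SimpleGraph.mem_neighborFinset] at hw
          rcases Nat.lt_or_ge (lev w) (lev x) with h1 | h1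
          · exact (hparu x w hx.le h1 hw.1).symm
          · have h2 := hsame x w hw.1 (by omega) hx
            have h3 := (h0 x).2 (h2.imp And.left And.left)
            omega
    obtain ⟨y, hy⟩ := hone
    have hcard := Finset.card_filter_add_card_filter_not (s := G.neighborFinset x) (fun w => lev x < lev w)
    rw [hy, Finset.card_singleton, SimpleGraph.card_neighborFinset_eq_degree, hreg x] at hcard
    rw [hset]; omega
  · intro a b hab h
    rcases lt_trichotomy (lev a) (lev b) with h1 | h1 | h1
    · have := hadjlev a b hab (by omega)
      exact Or.inr (Or.inr (Or.inr ⟨by omega, by omega, hparu b a (by omega) h1 hab.symm⟩))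
    · exact (hsame a b hab h1 (by omega)).imp_right Or.inl
    · have := hadjlev b a hab.symm (by omega)
      exact Or.inr (Or.inr (Or.inl ⟨by omega, by omega, hparu a b (by omega) h1 hab⟩))

end Girth

/-! ### Normalization -/

section Unitarity

variable {V : Type u} [Fintype V] [DecidableEq V]

theorem layer_conjTranspose_mul (J : V → V → ℝ) (b : V → ℝ) (g : ℝ) :
    (layer J b g).conjTranspose * layer J b g = 1 := by
  rw [layer, Matrix.conjTranspose_mul, Matrix.mul_assoc,
    ← Matrix.mul_assoc (NormedSpace.exp (mixGen b)).conjTranspose,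
    exp_conjTranspose_mul_exp (mixGen_conjTranspose b), Matrix.one_mul,
    exp_conjTranspose_mul_exp (phaseGen_conjTranspose J g)]

theorem expect_layeredState_one (J : V → V → ℝ) {p : ℕ} (b : Fin p → V → ℝ) (γ : Fin p → ℝ) :
    expect (layeredState J b γ) 1 = 1 := by
  induction p with
  | zero =>
    have h : ∀ _v : V, ((1 / Real.sqrt 2 : ℝ) : ℂ) * ((1 / Real.sqrt 2 : ℝ) : ℂ) = 1 / 2 := fun _ => by
      rw [← Complex.ofReal_mul, div_mul_div_comm, Real.mul_self_sqrt (by norm_num)]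
      push_cast; ring
    rw [layeredState_zero, expect, Matrix.one_mulVec, dotProduct]
    have h' : ∀ x : V → ℤˣ, star (plusState : (V → ℤˣ) → ℂ) x * plusState x = ∏ _v : V, (1 / 2 : ℂ) :=
      fun x => by
        simp only [plusState, Pi.star_apply, star_prod, RCLike.star_def, Complex.conj_ofReal]
        rw [← Finset.prod_mul_distrib]
        exact Finset.prod_congr rfl fun v _ => h v
    simp only [h']
    rw [Finset.sum_const, Finset.card_univ, Fintype.card_fun, Finset.prod_const, Finset.card_univ,
      Fintype.card_units_int, nsmul_eq_mul]
    push_cast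
    rw [← mul_pow]; norm_num
  | succ p ih =>
    rw [layeredState_succ, expect_mulVec, Matrix.mul_one, layer_conjTranspose_mul, ih]

end Unitarity

/-! ### Causality: cancellation of asymmetric histories -/

section Causal

variable {p : ℕ}

theorem signedFlip_one : signedFlip 1 (fun _ => 1) = 1 := by
  ext a b; simp [signedFlip, Matrix.one_apply]

/-- The squared norm of an uncoupled qubit, evaluated once by unitarity and once as a sum over
histories. -/
theorem sum_f (β : Fin p → ℝ) : ∑ b, f β b = 1 := by
  have h1 := expect_layeredState_one (V := Unit) (fun _ _ => 0) (fun j _ => β j) (fun _ : Fin p => 0)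
  have h2 := expect_layeredState (V := Unit) (fun _ _ => 0) (fun j _ => β j) (fun _ : Fin p => 0)
    (fun _ => 1) (fun _ _ => 1)
  rw [signedFlip_one, tens_one, h1] at h2
  rw [h2, ← (Equiv.funUnique Unit (Bits p)).symm.sum_comp]
  refine Finset.sum_congr rfl fun b _ => ?_
  simp [isingEnergy, f]

/-- The bitstring is symmetric under `j ↔ -j` from position `t` up to the middle. -/
def SymmFrom (t : ℕ) (a : Bits p) : Prop :=
  ∀ i : Fin (2 * p + 1), t ≤ (i : ℕ) → (i : ℕ) ≤ p → a i = a i.rev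

/-- Flip all bits between position `t` and its mirror image. -/
def flipFrom (t : ℕ) (a : Bits p) : Bits p :=
  fun i => if t ≤ (i : ℕ) ∧ (i : ℕ) + t ≤ 2 * p then -a i else a i

theorem symmFrom_mid (a : Bits p) : SymmFrom p a := fun i h1 h2 => by
  congr 1; ext; rw [Fin.val_rev]; omega

theorem SymmFrom.mono {s t : ℕ} (hst : s ≤ t) {a : Bits p} (h : SymmFrom s a) : SymmFrom t a :=
  fun i h1 h2 => h i (hst.trans h1) h2

theorem flipFrom_flipFrom (t : ℕ) (a : Bits p) : flipFrom t (flipFrom t a) = a := by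
  funext i; simp only [flipFrom]; split_ifs <;> simp

theorem flipFrom_mid {t : ℕ} (ht : t ≤ p) (a : Bits p) : flipFrom t a (mid p) = -a (mid p) :=
  if_pos ⟨ht, by change p + t ≤ 2 * p; omega⟩

theorem flipFrom_rev {t : ℕ} {a : Bits p} (i : Fin (2 * p + 1)) :
    flipFrom t a i = flipFrom t a i.rev ↔ a i = a i.rev := by
  have := i.is_lt
  simp only [flipFrom, Fin.val_rev]
  by_cases h : t ≤ (i : ℕ) ∧ (i : ℕ) + t ≤ 2 * p
  · rw [if_pos h, if_pos (by omega), neg_inj]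
  · rw [if_neg h, if_neg (by omega)]

theorem symmFrom_flipFrom {s t : ℕ} {a : Bits p} : SymmFrom s (flipFrom t a) ↔ SymmFrom s a := by
  simp only [SymmFrom, flipFrom_rev]

/-- A function of bitstrings that cannot distinguish the values of the late symmetric bits. -/
def Causal (F : Bits p → ℂ) : Prop := ∀ t ≤ p, ∀ a, SymmFrom t a → F (flipFrom t a) = F a

/-- The contributions of the inner bits `x` and `-x` are the two terms of ⟨a|e^{iθX} e^{-iθX}|-a⟩ =
0. -/
theorem rot_mul_rot_flip (θ : ℝ) (a x : ℤˣ) :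
    rot θ a (-x) * rot (-θ) (-x) (-a) = -(rot θ a x * rot (-θ) x (-a)) := by
  simp only [rot_eq, sgn_neg]
  push_cast
  rcases Int.units_eq_one_or a with rfl | rfl <;> rcases Int.units_eq_one_or x with rfl | rfl <;>
    simp [sgn] <;> ring

/-- Factors with both bits inside or both outside the flipped block are unchanged. Only the factor
at position `s` and its mirror image cross the boundary; since the outer bits differ there, their
product changes sign by `rot_mul_rot_flip`. -/
theorem f_flipFrom (β : Fin p → ℝ) {s : ℕ} (hs : s < p) {a : Bits p} (ha : SymmFrom (s + 1) a)
    (has : a ⟨s, by omega⟩ ≠ a (Fin.rev ⟨s, by omega⟩)) :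
    f β (flipFrom (s + 1) a) = -f β a := by
  have key : ∀ i : Fin p, rot (β i) (flipFrom (s + 1) a ⟨i, by omega⟩)
        (flipFrom (s + 1) a ⟨i + 1, by omega⟩)
      * rot (-β i) (flipFrom (s + 1) a ⟨2 * p - 1 - i, by omega⟩)
        (flipFrom (s + 1) a ⟨2 * p - i, by omega⟩)
      = (if i = ⟨s, hs⟩ then -1 else 1) * (rot (β i) (a ⟨i, by omega⟩) (a ⟨i + 1, by omega⟩)
        * rot (-β i) (a ⟨2 * p - 1 - i, by omega⟩) (a ⟨2 * p - i, by omega⟩)) := by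
    rintro ⟨i, hi⟩
    rcases lt_trichotomy i s with h | h | h
    · simp only [flipFrom]
      rw [if_neg (by omega), if_neg (by omega), if_neg (by omega), if_neg (by omega),
        if_neg (by simp; omega), one_mul]
    · subst h
      simp only [flipFrom]
      rw [if_neg (by omega), if_pos (by omega), if_pos (by omega), if_neg (by omega), if_pos True.intro]
      have h1 : a ⟨2 * p - 1 - i, by omega⟩ = a ⟨i + 1, by omega⟩ := by
        rw [ha ⟨i + 1, by omega⟩ le_rfl (by simp; omega)]
        congr 1; ext; simp [Fin.val_rev]; omega
      have h2 : a ⟨2 * p - i, by omega⟩ = -a ⟨i, by omega⟩ := by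
        have h3 : (Fin.rev ⟨i, by omega⟩ : Fin (2 * p + 1)) = ⟨2 * p - i, by omega⟩ := by
          ext; simp [Fin.val_rev]
        rw [h3] at has
        exact Int.units_ne_iff_eq_neg.1 has.symm
      rw [h1, h2, rot_mul_rot_flip]; ring
    · simp only [flipFrom]
      rw [if_pos (by omega), if_pos (by omega), if_pos (by omega), if_pos (by omega),
        if_neg (by simp; omega), one_mul, rot_neg_neg, rot_neg_neg]
  rw [f, f, weight, weight, mul_assoc, mul_assoc, ← Finset.prod_mul_distrib,
    ← Finset.prod_mul_distrib, Finset.prod_congr rfl fun i _ => key i, Finset.prod_mul_distrib,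
    Finset.prod_ite_eq']
  simp

open Classical in
/-- The contributions of bitstrings that are not symmetric from position `t` on cancel in pairs. -/
theorem sum_f_mul_eq_symm (β : Fin p → ℝ) {t : ℕ} (ht : t ≤ p) (F : Bits p → ℂ)
    (hF : ∀ s, t ≤ s → s < p → ∀ b, SymmFrom (s + 1) b → F (flipFrom (s + 1) b) = F b) :
    ∑ b, f β b * F b = ∑ b with SymmFrom t b, f β b * F b := by
  induction ht using Nat.decreasingInduction with
  | self => rw [Finset.filter_true_of_mem fun b _ => symmFrom_mid b]
  | of_succ s hs ih =>
    rw [ih fun s' h1 => hF s' (by omega)]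
    have hsplit : (Finset.univ.filter fun b : Bits p => SymmFrom (s + 1) b)
        = (Finset.univ.filter fun b : Bits p => SymmFrom s b) ∪ Finset.univ.filter fun b : Bits p =>
          SymmFrom (s + 1) b ∧ b ⟨s, by omega⟩ ≠ b (Fin.rev ⟨s, by omega⟩) := by
      ext b
      simp only [Finset.mem_filter_univ, Finset.mem_union]
      constructor
      · intro h
        by_cases hb : b ⟨s, by omega⟩ = b (Fin.rev ⟨s, by omega⟩)
        · refine Or.inl fun i h1 h2 => ?_
          rcases Nat.eq_or_lt_of_le h1 with h3 | h3
          · rw [show i = ⟨s, by omega⟩ from Fin.ext h3.symm]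
            exact hb
          · exact h i h3 h2
        · exact Or.inr ⟨h, hb⟩
      · rintro (h | h)
        exacts [h.mono (Nat.le_succ s), h.1]
    rw [hsplit, Finset.sum_union]
    · rw [add_eq_left]
      refine Finset.sum_involution (fun b _ => flipFrom (s + 1) b) (fun b hb => ?_) (fun b hb _ h => ?_)
        (fun b hb => ?_) (fun b _ => flipFrom_flipFrom _ _)
      · simp only [Finset.mem_filter_univ] at hb
        rw [f_flipFrom β hs hb.1 hb.2, hF s le_rfl hs b hb.1]; ring
      · have h1 := congrFun h (mid p)
        rw [flipFrom_mid hs] at h1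
        rcases Int.units_eq_one_or (b (mid p)) with h2 | h2 <;> rw [h2] at h1 <;>
          exact absurd h1 (by decide)
      · simp only [Finset.mem_filter_univ] at hb ⊢
        refine ⟨symmFrom_flipFrom.2 hb.1, fun h => hb.2 ((flipFrom_rev _).1 h)⟩
    · refine Finset.disjoint_filter.2 fun b _ h1 h2 => h2.2 (h1 ⟨s, by omega⟩ le_rfl hs.le)

/-- Flipping the block from position `k` turns a -1 at `k` into 1 and preserves both the symmetry
and the earlier bits. Working from the outside in, every symmetric string reaches the all-ones
string. -/
theorem Causal.eq_one {F : Bits p → ℂ} (hF : Causal F) {b : Bits p} (hb : SymmFrom 0 b) :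
    F b = F 1 := by
  have h : ∀ k ≤ p + 1, ∀ b : Bits p, SymmFrom 0 b → (∀ i : Fin (2 * p + 1), (i : ℕ) < k → b i = 1) →
      F b = F 1 := by
    intro k hk
    induction hk using Nat.decreasingInduction with
    | self =>
      intro b hb h1
      congr 1; funext i
      have := i.is_lt
      by_cases h : (i : ℕ) ≤ p
      · exact h1 i (by omega)
      · have h2 := hb i.rev (Nat.zero_le _) (by rw [Fin.val_rev]; omega)
        rw [Fin.rev_rev] at h2
        rw [← h2]
        exact h1 _ (by rw [Fin.val_rev]; omega)
    | of_succ k hk ih =>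
      intro b hb h1
      rcases Int.units_eq_one_or (b ⟨k, by omega⟩) with h | h
      · refine ih b hb fun i hi => ?_
        rcases Nat.lt_succ_iff_lt_or_eq.1 hi with h2 | h2
        · exact h1 i h2
        · rw [show i = ⟨k, by omega⟩ from Fin.ext h2]
          exact h
      · rw [← hF k (by omega) b (hb.mono (Nat.zero_le k))]
        refine ih _ (symmFrom_flipFrom.2 hb) fun i hi => ?_
        rcases Nat.lt_succ_iff_lt_or_eq.1 hi with h2 | h2
        · rw [flipFrom, if_neg (by omega), h1 i h2]
        · rw [show i = ⟨k, by omega⟩ from Fin.ext h2]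
          simp only [flipFrom]
          rw [if_pos (by omega), h, neg_neg]
  exact h 0 (Nat.zero_le _) b hb fun i hi => absurd hi (Nat.not_lt_zero _)

/-- Only symmetric strings contribute, `F` is constant on them, and their total weight is 1, as the
same cancellation applied to the constant function shows. -/
theorem Causal.sum_f_mul {F : Bits p → ℂ} (hF : Causal F) (β : Fin p → ℝ) :
    ∑ b, f β b * F b = F 1 := by
  classical
  have h1 := sum_f_mul_eq_symm β (Nat.zero_le p) F fun s _ hs b hb => hF (s + 1) hs b hb
  have h2 := sum_f_mul_eq_symm β (Nat.zero_le p) (fun _ => 1) fun _ _ _ _ _ => rfl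
  simp only [mul_one, sum_f] at h2
  rw [h1, ← one_mul (F 1), h2, Finset.sum_mul]
  refine Finset.sum_congr rfl fun b hb => ?_
  rw [hF.eq_one (Finset.mem_filter.1 hb).2]

/-- `∑ Γ_j a_j b_j`. -/
def gamDot (γ : Fin p → ℝ) (a b : Bits p) : ℂ := ∑ j, (Gam γ j : ℂ) * (sgn (a j) * sgn (b j))

theorem gamDot_comm (γ : Fin p → ℝ) (a b : Bits p) : gamDot γ a b = gamDot γ b a := by
  simp only [gamDot, mul_comm (sgn (a _))]

/-- As Γ is odd, mirror positions at which both strings are symmetric cancel, and the flipped block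
consists of such positions. -/
theorem gamDot_flipFrom (γ : Fin p → ℝ) {t : ℕ} {a b : Bits p} (ha : SymmFrom t a)
    (hb : SymmFrom t b) : gamDot γ (flipFrom t a) b = gamDot γ a b := by
  rw [gamDot, gamDot, sum_Gam_mul, sum_Gam_mul]
  refine Finset.sum_congr rfl fun i _ => ?_
  congr 1
  have hr : (⟨2 * p - i, by omega⟩ : Fin (2 * p + 1)) = Fin.rev ⟨i, by omega⟩ := by
    ext; simp [Fin.val_rev]
  rw [hr]
  by_cases h : t ≤ (i : ℕ)
  · rw [← ha ⟨i, by omega⟩ h i.is_lt.le, ← hb ⟨i, by omega⟩ h i.is_lt.le,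
      ← (flipFrom_rev (t := t) (a := a) _).2 (ha ⟨i, by omega⟩ h i.is_lt.le), sub_self, sub_self]
  · simp only [flipFrom, Fin.val_rev]
    rw [if_neg (by omega), if_neg (by omega)]

theorem symmFrom_one (t : ℕ) : SymmFrom t (1 : Bits p) := fun _ _ _ => rfl

/-- If `a` is symmetric from `t`, the sum may be restricted to `b` symmetric from `t`, and these do
not notice a flip of the block of `a`. This passes causality from children to their parent. -/
theorem Causal.sum_f_exp {H : Bits p → ℂ} (hH : Causal H) (γ β : Fin p → ℝ) (c : ℂ) :
    Causal fun a => ∑ b, f β b * (Complex.exp (c * gamDot γ b a) * H b) := by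
  classical
  have key : ∀ t ≤ p, ∀ a : Bits p, SymmFrom t a →
      ∑ b, f β b * (Complex.exp (c * gamDot γ b a) * H b)
        = ∑ b with SymmFrom t b, f β b * (Complex.exp (c * gamDot γ b a) * H b) :=
    fun t ht a ha => sum_f_mul_eq_symm β ht (fun b => Complex.exp (c * gamDot γ b a) * H b)
      fun s hts hs b hb => by
        rw [hH (s + 1) hs b hb, gamDot_flipFrom γ hb (ha.mono (by omega))]
  intro t ht a ha
  beta_reduce
  rw [key t ht a ha, key t ht _ (symmFrom_flipFrom.2 ha)]
  refine Finset.sum_congr rfl fun b hb => ?_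
  rw [gamDot_comm γ b, gamDot_flipFrom γ ha (Finset.mem_filter.1 hb).2, gamDot_comm]

theorem gamDot_one_one (γ : Fin p → ℝ) : gamDot γ 1 1 = 0 := by
  rw [gamDot, sum_Gam_mul]
  simp

theorem Causal.sum_f_exp_one {H : Bits p → ℂ} (hH : Causal H) (γ β : Fin p → ℝ) (c : ℂ) :
    ∑ b, f β b * (Complex.exp (c * gamDot γ b 1) * H b) = H 1 := by
  have h : Causal fun b => Complex.exp (c * gamDot γ b 1) * H b := fun t ht b hb => by
    beta_reduce
    rw [hH t ht b hb, gamDot_flipFrom γ hb (symmFrom_one t)]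
  rw [h.sum_f_mul β, gamDot_one_one]
  simp

end Causal

/-! ### The expectation value on an edge -/

section EdgeValue

/-- The interaction along one edge. -/
def edgeKernel {p : ℕ} (γ : Fin p → ℝ) (D : ℕ) (b a : Bits p) : ℂ :=
  Complex.exp (-(Complex.I * (1 / Real.sqrt D : ℝ)) * gamDot γ b a)

/-- The weight of a vertex above a subtree of depth `m`: no mixer acts on the leaves. -/
def levelWeight {p : ℕ} (β : Fin p → ℝ) (m : ℕ) : Bits p → ℂ :=
  if m = 0 then f fun _ => 0 else f β

/-- The factor contributed by the `D` subtrees of depth `m` below a vertex. -/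
def treeFactor {p : ℕ} (γ β : Fin p → ℝ) (D m : ℕ) : Bits p → ℂ :=
  branchFactor (edgeKernel γ D) (levelWeight β) D m

/-- The weight of a vertex at which the operator `signedFlip ε c` is inserted. -/
def insertedWeight {p : ℕ} (β : Fin p → ℝ) (ε : ℤˣ) (c : ℤˣ → ℂ) (a : Bits p) : ℂ :=
  c (a (mid p)) * weight β (Function.update a (mid p) (ε * a (mid p))) a

/-- The expectation value of a product of two equal one-qubit operators on an edge. -/
def edgeValue {p : ℕ} (γ β : Fin p → ℝ) (D : ℕ) (ε : ℤˣ) (c : ℤˣ → ℂ) : ℂ :=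
  ∑ a, ∑ b, insertedWeight β ε c a * insertedWeight β ε c b
    * (edgeKernel γ D a b * (treeFactor γ β D p a * treeFactor γ β D p b))

variable {V : Type u} [Fintype V] [DecidableEq V]

theorem mcState_eq_layeredState (G : SimpleGraph V) [DecidableRel G.Adj] (D : ℕ) {p : ℕ}
    (γ β : Fin p → ℝ) :
    mcState G D γ β = layeredState (fun u v => if G.Adj u v then -(1 / Real.sqrt D) else 0)
      (fun j _ => β j) γ := by
  have h1 : phaser G D = coupling fun u v => if G.Adj u v then -(1 / Real.sqrt D) else 0 := by
    rw [phaser, edgeSum, coupling, smul_comm, Finset.smul_sum]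
    congr 1
    refine Finset.sum_congr rfl fun u _ => ?_
    rw [Finset.smul_sum, SimpleGraph.neighborFinset_eq_filter, Finset.sum_filter]
    refine Finset.sum_congr rfl fun v _ => ?_
    split_ifs <;> simp
  have h2 : ∀ b : ℝ, (-Complex.I * (b : ℂ)) • mixer (V := V) = mixGen fun _ => b := fun b => by
    rw [mixer, mixGen, Finset.smul_sum]
  rw [mcState, layeredState]
  congr 1
  funext ψ j
  rw [layer, ← Matrix.mulVec_mulVec, h2, phaseGen, h1]

theorem sum_f_levelWeight {p : ℕ} (β : Fin p → ℝ) (m : ℕ) : ∑ b, levelWeight β m b = 1 := by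
  rw [levelWeight]; split_ifs <;> exact sum_f _

theorem sum_Gam_isingEnergy (J : V → V → ℝ) {p : ℕ} (γ : Fin p → ℝ) (σ : V → Bits p) :
    ∑ j, (Gam γ j : ℂ) * isingEnergy J (fun v => σ v j)
      = (1 / 2) * ∑ a, ∑ b, (J a b : ℂ) * gamDot γ (σ a) (σ b) := by
  simp only [isingEnergy, gamDot, Finset.mul_sum]
  rw [Finset.sum_comm]
  refine Finset.sum_congr rfl fun a _ => ?_
  rw [Finset.sum_comm]
  refine Finset.sum_congr rfl fun b _ => Finset.sum_congr rfl fun j _ => ?_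
  ring

/-- The light cone, the tree structure and the summation from the leaves come together here. The
right-hand side depends on the graph only through D. -/
theorem expect_edge {G : SimpleGraph V} [DecidableRel G.Adj] {p D : ℕ} (hp : 1 ≤ p)
    (hG : ((2 * p + 1 : ℕ) : ℕ∞) < G.egirth) (hreg : G.IsRegularOfDegree (D + 1)) {u v : V}
    (huv : G.Adj u v) (γ β : Fin p → ℝ) (ε : ℤˣ) (c : ℤˣ → ℂ) :
    expect (mcState G D γ β) (opAt (signedFlip ε c) u * opAt (signedFlip ε c) v)
      = edgeValue γ β D ε c := by
  classical
  obtain ⟨lev, par, h0, hpar, hdeg, hup, hedge⟩ := exists_levels hG hreg huv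
  have hlu : lev u = 0 := (h0 u).2 (Or.inl rfl)
  have hlv : lev v = 0 := (h0 v).2 (Or.inr rfl)
  -- Edges inside level p are dropped, which leaves the couplings of two joined trees. Mixers are
  -- switched off from level p on, so leaves carry the weight f at zero angles; this is the origin
  -- of the constant initial matrix of the iteration.
  let J' : V → V → ℝ := fun a b =>
    if G.Adj a b ∧ (lev a < p ∨ lev b < p) then -(1 / Real.sqrt D) else 0
  let b' : Fin p → V → ℝ := fun j w => if lev w < p then β j else 0
  -- reduction to the light cone
  have hred : expect (mcState G D γ β) (opAt (signedFlip ε c) u * opAt (signedFlip ε c) v)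
      = expect (layeredState J' b' γ) (opAt (signedFlip ε c) u * opAt (signedFlip ε c) v) := by
    rw [mcState_eq_layeredState]
    refine expect_layeredState_congr (B := fun k => {w | lev w ≤ k})
      (fun k l hkl w (hw : lev w ≤ k) => hw.trans hkl) (P := p) ?_ ?_ p 0 (by omega) _ _ ?_ γ _ ?_
    · intro k hk a b hab h
      have hadj : G.Adj a b := by
        by_contra h; simp [h] at hab
      simp only [Set.mem_ofPred_eq] at h ⊢
      rcases h with h | h
      · have := hup a b hadj (by omega)
        omega
      · have := hup b a hadj.symm (by omega)
        omega
    · intro k hk a b h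
      simp only [Set.mem_ofPred_eq] at h
      have : lev a < p ∨ lev b < p := by omega
      simp [J', this]
    · intro j k hk w hw
      simp only [Set.mem_ofPred_eq] at hw
      have : lev w < p := by omega
      simp [b', this]
    · intro w hw A
      simp only [Set.mem_ofPred_eq, Nat.le_zero] at hw
      have hwu : w ≠ u := by rintro rfl; exact hw hlu
      have hwv : w ≠ v := by rintro rfl; exact hw hlv
      exact (opAt_commute _ _ hwu.symm).mul_left (opAt_commute _ _ hwv.symm)
  -- the operator as a tensor product
  have hop : opAt (signedFlip ε c) u * opAt (signedFlip ε c) v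
      = tens fun w => signedFlip (if lev w = 0 then ε else 1)
          (if lev w = 0 then c else fun _ => 1) := by
    rw [opAt_mul_opAt _ _ huv.ne]
    congr 1; funext w
    by_cases hv : w = v
    · subst hv; simp [hlv]
    · by_cases hu : w = u
      · subst hu; simp [hlu, hv]
      · have : lev w ≠ 0 := fun h => ((h0 w).1 h).elim hu hv
        simp [hv, hu, this, signedFlip_one]
  -- the phases
  have hphase : ∀ σ : V → Bits p,
      Complex.exp (Complex.I * ∑ j, (Gam γ j : ℂ) * isingEnergy J' fun w => σ w j)
        = edgeKernel γ D (σ u) (σ v)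
          * ∏ w with 1 ≤ lev w ∧ lev w ≤ p, edgeKernel γ D (σ w) (σ (par w)) := by
    intro σ
    -- Every edge appears in both orientations: the root edge gives the first two indicators, the
    -- edges from vertices to their parents the last two. The factor 1/2 in `isingEnergy`
    -- compensates for the double counting.
    have hJ : ∀ a b, (J' a b : ℂ) = -(1 / Real.sqrt D : ℝ) *
        ((if a = u then (if b = v then 1 else 0) else 0)
          + (if a = v then (if b = u then 1 else 0) else 0)
          + (if 1 ≤ lev a ∧ lev a ≤ p then (if b = par a then 1 else 0) else 0)
          + (if 1 ≤ lev b ∧ lev b ≤ p then (if a = par b then 1 else 0) else 0)) := by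
      intro a b
      by_cases hab : G.Adj a b ∧ (lev a < p ∨ lev b < p)
      · simp only [J', if_pos hab]
        rcases hedge a b hab.1 hab.2 with ⟨rfl, rfl⟩ | ⟨rfl, rfl⟩ | ⟨h1, h2, rfl⟩ | ⟨h1, h2, rfl⟩
        · simp [hlu, hlv, huv.ne]
        · simp [hlu, hlv, huv.ne.symm]
        · have h3 := (hpar a h1 h2).1
          have hau : ¬ (a = u ∧ par a = v) := by rintro ⟨rfl, -⟩; omega
          have hav : ¬ (a = v ∧ par a = u) := by rintro ⟨rfl, -⟩; omega
          have h4 : ¬ ((1 ≤ lev (par a) ∧ lev (par a) ≤ p) ∧ a = par (par a)) := by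
            rintro ⟨h4, h⟩
            have h5 := (hpar (par a) h4.1 h4.2).1
            rw [← h] at h5; omega
          simp only [← ite_and, if_neg hau, if_neg hav, if_neg h4]
          simp [h1, h2]
        · have h3 := (hpar b h1 h2).1
          have hbu : ¬ (par b = v ∧ b = u) := by rintro ⟨-, rfl⟩; omega
          have hbv : ¬ (par b = u ∧ b = v) := by rintro ⟨-, rfl⟩; omega
          have h4 : ¬ ((1 ≤ lev (par b) ∧ lev (par b) ≤ p) ∧ b = par (par b)) := by
            rintro ⟨h4, h⟩
            have h5 := (hpar (par b) h4.1 h4.2).1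
            rw [← h] at h5; omega
          simp only [← ite_and, if_neg hbu, if_neg hbv, if_neg h4]
          simp [h1, h2]
      · simp only [J', if_neg hab]
        have h1 : ¬ (a = u ∧ b = v) := by
          rintro ⟨rfl, rfl⟩; exact hab ⟨huv, Or.inl (by omega)⟩
        have h2 : ¬ (a = v ∧ b = u) := by
          rintro ⟨rfl, rfl⟩; exact hab ⟨huv.symm, Or.inl (by omega)⟩
        have h3 : ¬ ((1 ≤ lev a ∧ lev a ≤ p) ∧ b = par a) := by
          rintro ⟨h3, rfl⟩
          have h4 := hpar a h3.1 h3.2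
          exact hab ⟨h4.2, Or.inr (by omega)⟩
        have h4 : ¬ ((1 ≤ lev b ∧ lev b ≤ p) ∧ a = par b) := by
          rintro ⟨h5, rfl⟩
          have h4 := hpar b h5.1 h5.2
          exact hab ⟨h4.2.symm, Or.inl (by omega)⟩
        simp only [← ite_and, if_neg h1, if_neg h2, if_neg h3, if_neg h4]
        simp
    have hsum : ∑ a, ∑ b, (J' a b : ℂ) * gamDot γ (σ a) (σ b)
        = -(1 / Real.sqrt D : ℝ) * (2 * gamDot γ (σ u) (σ v)
          + 2 * ∑ w with 1 ≤ lev w ∧ lev w ≤ p, gamDot γ (σ w) (σ (par w))) := by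
      simp only [hJ, mul_assoc, ← Finset.mul_sum, add_mul, Finset.sum_add_distrib, ite_mul, one_mul,
        zero_mul]
      congr 1
      have e3 : ∑ a, ∑ b, (if 1 ≤ lev a ∧ lev a ≤ p then
            if b = par a then gamDot γ (σ a) (σ b) else 0 else 0)
          = ∑ w with 1 ≤ lev w ∧ lev w ≤ p, gamDot γ (σ w) (σ (par w)) := by
        rw [Finset.sum_filter]
        refine Finset.sum_congr rfl fun a _ => ?_
        split_ifs <;> simp
      have e4 : ∑ a, ∑ b, (if 1 ≤ lev b ∧ lev b ≤ p then
            if a = par b then gamDot γ (σ a) (σ b) else 0 else 0)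
          = ∑ w with 1 ≤ lev w ∧ lev w ≤ p, gamDot γ (σ w) (σ (par w)) := by
        rw [Finset.sum_comm, Finset.sum_filter]
        refine Finset.sum_congr rfl fun a _ => ?_
        split_ifs
        · simp [gamDot_comm]
        · simp
      have e1 : ∀ x y : V, ∑ a, ∑ b, (if a = x then if b = y then gamDot γ (σ a) (σ b) else 0 else 0)
          = gamDot γ (σ x) (σ y) := fun x y => by
        rw [Finset.sum_eq_single x]
        · simp
        · intro a _ ha; simp [ha]
        · simp
      rw [e1, e1, e3, e4, gamDot_comm γ (σ v)]
      ring
    rw [sum_Gam_isingEnergy, hsum]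
    simp only [edgeKernel]
    rw [← Complex.exp_sum, ← Complex.exp_add, ← Finset.mul_sum]
    congr 1; ring
  let g : V → Bits p → ℂ := fun w a => (if lev w = 0 then c else fun _ => 1) (a (mid p))
    * weight (fun j => b' j w)
      (Function.update a (mid p) ((if lev w = 0 then ε else 1) * a (mid p))) a
  have hg1 : ∀ w, 1 ≤ lev w → g w = f fun j => b' j w := fun w hw => by
    funext a
    simp only [g, if_neg (show lev w ≠ 0 by omega), one_mul, Function.update_eq_self]
    rfl
  have hg0 : ∀ w, lev w = 0 → g w = insertedWeight β ε c := fun w hw => by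
    funext a
    simp only [g, b', if_pos hw, if_pos (show lev w < p by omega)]
    rfl
  rw [hred, hop, expect_layeredState]
  simp only [hphase]
  have hK0 : ∀ w, 1 ≤ lev w → ∀ (σ : V → Bits p) b, edgeKernel γ D (Function.update σ w b u)
      (Function.update σ w b v) = edgeKernel γ D (σ u) (σ v) := fun w hw σ b => by
    rw [Function.update_of_ne (by rintro rfl; omega), Function.update_of_ne (by rintro rfl; omega)]
  have hlev := sum_prod_levels (edgeKernel γ D) (levelWeight β) (D := D) (P := p) g lev par
    (fun w h1 h2 => by
      rw [hg1 w h1, levelWeight]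
      by_cases h : lev w < p
      · rw [if_neg (by omega)]; simp [b', h]
      · rw [if_pos (by omega)]; simp [b', h])
    (sum_f_levelWeight β) (fun w h1 h2 => (hpar w h1 h2).1) hdeg
    (fun σ => edgeKernel γ D (σ u) (σ v)) hK0 p le_rfl
  refine hlev.trans ?_
  have hroots : (Finset.univ.filter fun w => lev w = p - p) = {u, v} := by
    ext w; simp [h0]
  have hempty : (Finset.univ.filter fun w => 1 ≤ lev w ∧ lev w ≤ p - p) = ∅ := by
    ext w; simp; omega
  simp only [hroots, hempty, Finset.prod_empty, mul_one, Finset.prod_pair huv.ne]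
  have hpair := sum_prod_pair g huv.ne (fun w hu hv => by
    rw [hg1 w (Nat.one_le_iff_ne_zero.2 fun h => ((h0 w).1 h).elim hu hv), sum_f])
    (fun a b => edgeKernel γ D a b * (treeFactor γ β D p a * treeFactor γ β D p b))
  rw [hg0 u hlu, hg0 v hlv] at hpair
  exact hpair

end EdgeValue

/-! ### Parity, conjugation and positivity -/

section Symmetry

variable {p : ℕ}

theorem weight_neg (β : Fin p → ℝ) (l r : Bits p) : weight β (-l) (-r) = weight β l r := by
  simp only [weight, Pi.neg_apply, rot_neg_neg]

theorem f_neg (β : Fin p → ℝ) (a : Bits p) : f β (-a) = f β a := weight_neg β a a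

theorem update_neg_mid (a : Bits p) (ε : ℤˣ) :
    Function.update (-a) (mid p) (ε * (-a) (mid p)) = -Function.update a (mid p) (ε * a (mid p)) := by
  funext i
  by_cases h : i = mid p
  · subst h; simp
  · simp [h]

theorem insertedWeight_neg (β : Fin p → ℝ) (ε : ℤˣ) (c : ℤˣ → ℂ) (a : Bits p) :
    insertedWeight β ε c (-a)
      = c (-(a (mid p))) * weight β (Function.update a (mid p) (ε * a (mid p))) a := by
  rw [insertedWeight, update_neg_mid, weight_neg]; rfl

theorem sum_bits_neg (F : Bits p → ℂ) : ∑ a, F (-a) = ∑ a, F a :=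
  Equiv.sum_comp (Equiv.neg (Bits p)) F

theorem sum_eq_zero_of_odd {F : Bits p → ℂ} (h : ∀ a, F (-a) = -F a) : ∑ a, F a = 0 := by
  have h1 := sum_bits_neg F
  simp only [h, Finset.sum_neg_distrib] at h1
  exact self_eq_neg.1 h1.symm

theorem gamDot_neg_left (γ : Fin p → ℝ) (a b : Bits p) : gamDot γ (-a) b = -gamDot γ a b := by
  simp [gamDot, sgn_neg]

theorem gamDot_neg_right (γ : Fin p → ℝ) (a b : Bits p) : gamDot γ a (-b) = -gamDot γ a b := by
  simp [gamDot, sgn_neg]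

theorem levelWeight_neg (β : Fin p → ℝ) (m : ℕ) (a : Bits p) :
    levelWeight β m (-a) = levelWeight β m a := by
  rw [levelWeight]; split_ifs <;> exact f_neg _ _

theorem treeFactor_zero (γ β : Fin p → ℝ) (D : ℕ) (a : Bits p) : treeFactor γ β D 0 a = 1 := rfl

theorem treeFactor_succ (γ β : Fin p → ℝ) (D m : ℕ) (a : Bits p) :
    treeFactor γ β D (m + 1) a
      = (∑ b, levelWeight β m b * (edgeKernel γ D b a * treeFactor γ β D m b)) ^ D := rfl

theorem treeFactor_neg (γ β : Fin p → ℝ) (D m : ℕ) (a : Bits p) :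
    treeFactor γ β D m (-a) = treeFactor γ β D m a := by
  induction m generalizing a with
  | zero => rfl
  | succ m ih =>
    rw [treeFactor_succ, treeFactor_succ, ← sum_bits_neg]
    simp only [levelWeight_neg, ih, edgeKernel, gamDot_neg_left, gamDot_neg_right, neg_neg]

/-- Causality of f holds for arbitrary angles, so leaves and inner vertices can be treated alike. -/
theorem exists_levelWeight_eq_f (β : Fin p → ℝ) (m : ℕ) : ∃ β', levelWeight β m = f β' := by
  rw [levelWeight]; split_ifs
  exacts [⟨_, rfl⟩, ⟨_, rfl⟩]

theorem treeFactor_causal (γ β : Fin p → ℝ) (D m : ℕ) : Causal (treeFactor γ β D m) := by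
  induction m with
  | zero => exact fun _ _ _ _ => rfl
  | succ m ih =>
    obtain ⟨β', h⟩ := exists_levelWeight_eq_f β m
    intro t ht a ha
    rw [treeFactor_succ, treeFactor_succ, h]
    exact congrArg (· ^ D) (ih.sum_f_exp γ β' _ t ht a ha)

theorem treeFactor_one (γ β : Fin p → ℝ) (D m : ℕ) : treeFactor γ β D m 1 = 1 := by
  induction m with
  | zero => rfl
  | succ m ih =>
    obtain ⟨β', h⟩ := exists_levelWeight_eq_f β m
    rw [treeFactor_succ, h]
    simp only [edgeKernel]
    rw [(treeFactor_causal γ β D m).sum_f_exp_one γ β', ih, one_pow]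

/-- By causality the sum is the value at the all-ones string. It is exact for every D, so the order
zero of the later expansion needs no correction. -/
theorem sum_levelWeight_treeFactor (γ β : Fin p → ℝ) (D m k : ℕ) :
    ∑ b, levelWeight β k b * treeFactor γ β D m b = 1 := by
  obtain ⟨β', h⟩ := exists_levelWeight_eq_f β k
  rw [h, (treeFactor_causal γ β D m).sum_f_mul β', treeFactor_one]

/-! ### Conjugation -/

theorem Gam_rev (γ : Fin p → ℝ) (j : Fin (2 * p + 1)) : Gam γ j.rev = -Gam γ j := by
  have := j.is_lt
  simp only [Gam, Fin.val_rev]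
  rcases lt_trichotomy (j : ℕ) p with h | h | h
  · rw [dif_neg (by omega), dif_pos (by omega), dif_pos h]
    congr 2; ext; simp; omega
  · rw [dif_neg (by omega), dif_neg (by omega), dif_neg (by omega), dif_neg (by omega), neg_zero]
  · rw [dif_pos (by omega), dif_neg (by omega), dif_pos h, neg_neg]
    congr 1; ext; simp

theorem Gam_mid (γ : Fin p → ℝ) : Gam γ (mid p) = 0 := by simp [Gam, mid]

theorem mid_rev : (mid p).rev = mid p := by
  ext; rw [Fin.val_rev]; simp only [mid]; omega

/-- Complex conjugation exchanges bra and ket, which reverses the strings. -/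
theorem star_weight (β : Fin p → ℝ) (l r : Bits p) :
    (starRingEnd ℂ) (weight β l r) = weight β (r ∘ Fin.rev) (l ∘ Fin.rev) := by
  simp only [weight, map_mul, map_prod, star_rot, map_div₀, map_one, map_ofNat, neg_neg,
    Function.comp_apply]
  rw [mul_assoc, mul_assoc]
  congr 1
  rw [mul_comm]
  congr 1
  · refine Finset.prod_congr rfl fun i _ => ?_
    rw [rot_comm]
    congr 2 <;> ext <;> simp [Fin.val_rev] <;> omega
  · refine Finset.prod_congr rfl fun i _ => ?_
    rw [rot_comm]
    congr 2 <;> ext <;> simp [Fin.val_rev] <;> omega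

theorem star_f (β : Fin p → ℝ) (a : Bits p) : (starRingEnd ℂ) (f β a) = f β (a ∘ Fin.rev) :=
  star_weight β a a

/-- Reflect a bitstring and flip its middle bit. -/
def reflectFlip (a : Bits p) : Bits p := Function.update (a ∘ Fin.rev) (mid p) (-(a (mid p)))

theorem reflectFlip_mid (a : Bits p) : reflectFlip a (mid p) = -a (mid p) :=
  Function.update_self _ _ _

theorem reflectFlip_of_ne (a : Bits p) {j : Fin (2 * p + 1)} (h : j ≠ mid p) :
    reflectFlip a j = a j.rev :=
  Function.update_of_ne h _ _

theorem reflectFlip_involutive : Function.Involutive (reflectFlip (p := p)) := fun a => by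
  funext j
  by_cases h : j = mid p
  · subst h; rw [reflectFlip_mid, reflectFlip_mid, neg_neg]
  · have h' : j.rev ≠ mid p := fun h' => h (by rw [← Fin.rev_rev j, h', mid_rev])
    rw [reflectFlip_of_ne _ h, reflectFlip_of_ne _ h', Fin.rev_rev]

/-- In f' the flipped middle bit belongs to the left half only. Reflection moves the flip to the
right half, and renaming the middle bit moves it back; hence `reflectFlip` instead of plain
reflection. -/
theorem star_f' (β : Fin p → ℝ) (a : Bits p) : (starRingEnd ℂ) (f' β a) = f' β (reflectFlip a) := by
  rw [f', f', star_weight, reflectFlip_mid, neg_neg]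
  congr 1
  · funext j
    by_cases h : j = mid p
    · subst h; simp [mid_rev]
    · simp [h, reflectFlip_of_ne]
  · funext j
    by_cases h : j = mid p
    · subst h; rw [reflectFlip_mid]; simp [mid_rev]
    · have h' : j.rev ≠ mid p := fun h' => h (by rw [← Fin.rev_rev j, h', mid_rev])
      simp [h, h', reflectFlip_of_ne]

theorem star_gaussFactor (γ : Fin p → ℝ) {M : Matrix (Fin (2 * p + 1)) (Fin (2 * p + 1)) ℂ}
    (hM : ∀ j k, (starRingEnd ℂ) (M j k) = M j.rev k.rev) (a : Bits p) :
    (starRingEnd ℂ) (gaussFactor γ M a) = gaussFactor γ M (a ∘ Fin.rev) := by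
  simp only [gaussFactor, ← Complex.exp_conj, map_mul, map_neg, map_div₀, map_one, map_ofNat, map_sum,
    Complex.conj_ofReal, star_sgn, hM, Function.comp_apply]
  congr 2
  rw [← Equiv.sum_comp Fin.revPerm]
  refine Finset.sum_congr rfl fun j _ => ?_
  rw [← Equiv.sum_comp Fin.revPerm]
  refine Finset.sum_congr rfl fun k _ => ?_
  simp only [Fin.revPerm_apply, Fin.rev_rev, Gam_rev]
  push_cast; ring

theorem gaussFactor_update_mid (γ : Fin p → ℝ) (M : Matrix (Fin (2 * p + 1)) (Fin (2 * p + 1)) ℂ)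
    (a : Bits p) (x : ℤˣ) :
    gaussFactor γ M (Function.update a (mid p) x) = gaussFactor γ M a := by
  simp only [gaussFactor]
  congr 2
  refine Finset.sum_congr rfl fun j _ => Finset.sum_congr rfl fun k _ => ?_
  by_cases hj : j = mid p
  · subst hj; simp [Gam_mid]
  · by_cases hk : k = mid p
    · subst hk; simp [Gam_mid]
    · simp [hj, hk]

theorem star_GMat (γ β : Fin p → ℝ) (m : ℕ) (j k : Fin (2 * p + 1)) :
    (starRingEnd ℂ) (GMat γ β m j k) = GMat γ β m j.rev k.rev := by
  induction m generalizing j k with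
  | zero => simp [GMat]
  | succ m ih =>
    simp only [GMat, Matrix.of_apply, map_sum, map_mul, star_f, star_sgn, star_gaussFactor γ ih]
    rw [← (Equiv.arrowCongr (Fin.revPerm (n := 2 * p + 1)) (Equiv.refl ℤˣ)).sum_comp]
    refine Finset.sum_congr rfl fun a _ => ?_
    have h : (Equiv.arrowCongr (Fin.revPerm (n := 2 * p + 1)) (Equiv.refl ℤˣ)) a = a ∘ Fin.rev := rfl
    have h2 : (a ∘ Fin.rev) ∘ Fin.rev = a := by funext i; simp
    rw [h, h2]; rfl

/-- The sign is that of the flipped middle bit; the Gaussian factor ignores this bit because Γ_0 =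
0. In column 0 the bit would occur twice and the sign would disappear, but that column has
coefficient Γ_0 = 0 in the energy. -/
theorem star_GMat'_mid (γ β : Fin p → ℝ) (m : ℕ) {j : Fin (2 * p + 1)} (hj : j ≠ mid p) :
    (starRingEnd ℂ) (GMat' γ β (m + 1) (mid p) j) = -GMat' γ β (m + 1) (mid p) j.rev := by
  simp only [GMat', Matrix.of_apply, map_sum, map_mul, star_f', star_sgn,
    star_gaussFactor γ (star_GMat γ β m)]
  rw [← Equiv.sum_comp (reflectFlip_involutive (p := p)).toPerm, ← Finset.sum_neg_distrib]
  refine Finset.sum_congr rfl fun a _ => ?_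
  have h2 : gaussFactor γ (GMat γ β m) (reflectFlip a ∘ Fin.rev) = gaussFactor γ (GMat γ β m) a := by
    rw [show reflectFlip a ∘ Fin.rev = Function.update a (mid p) (-(a (mid p))) from ?_,
      gaussFactor_update_mid]
    funext i
    by_cases h : i = mid p
    · subst h; simp [mid_rev, reflectFlip_mid]
    · have h' : i.rev ≠ mid p := fun h' => h (by rw [← Fin.rev_rev i, h', mid_rev])
      simp [h, reflectFlip_of_ne _ h']
  rw [Function.Involutive.coe_toPerm, reflectFlip_involutive a, reflectFlip_mid,
    reflectFlip_of_ne _ hj, sgn_neg, h2]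
  ring

/-- Conjugation carries the squares at j to the squares at -j, the sign for G' disappearing in the
square. The oddness of Γ and the conjugation of i then compensate each other. -/
theorem star_nuXYFormula (hp : 1 ≤ p) (γ β : Fin p → ℝ) :
    (starRingEnd ℂ) (nuXYFormula γ β) = nuXYFormula γ β := by
  obtain ⟨m, hm⟩ : ∃ m, p = m + 1 := ⟨p - 1, by omega⟩
  have h : ∀ j, (starRingEnd ℂ) ((Gam γ j : ℂ) * ((GMat γ β p (mid p) j) ^ 2
        - (GMat' γ β p (mid p) j) ^ 2))
      = -((Gam γ j.rev : ℂ) * ((GMat γ β p (mid p) j.rev) ^ 2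
        - (GMat' γ β p (mid p) j.rev) ^ 2)) := fun j => by
    by_cases hj : j = mid p
    · subst hj; simp [mid_rev, Gam_mid]
    · have h1 : (starRingEnd ℂ) (GMat' γ β p (mid p) j) = -GMat' γ β p (mid p) j.rev := by
        have := star_GMat'_mid γ β m hj
        rwa [← hm] at this
      simp only [map_mul, map_sub, map_pow, star_GMat, mid_rev, h1, Gam_rev, Complex.conj_ofReal]
      push_cast; ring
  rw [nuXYFormula, map_mul, map_sum, map_div₀, Complex.conj_I, map_ofNat]
  simp only [h]
  have h2 := Equiv.sum_comp Fin.revPerm fun j => (Gam γ j : ℂ) *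
    ((GMat γ β p (mid p) j) ^ 2 - (GMat' γ β p (mid p) j) ^ 2)
  simp only [Fin.revPerm_apply] at h2
  rw [Finset.sum_neg_distrib, h2]
  ring

/-! ### Positivity -/

/-- `H` is a positive semidefinite kernel of the left and the right half of a bitstring. -/
def IsGram (H : Bits p → ℂ) : Prop :=
  ∃ (ι : Type) (_ : Fintype ι) (h : ι → (Fin p → ℤˣ) → ℂ),
    ∀ l y r, H (joinBits l y r) = ∑ k, (starRingEnd ℂ) (h k l) * h k r

theorem IsGram.one : IsGram (fun _ : Bits p => 1) :=
  ⟨Unit, inferInstance, fun _ _ => 1, fun _ _ _ => by simp⟩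

theorem IsGram.mul {H H' : Bits p → ℂ} : IsGram H → IsGram H' → IsGram fun a => H a * H' a := by
  rintro ⟨ι, _, h, hh⟩ ⟨ι', _, h', hh'⟩
  refine ⟨ι × ι', inferInstance, fun k l => h k.1 l * h' k.2 l, fun l y r => ?_⟩
  beta_reduce
  rw [hh, hh', Finset.sum_mul_sum, Fintype.sum_prod_type]
  refine Finset.sum_congr rfl fun i _ => Finset.sum_congr rfl fun j _ => ?_
  rw [map_mul]; ring

theorem IsGram.pow {H : Bits p → ℂ} (hH : IsGram H) (n : ℕ) : IsGram fun a => H a ^ n := by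
  induction n with
  | zero => simpa using IsGram.one
  | succ n ih => simpa only [pow_succ] using ih.mul hH

/-- The amplitude of one half of a history of a qubit. -/
def halfWeight (β : Fin p → ℝ) (r : Fin p → ℤˣ) (y : ℤˣ) : ℂ :=
  ((1 / Real.sqrt 2 : ℝ) : ℂ) * ∏ i : Fin p, rot (-β i) ((Fin.snoc r y : Fin (p + 1) → ℤˣ) i.succ)
    ((Fin.snoc r y : Fin (p + 1) → ℤˣ) i.castSucc)

theorem weight_eq_halfWeight (β : Fin p → ℝ) (l r : Fin p → ℤˣ) (z y : ℤˣ) :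
    weight β (Function.update (joinBits l y r) (mid p) z) (joinBits l y r)
      = (starRingEnd ℂ) (halfWeight β l z) * halfWeight β r y := by
  have h : (1 / 2 : ℂ) = ((1 / Real.sqrt 2 : ℝ) : ℂ) * ((1 / Real.sqrt 2 : ℝ) : ℂ) := by
    rw [← Complex.ofReal_mul, div_mul_div_comm, Real.mul_self_sqrt (by norm_num)]
    push_cast; ring
  rw [weight_joinBits, halfWeight, halfWeight, h]
  simp only [map_mul, map_prod, Complex.conj_ofReal, star_rot, neg_neg,
    fun θ i => rot_comm θ ((Fin.snoc l z : Fin (p + 1) → ℤˣ) (Fin.succ i))]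
  ring

theorem f_joinBits (β : Fin p → ℝ) (l r : Fin p → ℤˣ) (y : ℤˣ) :
    f β (joinBits l y r) = (starRingEnd ℂ) (halfWeight β l y) * halfWeight β r y := by
  rw [← weight_eq_halfWeight, f]
  congr 1
  conv_lhs => rw [← Function.update_eq_self (mid p) (joinBits l y r), joinBits_mid]

theorem f'_joinBits (β : Fin p → ℝ) (l r : Fin p → ℤˣ) (y : ℤˣ) :
    f' β (joinBits l y r) = (starRingEnd ℂ) (halfWeight β l (-y)) * halfWeight β r y := by
  rw [← weight_eq_halfWeight, f', joinBits_mid]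

theorem edgeKernel_joinBits (γ : Fin p → ℝ) (D : ℕ) (l' r' l r : Fin p → ℤˣ) (y' y : ℤˣ) :
    edgeKernel γ D (joinBits l' y' r') (joinBits l y r)
      = (starRingEnd ℂ) (Complex.exp (Complex.I * (1 / Real.sqrt D : ℝ)
          * ∑ i, (γ i : ℂ) * (sgn (l' i) * sgn (l i))))
        * Complex.exp (Complex.I * (1 / Real.sqrt D : ℝ)
          * ∑ i, (γ i : ℂ) * (sgn (r' i) * sgn (r i))) := by
  rw [edgeKernel, gamDot, sum_Gam_mul, ← Complex.exp_conj, ← Complex.exp_add]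
  simp only [joinBits_left, joinBits_right, map_mul, map_sum, Complex.conj_I, Complex.conj_ofReal,
    star_sgn, mul_sub, Finset.sum_sub_distrib]
  congr 1; ring

/-- Summing out a child is a partial trace. The weight and the edge kernel both split into a
conjugated left part and a right part, linked only by the middle bit of the child, so the new Gram
vectors are indexed by the old index and that bit. -/
theorem IsGram.sum_edgeKernel {H : Bits p → ℂ} (hH : IsGram H) (γ β : Fin p → ℝ) (D : ℕ) :
    IsGram fun a => ∑ b, f β b * (edgeKernel γ D b a * H b) := by
  obtain ⟨ι, _, h, hh⟩ := hH
  refine ⟨ι × ℤˣ, inferInstance, fun k r => ∑ r' : Fin p → ℤˣ, halfWeight β r' k.2 *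
    (Complex.exp (Complex.I * (1 / Real.sqrt D : ℝ) * ∑ i, (γ i : ℂ) * (sgn (r' i) * sgn (r i)))
      * h k.1 r'), fun l y r => ?_⟩
  beta_reduce
  rw [sum_joinBits, Fintype.sum_prod_type]
  simp only [map_sum, Finset.sum_mul_sum]
  conv_lhs => rw [Finset.sum_comm]
  conv_rhs => rw [Finset.sum_comm]
  refine Finset.sum_congr rfl fun y' _ => ?_
  conv_rhs => rw [Finset.sum_comm]
  refine Finset.sum_congr rfl fun l' _ => ?_
  conv_rhs => rw [Finset.sum_comm]
  refine Finset.sum_congr rfl fun r' _ => ?_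
  rw [f_joinBits, edgeKernel_joinBits, hh, Finset.mul_sum, Finset.mul_sum]
  refine Finset.sum_congr rfl fun k _ => ?_
  simp only [map_mul]; ring

theorem treeFactor_isGram (γ β : Fin p → ℝ) (D m : ℕ) : IsGram (treeFactor γ β D m) := by
  induction m with
  | zero => exact IsGram.one
  | succ m ih =>
    obtain ⟨β', h⟩ := exists_levelWeight_eq_f β m
    have := (ih.sum_edgeKernel γ β' D).pow D
    rw [← h] at this
    exact this

/-- The expectation value of `X` against a positive normalized kernel is real and at most one. -/
theorem IsGram.sum_f'_mul {H : Bits p → ℂ} (hH : IsGram H) (β : Fin p → ℝ)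
    (h1 : ∑ a, f β a * H a = 1) :
    (∑ a, f' β a * H a).im = 0 ∧ |(∑ a, f' β a * H a).re| ≤ 1 := by
  obtain ⟨ι, _, h, hh⟩ := hH
  -- The amplitude of the root bit `y` with environment state `k`. The hypothesis reads Σ_k (|w k
  -- 1|² + |w k (-1)|²) = 1, and the sum to be bounded is Σ_k 2 Re(conj(w k 1) · w k (-1)).
  let w : ι → ℤˣ → ℂ := fun k y => ∑ r, halfWeight β r y * h k r
  have key : ∀ (z y : ℤˣ), ∑ l, ∑ r, (starRingEnd ℂ) (halfWeight β l z) * halfWeight β r y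
      * ∑ k, (starRingEnd ℂ) (h k l) * h k r = ∑ k, (starRingEnd ℂ) (w k z) * w k y := by
    intro z y
    simp only [w, map_sum, Finset.sum_mul_sum]
    conv_rhs => rw [Finset.sum_comm]
    refine Finset.sum_congr rfl fun l _ => ?_
    conv_rhs => rw [Finset.sum_comm]
    refine Finset.sum_congr rfl fun r _ => ?_
    rw [Finset.mul_sum]
    refine Finset.sum_congr rfl fun k _ => ?_
    rw [map_mul]; ring
  have e1 : ∑ a, f β a * H a = ∑ k, ((starRingEnd ℂ) (w k 1) * w k 1
      + (starRingEnd ℂ) (w k (-1)) * w k (-1)) := by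
    rw [sum_joinBits, Finset.sum_comm]
    simp only [f_joinBits, hh, key, sum_units, Finset.sum_add_distrib]
  have e2 : ∑ a, f' β a * H a = ∑ k, ((starRingEnd ℂ) (w k (-1)) * w k 1
      + (starRingEnd ℂ) (w k 1) * w k (-1)) := by
    rw [sum_joinBits, Finset.sum_comm]
    simp only [f'_joinBits, hh, key, sum_units, Finset.sum_add_distrib, neg_neg]
  rw [e1] at h1
  have h2 := congrArg Complex.re h1
  rw [e2]
  simp only [Complex.re_sum, Complex.im_sum, Complex.add_re, Complex.add_im, Complex.mul_re,
    Complex.mul_im, Complex.conj_re, Complex.conj_im, Complex.one_re] at h2 ⊢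
  constructor
  · exact Finset.sum_eq_zero fun k _ => by ring
  · rw [← h2]
    refine (Finset.abs_sum_le_sum_abs _ _).trans (Finset.sum_le_sum fun k _ => ?_)
    rw [abs_le]
    constructor
    · nlinarith [sq_nonneg ((w k 1).re + (w k (-1)).re), sq_nonneg ((w k 1).im + (w k (-1)).im)]
    · nlinarith [sq_nonneg ((w k 1).re - (w k (-1)).re), sq_nonneg ((w k 1).im - (w k (-1)).im)]

end Symmetry

/-! ### The limit of infinite degree -/

section Asymptotics

open Filter Asymptotics

/-- `1 / D` as a scale of comparison. -/
def invDeg (D : ℕ) : ℝ := 1 / (D : ℝ)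

theorem invDeg_isBigO_one : invDeg =O[atTop] (fun _ => (1 : ℝ)) :=
  IsBigO.of_bound 1 (Eventually.of_forall fun D => by
    rw [invDeg, norm_one, mul_one, Real.norm_of_nonneg (by positivity)]
    rcases Nat.eq_zero_or_pos D with rfl | h
    · simp
    · exact div_le_one_of_le₀ (by exact_mod_cast h) (by positivity))

theorem tendsto_invDeg : Tendsto invDeg atTop (𝓝 0) := tendsto_one_div_atTop_nhds_zero_nat

theorem tendsto_invSqrt : Tendsto (fun D : ℕ => 1 / Real.sqrt D) atTop (𝓝 0) :=
  (tendsto_const_nhds (x := (1 : ℝ))).div_atTop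
    (Real.tendsto_sqrt_atTop.comp tendsto_natCast_atTop_atTop)

/-- The phase `-i x / √D`. -/
def phase (x : ℂ) (D : ℕ) : ℂ := -(Complex.I * (1 / Real.sqrt D : ℝ)) * x

theorem phase_sq (x : ℂ) (D : ℕ) : phase x D ^ 2 = -(x ^ 2) * (invDeg D : ℂ) := by
  have h : ((1 / Real.sqrt D : ℝ) : ℂ) ^ 2 = (invDeg D : ℂ) := by
    rw [← Complex.ofReal_pow, div_pow, one_pow, Real.sq_sqrt (Nat.cast_nonneg D), invDeg]
  rw [phase, ← h]
  linear_combination (((1 / Real.sqrt D : ℝ) : ℂ) ^ 2 * x ^ 2) * Complex.I_sq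

theorem tendsto_phase (x : ℂ) : Tendsto (phase x) atTop (𝓝 0) := by
  have h : Tendsto (fun D : ℕ => ((1 / Real.sqrt D : ℝ) : ℂ)) atTop (𝓝 ((0 : ℝ) : ℂ)) :=
    (Complex.continuous_ofReal.tendsto 0).comp tendsto_invSqrt
  have := ((h.const_mul Complex.I).neg).mul_const x
  rw [Complex.ofReal_zero, mul_zero, neg_zero, zero_mul] at this
  exact this

theorem phase_sq_isBigO (x : ℂ) : (fun D => phase x D ^ 2) =O[atTop] invDeg := by
  simp only [phase_sq]
  refine IsBigO.const_mul_left ?_ _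
  exact IsBigO.of_norm_left (by simpa using (isBigO_refl invDeg atTop).norm_left)

theorem exp_phase_first (x : ℂ) :
    (fun D => Complex.exp (phase x D) - (1 + phase x D)) =O[atTop] invDeg := by
  have h := (Complex.exp_sub_sum_range_isBigO_pow 2).comp_tendsto (tendsto_phase x)
  have h2 : (fun D => Complex.exp (phase x D) - (1 + phase x D))
      = (fun z => Complex.exp z - ∑ i ∈ Finset.range 2, z ^ i / (i.factorial : ℂ)) ∘ phase x := by
    funext D; simp [Finset.sum_range_succ]
  rw [h2]
  exact h.trans (phase_sq_isBigO x)

theorem exp_phase_third (x : ℂ) :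
    (fun D => Complex.exp (phase x D)
      - (1 + phase x D + phase x D ^ 2 / 2 + phase x D ^ 3 / 6)) =O[atTop] fun D => invDeg D ^ 2 := by
  have h := (Complex.exp_sub_sum_range_isBigO_pow 4).comp_tendsto (tendsto_phase x)
  have h2 : (fun D => Complex.exp (phase x D)
        - (1 + phase x D + phase x D ^ 2 / 2 + phase x D ^ 3 / 6))
      = (fun z => Complex.exp z - ∑ i ∈ Finset.range 4, z ^ i / (i.factorial : ℂ)) ∘ phase x := by
    funext D; simp [Finset.sum_range_succ, Nat.factorial]
  rw [h2]
  refine h.trans (((phase_sq_isBigO x).pow 2).congr_left fun D => ?_)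
  simp only [Function.comp_apply]; ring

theorem norm_pow_sub_pow_le {z w : ℂ} {C : ℝ} (hz : ‖z‖ ≤ C) (hw : ‖w‖ ≤ C) (hC : 1 ≤ C) (n : ℕ) :
    ‖z ^ n - w ^ n‖ ≤ n * C ^ n * ‖z - w‖ := by
  rw [← (Commute.all z w).geom_sum₂_mul, norm_mul]
  refine mul_le_mul_of_nonneg_right ?_ (norm_nonneg _)
  refine (norm_sum_le _ _).trans ?_
  calc ∑ i ∈ Finset.range n, ‖z ^ i * w ^ (n - 1 - i)‖ ≤ ∑ _i ∈ Finset.range n, C ^ n := by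
        refine Finset.sum_le_sum fun i hi => ?_
        rw [Finset.mem_range] at hi
        rw [norm_mul, norm_pow, norm_pow]
        calc ‖z‖ ^ i * ‖w‖ ^ (n - 1 - i) ≤ C ^ i * C ^ (n - 1 - i) := by gcongr
          _ = C ^ (n - 1) := by rw [← pow_add]; congr 1; omega
          _ ≤ C ^ n := pow_le_pow_right₀ hC (by omega)
    _ = n * C ^ n := by simp

/-- `(1 + q / D + O(1 / D²)) ^ D = exp q + O(1 / D)`. -/
theorem pow_sub_exp_isBigO {z : ℕ → ℂ} {q : ℂ}
    (hz : (fun D => z D - (1 + q * invDeg D)) =O[atTop] fun D => invDeg D ^ 2) :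
    (fun D => z D ^ D - Complex.exp q) =O[atTop] invDeg := by
  have hq : Tendsto (fun D => q * (invDeg D : ℂ)) atTop (𝓝 0) := by
    have h : Tendsto (fun D => ((invDeg D : ℝ) : ℂ)) atTop (𝓝 ((0 : ℝ) : ℂ)) :=
      (Complex.continuous_ofReal.tendsto 0).comp tendsto_invDeg
    simpa using h.const_mul q
  have hw : (fun D => Complex.exp (q * invDeg D) - (1 + q * invDeg D)) =O[atTop]
      fun D => invDeg D ^ 2 := by
    have h := (Complex.exp_sub_sum_range_isBigO_pow 2).comp_tendsto hq
    have h2 : (fun D => Complex.exp (q * invDeg D) - (1 + q * invDeg D))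
        = (fun z => Complex.exp z - ∑ i ∈ Finset.range 2, z ^ i / (i.factorial : ℂ)) ∘
          fun D => q * (invDeg D : ℂ) := by
      funext D; simp [Finset.sum_range_succ]
    rw [h2]
    refine h.trans (IsBigO.of_bound (‖q‖ ^ 2) (Eventually.of_forall fun D => ?_))
    simp [mul_pow]
  have hd : (fun D => z D - Complex.exp (q * invDeg D)) =O[atTop] fun D => invDeg D ^ 2 :=
    (hz.sub hw).congr_left fun D => by ring
  obtain ⟨c, hc⟩ := hd.bound
  obtain ⟨c', hc'⟩ := hz.bound
  -- Chosen so that both bases are at most exp(A/D). Their D-th powers then stay below exp A, and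
  -- telescoping costs only a factor D against the error O(1/D²).
  let A : ℝ := ‖q‖ + |c'|
  refine IsBigO.of_bound (Real.exp A * |c|) ?_
  filter_upwards [hc, hc', eventually_ge_atTop 1] with D h1 h2 hD
  have hD0 : (0 : ℝ) < D := by exact_mod_cast hD
  have hi0 : 0 < invDeg D := by rw [invDeg]; positivity
  have hi1 : invDeg D ≤ 1 := by
    rw [invDeg, div_le_one hD0]; exact_mod_cast hD
  have hDi : (D : ℝ) * invDeg D = 1 := by rw [invDeg]; field_simp
  rw [Real.norm_of_nonneg (by positivity)] at h1 h2
  have hexp : Complex.exp q = Complex.exp (q * invDeg D) ^ D := by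
    rw [← Complex.exp_nat_mul]
    congr 1
    have : (D : ℂ) * (invDeg D : ℂ) = 1 := by exact_mod_cast hDi
    linear_combination (-q) * this
  have hzle : ‖z D‖ ≤ Real.exp (A * invDeg D) := by
    have h3 : ‖z D‖ ≤ ‖z D - (1 + q * invDeg D)‖ + ‖1 + q * (invDeg D : ℂ)‖ := by
      simpa using norm_add_le (z D - (1 + q * invDeg D)) (1 + q * (invDeg D : ℂ))
    have h4 : ‖1 + q * (invDeg D : ℂ)‖ ≤ 1 + ‖q‖ * invDeg D := by
      refine (norm_add_le _ _).trans ?_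
      rw [norm_one, norm_mul, Complex.norm_real, Real.norm_of_nonneg hi0.le]
    have h5 : c' * invDeg D ^ 2 ≤ |c'| * invDeg D := by
      have : invDeg D ^ 2 ≤ invDeg D := by nlinarith
      calc c' * invDeg D ^ 2 ≤ |c'| * invDeg D ^ 2 := by gcongr; exact le_abs_self c'
        _ ≤ _ := by gcongr
    have h6 := Real.add_one_le_exp (A * invDeg D)
    simp only [A, add_mul] at h6 ⊢
    linarith
  have hwle : ‖Complex.exp (q * invDeg D)‖ ≤ Real.exp (A * invDeg D) := by
    refine (Complex.norm_exp_le_exp_norm _).trans (Real.exp_le_exp.2 ?_)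
    rw [norm_mul, Complex.norm_real, Real.norm_of_nonneg hi0.le]
    have : 0 ≤ |c'| * invDeg D := by positivity
    simp only [A, add_mul]; linarith
  have hA : 0 ≤ A := by positivity
  rw [hexp]
  refine (norm_pow_sub_pow_le hzle hwle (Real.one_le_exp (by positivity)) D).trans ?_
  rw [← Real.exp_nat_mul, show (D : ℝ) * (A * invDeg D) = A by rw [mul_left_comm, hDi, mul_one],
    Real.norm_of_nonneg hi0.le]
  calc (D : ℝ) * Real.exp A * ‖z D - Complex.exp (q * invDeg D)‖
      ≤ D * Real.exp A * (|c| * invDeg D ^ 2) := by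
        gcongr
        exact h1.trans (by gcongr; exact le_abs_self c)
    _ = Real.exp A * |c| * invDeg D * (D * invDeg D) := by ring
    _ = _ := by rw [hDi, mul_one]

variable {p : ℕ}

/-- The limit of `treeFactor`. -/
def limitFactor (γ β : Fin p → ℝ) : ℕ → Bits p → ℂ
  | 0 => fun _ => 1
  | m + 1 => gaussFactor γ (GMat γ β m)

theorem edgeKernel_eq (γ : Fin p → ℝ) (D : ℕ) (b a : Bits p) :
    edgeKernel γ D b a = Complex.exp (phase (gamDot γ b a) D) := rfl

/-- Without rotations a history is constant, and each of the two constant strings has weight 1/2.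
This describes the leaves. -/
theorem f_zero (b : Bits p) :
    f (fun _ => 0) b = if ∀ j, b j = b (mid p) then (1 / 2 : ℂ) else 0 := by
  rw [f, weight]
  simp only [neg_zero, rot_zero, Finset.prod_ite_zero, Finset.prod_const_one,
    Finset.mem_univ, true_imp_iff]
  have hiff : (∀ j, b j = b (mid p)) ↔
      (∀ i : Fin p, b ⟨i, by omega⟩ = b ⟨i + 1, by omega⟩)
        ∧ ∀ i : Fin p, b ⟨2 * p - 1 - i, by omega⟩ = b ⟨2 * p - i, by omega⟩ := by
    constructor
    · intro h
      exact ⟨fun i => (h _).trans (h _).symm, fun i => (h _).trans (h _).symm⟩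
    · rintro ⟨h1, h2⟩
      have hstep : ∀ k (hk : k + 1 < 2 * p + 1), b ⟨k, by omega⟩ = b ⟨k + 1, hk⟩ := by
        intro k hk
        by_cases h : k < p
        · exact h1 ⟨k, h⟩
        · have := h2 ⟨2 * p - 1 - k, by omega⟩
          convert this using 2 <;> ext <;> simp <;> omega
      have hall : ∀ k (hk : k < 2 * p + 1), b ⟨k, hk⟩ = b ⟨0, by omega⟩ := by
        intro k
        induction k with
        | zero => intro _; rfl
        | succ k ih => intro hk; rw [← hstep k hk, ih]
      intro j
      exact (hall j j.is_lt).trans (hall p (by omega)).symm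
  by_cases h : ∀ j, b j = b (mid p)
  · obtain ⟨h1, h2⟩ := hiff.1 h
    rw [if_pos h, if_pos h1, if_pos h2, mul_one, mul_one]
  · rw [if_neg h]
    rw [hiff, not_and_or] at h
    rcases h with h | h <;> simp [h]

theorem sum_levelWeight_limitFactor (γ β : Fin p → ℝ) (m : ℕ) (j k : Fin (2 * p + 1)) :
    ∑ b, levelWeight β m b * limitFactor γ β m b * (sgn (b j) * sgn (b k)) = GMat γ β m j k := by
  cases m with
  | zero =>
    have h : ∀ b : Bits p, levelWeight β 0 b * limitFactor γ β 0 b * (sgn (b j) * sgn (b k))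
        = f (fun _ => 0) b := fun b => by
      rw [levelWeight, if_pos rfl, limitFactor, f_zero]
      split_ifs with hb
      · rw [hb j, hb k, sgn_mul_self]; ring
      · simp
    simp only [h, sum_f, GMat, Matrix.of_apply]
  | succ m =>
    simp only [GMat, Matrix.of_apply]
    refine Finset.sum_congr rfl fun b _ => ?_
    rw [levelWeight, if_neg (Nat.succ_ne_zero m), limitFactor]; ring

theorem gamDot_sq (γ : Fin p → ℝ) (b a : Bits p) :
    gamDot γ b a ^ 2 = ∑ j, ∑ k, (Gam γ j : ℂ) * (Gam γ k : ℂ) * sgn (a j) * sgn (a k)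
      * (sgn (b j) * sgn (b k)) := by
  rw [sq, gamDot, Finset.sum_mul_sum]
  refine Finset.sum_congr rfl fun j _ => Finset.sum_congr rfl fun k _ => ?_
  ring

theorem gaussFactor_GMat (γ β : Fin p → ℝ) (m : ℕ) (a : Bits p) :
    gaussFactor γ (GMat γ β m) a = Complex.exp (-(1 / 2 : ℂ) *
      ∑ b, levelWeight β m b * limitFactor γ β m b * gamDot γ b a ^ 2) := by
  rw [gaussFactor]
  congr 2
  simp only [gamDot_sq, ← sum_levelWeight_limitFactor γ β, Finset.mul_sum]
  conv_rhs => rw [Finset.sum_comm]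
  refine Finset.sum_congr rfl fun j _ => ?_
  conv_rhs => rw [Finset.sum_comm]
  refine Finset.sum_congr rfl fun k _ => Finset.sum_congr rfl fun b _ => ?_
  ring

theorem isBigO_one_of_sub {T : ℕ → ℂ} {t : ℂ} (h : (fun D => T D - t) =O[atTop] invDeg) :
    T =O[atTop] (fun _ => (1 : ℝ)) :=
  ((h.trans invDeg_isBigO_one).add (isBigO_const_const t one_ne_zero atTop)).congr_left
    fun D => by ring

/-- Expand the kernel to third order. Order zero sums to 1 by causality, orders one and three vanish
by parity, order two is the Gaussian exponent divided by D, and the remainder is O(1/D²). A rate,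
and not only convergence, is what later survives multiplication by √D. -/
theorem treeFactor_sub_limitFactor (γ β : Fin p → ℝ) (m : ℕ) (a : Bits p) :
    (fun D => treeFactor γ β D m a - limitFactor γ β m a) =O[atTop] invDeg := by
  induction m generalizing a with
  | zero => simpa [treeFactor_zero, limitFactor] using isBigO_zero _ _
  | succ m ih =>
    simp only [treeFactor_succ]
    rw [limitFactor, gaussFactor_GMat]
    refine pow_sub_exp_isBigO ?_
    have hodd1 : ∀ D, ∑ b, levelWeight β m b * treeFactor γ β D m b * phase (gamDot γ b a) D = 0 :=
      fun D => sum_eq_zero_of_odd fun b => by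
        rw [levelWeight_neg, treeFactor_neg, gamDot_neg_left, phase, phase]; ring
    have hodd3 : ∀ D, ∑ b, levelWeight β m b * treeFactor γ β D m b
        * (phase (gamDot γ b a) D ^ 3 / 6) = 0 :=
      fun D => sum_eq_zero_of_odd fun b => by
        rw [levelWeight_neg, treeFactor_neg, gamDot_neg_left, phase, phase]; ring
    have heq : ∀ D, ∑ b, levelWeight β m b * (edgeKernel γ D b a * treeFactor γ β D m b)
          - (1 + -(1 / 2 : ℂ) * (∑ b, levelWeight β m b * limitFactor γ β m b * gamDot γ b a ^ 2)
            * invDeg D)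
        = ∑ b, (levelWeight β m b * (treeFactor γ β D m b * (Complex.exp (phase (gamDot γ b a) D)
            - (1 + phase (gamDot γ b a) D + phase (gamDot γ b a) D ^ 2 / 2
              + phase (gamDot γ b a) D ^ 3 / 6)))
          + -(1 / 2 : ℂ) * levelWeight β m b * gamDot γ b a ^ 2
            * ((treeFactor γ β D m b - limitFactor γ β m b) * (invDeg D : ℂ))) := fun D => by
      have h0 := sum_levelWeight_treeFactor γ β D m m
      have h1 := hodd1 D
      have h3 := hodd3 D
      have h4 : ∀ b, levelWeight β m b * (treeFactor γ β D m b * (Complex.exp (phase (gamDot γ b a) D)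
            - (1 + phase (gamDot γ b a) D + phase (gamDot γ b a) D ^ 2 / 2
              + phase (gamDot γ b a) D ^ 3 / 6)))
          + -(1 / 2 : ℂ) * levelWeight β m b * gamDot γ b a ^ 2
            * ((treeFactor γ β D m b - limitFactor γ β m b) * (invDeg D : ℂ))
          = levelWeight β m b * (edgeKernel γ D b a * treeFactor γ β D m b)
            - levelWeight β m b * treeFactor γ β D m b
            - levelWeight β m b * treeFactor γ β D m b * phase (gamDot γ b a) D
            - levelWeight β m b * treeFactor γ β D m b * (phase (gamDot γ b a) D ^ 3 / 6)
            - (-(1 / 2 : ℂ) * (levelWeight β m b * limitFactor γ β m b * gamDot γ b a ^ 2)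
              * invDeg D) := fun b => by
        rw [edgeKernel_eq, phase_sq]; ring
      simp only [h4, Finset.sum_sub_distrib, h0, h1, h3, ← Finset.sum_mul, ← Finset.mul_sum]
      ring
    simp only [heq]
    apply IsBigO.fun_sum
    intro b _
    refine IsBigO.add (IsBigO.const_mul_left ?_ _) (IsBigO.const_mul_left ?_ _)
    · exact ((isBigO_one_of_sub (ih b)).mul (exp_phase_third _)).congr_right fun D => one_mul _
    · have hi : (fun D => (invDeg D : ℂ)) =O[atTop] invDeg :=
        IsBigO.of_norm_left (by simpa using (isBigO_refl invDeg atTop).norm_left)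
      exact ((ih b).mul hi).congr_right fun D => (sq _).symm

end Asymptotics

/-! ### Expansion of the edge expectation values in 1/√D -/

section EdgeAsymptotics

open Filter Asymptotics

variable {p : ℕ}

theorem sqrt_mul_invDeg (D : ℕ) : Real.sqrt D * invDeg D = 1 / Real.sqrt D := by
  rw [invDeg, mul_one_div, Real.sqrt_div_self, one_div]

theorem tendsto_sqrt_mul {g : ℕ → ℂ} (hg : g =O[atTop] invDeg) :
    Tendsto (fun D : ℕ => (Real.sqrt D : ℂ) * g D) atTop (𝓝 0) := by
  have h1 : (fun D : ℕ => (Real.sqrt D : ℂ)) =O[atTop] fun D : ℕ => Real.sqrt D :=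
    IsBigO.of_norm_left (by simpa using (isBigO_refl (fun D : ℕ => Real.sqrt D) atTop).norm_left)
  refine (h1.mul hg).trans_tendsto ?_
  simp only [sqrt_mul_invDeg]
  exact tendsto_invSqrt

theorem tendsto_of_sub_isBigO {T : ℕ → ℂ} {t : ℂ} (h : (fun D => T D - t) =O[atTop] invDeg) :
    Tendsto T atTop (𝓝 t) :=
  tendsto_sub_nhds_zero_iff.1 (h.trans_tendsto tendsto_invDeg)

theorem sum_phase (γ : Fin p → ℝ) (D : ℕ) (U : Bits p → ℂ) :
    ∑ a, ∑ b, U a * U b * phase (gamDot γ a b) D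
      = -(Complex.I * (1 / Real.sqrt D : ℝ)) *
        ∑ j, (Gam γ j : ℂ) * (∑ a, U a * sgn (a j)) ^ 2 := by
  have h : ∀ j, (Gam γ j : ℂ) * (∑ a, U a * sgn (a j)) ^ 2
      = ∑ a, ∑ b, (Gam γ j : ℂ) * (U a * sgn (a j) * (U b * sgn (b j))) := fun j => by
    rw [sq, Finset.sum_mul_sum, Finset.mul_sum]
    exact Finset.sum_congr rfl fun a _ => Finset.mul_sum _ _ _
  simp only [h]
  conv_rhs => rw [Finset.sum_comm, Finset.mul_sum]
  refine Finset.sum_congr rfl fun a _ => ?_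
  conv_rhs => rw [Finset.sum_comm, Finset.mul_sum]
  refine Finset.sum_congr rfl fun b _ => ?_
  simp only [phase, gamDot, Finset.mul_sum]
  refine Finset.sum_congr rfl fun j _ => ?_
  ring

/-- Only the kernel of the root edge is expanded; the subtree factors stay at finite D, so parity
and causality remain exact. Their limits are used only to bound them. -/
theorem edge_expansion (γ : Fin p → ℝ) (W : Bits p → ℂ) {T : ℕ → Bits p → ℂ} {t : Bits p → ℂ}
    (hT : ∀ a, (fun D => T D a - t a) =O[atTop] invDeg) :
    (fun D => ∑ a, ∑ b, W a * W b * (edgeKernel γ D a b * (T D a * T D b))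
      - ((∑ a, W a * T D a) ^ 2 + -(Complex.I * (1 / Real.sqrt D : ℝ)) *
        ∑ j, (Gam γ j : ℂ) * (∑ a, W a * T D a * sgn (a j)) ^ 2)) =O[atTop] invDeg := by
  have heq : ∀ D, ∑ a, ∑ b, W a * W b * (edgeKernel γ D a b * (T D a * T D b))
      - ((∑ a, W a * T D a) ^ 2 + -(Complex.I * (1 / Real.sqrt D : ℝ)) *
        ∑ j, (Gam γ j : ℂ) * (∑ a, W a * T D a * sgn (a j)) ^ 2)
      = ∑ a, ∑ b, (W a * W b) * ((T D a * T D b) * (Complex.exp (phase (gamDot γ a b) D)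
        - (1 + phase (gamDot γ a b) D))) := fun D => by
    rw [← sum_phase, sq, Finset.sum_mul_sum]
    simp only [← Finset.sum_add_distrib, ← Finset.sum_sub_distrib, edgeKernel_eq]
    refine Finset.sum_congr rfl fun a _ => Finset.sum_congr rfl fun b _ => ?_
    ring
  simp only [heq]
  apply IsBigO.fun_sum
  intro a _
  apply IsBigO.fun_sum
  intro b _
  refine IsBigO.const_mul_left ?_ _
  have h := (isBigO_one_of_sub (hT a)).mul (isBigO_one_of_sub (hT b))
  exact (h.mul (exp_phase_first _)).congr_right fun D => by simp

theorem sum_sub_isBigO (W : Bits p → ℂ) {T : ℕ → Bits p → ℂ} {t : Bits p → ℂ}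
    (hT : ∀ a, (fun D => T D a - t a) =O[atTop] invDeg) :
    (fun D => ∑ a, W a * T D a - ∑ a, W a * t a) =O[atTop] invDeg := by
  simp only [← Finset.sum_sub_distrib, ← mul_sub]
  apply IsBigO.fun_sum
  intro a _
  exact (hT a).const_mul_left _

/-- Order zero is the square of a sum of odd terms, hence zero for every D, and the order 1/√D
becomes the limit. -/
theorem tendsto_sqrt_mul_edge_of_odd (γ : Fin p → ℝ) {W : Bits p → ℂ} (hW : ∀ a, W (-a) = -W a)
    {T : ℕ → Bits p → ℂ} (hTeven : ∀ D a, T D (-a) = T D a) {t : Bits p → ℂ}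
    (hT : ∀ a, (fun D => T D a - t a) =O[atTop] invDeg) :
    Tendsto (fun D : ℕ => (Real.sqrt D : ℂ) *
        ∑ a, ∑ b, W a * W b * (edgeKernel γ D a b * (T D a * T D b))) atTop
      (𝓝 (-Complex.I * ∑ j, (Gam γ j : ℂ) * (∑ a, W a * t a * sgn (a j)) ^ 2)) := by
  have h0 : ∀ D, ∑ a, W a * T D a = 0 := fun D => sum_eq_zero_of_odd fun a => by
    rw [hW, hTeven]; ring
  have h1 := tendsto_sqrt_mul (edge_expansion γ W hT)
  have h2 : Tendsto (fun D : ℕ => -Complex.I * ∑ j, (Gam γ j : ℂ) *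
      (∑ a, W a * T D a * sgn (a j)) ^ 2) atTop
      (𝓝 (-Complex.I * ∑ j, (Gam γ j : ℂ) * (∑ a, W a * t a * sgn (a j)) ^ 2)) :=
    (tendsto_finsetSum _ fun j _ => ((tendsto_finsetSum _ fun a _ =>
      ((tendsto_of_sub_isBigO (hT a)).const_mul _).mul_const _).pow 2).const_mul _).const_mul _
  have h3 := h1.add h2
  rw [zero_add] at h3
  refine h3.congr' ?_
  filter_upwards [eventually_ge_atTop 1] with D hD
  have hs : (Real.sqrt D : ℂ) * ((1 / Real.sqrt D : ℝ) : ℂ) = 1 := by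
    rw [← Complex.ofReal_mul, mul_one_div, div_self, Complex.ofReal_one]
    exact (Real.sqrt_pos.2 (by exact_mod_cast hD)).ne'
  rw [h0 D]
  linear_combination (-Complex.I * -1 * ∑ j, (Gam γ j : ℂ) *
      (∑ a, W a * T D a * sgn (a j)) ^ 2) * hs

theorem edge_sub_sq_isBigO_of_even (γ : Fin p → ℝ) {W : Bits p → ℂ} (hW : ∀ a, W (-a) = W a)
    {T : ℕ → Bits p → ℂ} (hTeven : ∀ D a, T D (-a) = T D a) {t : Bits p → ℂ}
    (hT : ∀ a, (fun D => T D a - t a) =O[atTop] invDeg) :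
    (fun D => ∑ a, ∑ b, W a * W b * (edgeKernel γ D a b * (T D a * T D b))
      - (∑ a, W a * T D a) ^ 2) =O[atTop] invDeg := by
  have h0 : ∀ D j, ∑ a, W a * T D a * sgn (a j) = 0 := fun D j => sum_eq_zero_of_odd fun a => by
    rw [hW, hTeven, Pi.neg_apply, sgn_neg]; ring
  simpa [h0] using edge_expansion γ W hT

/-! ### The four two-qubit operators -/

theorem signedFlip_pauliX : signedFlip (-1) (fun _ => 1) = pauliX := by
  ext a b; simp [signedFlip, pauliX]

theorem signedFlip_pauliY : signedFlip (-1) (fun b => Complex.I * sgn b) = pauliY := by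
  ext a b; simp [signedFlip, pauliY]

theorem signedFlip_pauliZ : signedFlip 1 sgn = pauliZ := by
  ext a b
  by_cases h : a = b
  · subst h; simp [signedFlip, pauliZ]
  · simp [signedFlip, pauliZ, h]

theorem insertedWeight_pauliX (β : Fin p → ℝ) (a : Bits p) :
    insertedWeight β (-1) (fun _ => 1) a = f' β a := by
  simp [insertedWeight, f']

theorem insertedWeight_pauliY (β : Fin p → ℝ) (a : Bits p) :
    insertedWeight β (-1) (fun b => Complex.I * sgn b) a = Complex.I * sgn (a (mid p)) * f' β a := by
  simp [insertedWeight, f']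

theorem insertedWeight_pauliZ (β : Fin p → ℝ) (a : Bits p) :
    insertedWeight β 1 sgn a = sgn (a (mid p)) * f β a := by
  simp [insertedWeight, f]

/-- `⟨X_u X_v⟩` on an edge. -/
def edgeX (γ β : Fin p → ℝ) (D : ℕ) : ℂ := edgeValue γ β D (-1) fun _ => 1

/-- `⟨Y_u Y_v⟩` on an edge. -/
def edgeY (γ β : Fin p → ℝ) (D : ℕ) : ℂ := edgeValue γ β D (-1) fun b => Complex.I * sgn b

/-- `⟨Z_u Z_v⟩` on an edge. -/
def edgeZ (γ β : Fin p → ℝ) (D : ℕ) : ℂ := edgeValue γ β D 1 sgn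

/-- The expectation value of `X` on the root of a tree of degree `D`. -/
def rootX (γ β : Fin p → ℝ) (D : ℕ) : ℂ := ∑ a, f' β a * treeFactor γ β D p a

theorem edgeX_sub_sq (γ β : Fin p → ℝ) :
    (fun D => edgeX γ β D - rootX γ β D ^ 2) =O[atTop] invDeg := by
  have h := edge_sub_sq_isBigO_of_even γ (W := insertedWeight β (-1) fun _ => 1)
    (fun a => by rw [insertedWeight_neg]; rfl) (fun D a => treeFactor_neg γ β D p a)
    (treeFactor_sub_limitFactor γ β p)
  simpa only [edgeX, edgeValue, rootX, insertedWeight_pauliX] using h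

theorem rootX_sub (γ β : Fin p → ℝ) :
    (fun D => rootX γ β D - ∑ a, f' β a * limitFactor γ β p a) =O[atTop] invDeg :=
  sum_sub_isBigO (f' β) (treeFactor_sub_limitFactor γ β p)

theorem rootX_im (γ β : Fin p → ℝ) (D : ℕ) : (rootX γ β D).im = 0 ∧ |(rootX γ β D).re| ≤ 1 :=
  (treeFactor_isGram γ β D p).sum_f'_mul β
    (((treeFactor_causal γ β D p).sum_f_mul β).trans (treeFactor_one γ β D p))

theorem limitFactor_eq (hp : 1 ≤ p) (γ β : Fin p → ℝ) (a : Bits p) :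
    limitFactor γ β p a = gaussFactor γ (GMat γ β (p - 1)) a := by
  have h : ∀ n, 1 ≤ n → limitFactor γ β n a = gaussFactor γ (GMat γ β (n - 1)) a
    | 0, h => absurd h (by omega)
    | n + 1, _ => rfl
  exact h p hp

theorem tendsto_sqrt_mul_edgeZ (hp : 1 ≤ p) (γ β : Fin p → ℝ) :
    Tendsto (fun D : ℕ => (Real.sqrt D : ℂ) * edgeZ γ β D) atTop
      (𝓝 (-Complex.I * ∑ j, (Gam γ j : ℂ) * GMat γ β p (mid p) j ^ 2)) := by
  have h := tendsto_sqrt_mul_edge_of_odd γ (W := insertedWeight β 1 sgn)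
    (fun a => by rw [insertedWeight_neg, sgn_neg, neg_mul]; rfl) (fun D a => treeFactor_neg γ β D p a)
    (treeFactor_sub_limitFactor γ β p)
  have e : ∀ j, ∑ a, insertedWeight β 1 sgn a * limitFactor γ β p a * sgn (a j)
      = GMat γ β p (mid p) j := fun j => by
    -- The depth p also occurs in the types, so it stays in place there and only the number of
    -- iterations is rewritten as m + 1.
    obtain ⟨m, hm⟩ : ∃ m, p = m + 1 := ⟨p - 1, by omega⟩
    have : GMat γ β p = GMat γ β (m + 1) := by rw [← hm]
    rw [this]
    simp only [GMat, Matrix.of_apply]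
    refine Finset.sum_congr rfl fun a _ => ?_
    rw [insertedWeight_pauliZ, limitFactor_eq hp, show p - 1 = m by omega]; ring
  simp only [e] at h
  exact h

theorem tendsto_sqrt_mul_edgeY (hp : 1 ≤ p) (γ β : Fin p → ℝ) :
    Tendsto (fun D : ℕ => (Real.sqrt D : ℂ) * edgeY γ β D) atTop
      (𝓝 (Complex.I * ∑ j, (Gam γ j : ℂ) * GMat' γ β p (mid p) j ^ 2)) := by
  have h := tendsto_sqrt_mul_edge_of_odd γ (W := insertedWeight β (-1) fun b => Complex.I * sgn b)
    (fun a => by rw [insertedWeight_neg, sgn_neg, mul_neg, neg_mul]; rfl)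
    (fun D a => treeFactor_neg γ β D p a) (treeFactor_sub_limitFactor γ β p)
  have e : ∀ j, ∑ a, insertedWeight β (-1) (fun b => Complex.I * sgn b) a * limitFactor γ β p a
      * sgn (a j) = Complex.I * GMat' γ β p (mid p) j := fun j => by
    obtain ⟨m, hm⟩ : ∃ m, p = m + 1 := ⟨p - 1, by omega⟩
    have : GMat' γ β p = GMat' γ β (m + 1) := by rw [← hm]
    rw [this]
    simp only [GMat', Matrix.of_apply, Finset.mul_sum]
    refine Finset.sum_congr rfl fun a _ => ?_
    rw [insertedWeight_pauliY, limitFactor_eq hp, show p - 1 = m by omega]; ring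
  simp only [e, mul_pow, Complex.I_sq] at h
  have e2 : -Complex.I * ∑ j, (Gam γ j : ℂ) * (-1 * GMat' γ β p (mid p) j ^ 2)
      = Complex.I * ∑ j, (Gam γ j : ℂ) * GMat' γ β p (mid p) j ^ 2 := by
    simp only [Finset.mul_sum]
    exact Finset.sum_congr rfl fun j _ => by ring
  rw [e2] at h
  exact h

end EdgeAsymptotics

/-! ### Energies per edge and their limits -/

section Energy

open Filter Asymptotics

variable {V : Type u} [Fintype V] [DecidableEq V]

theorem expect_edgeSum {G : SimpleGraph V} [DecidableRel G.Adj] {ψ : (V → ℤˣ) → ℂ}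
    {A : Matrix ℤˣ ℤˣ ℂ} {x : ℂ} (h : ∀ u v, G.Adj u v → expect ψ (opAt A u * opAt A v) = x) :
    expect ψ (edgeSum G A) = G.edgeFinset.card * x := by
  have h1 : expect ψ (edgeSum G A)
      = (1 / 2 : ℂ) * ∑ u, ∑ v ∈ G.neighborFinset u, expect ψ (opAt A u * opAt A v) := by
    simp only [expect, edgeSum, Matrix.smul_mulVec, Matrix.sum_mulVec, dotProduct_smul,
      dotProduct_sum, smul_eq_mul]
  have h2 : ∑ u, ∑ v ∈ G.neighborFinset u, expect ψ (opAt A u * opAt A v)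
      = ∑ u, (G.degree u : ℂ) * x := by
    refine Finset.sum_congr rfl fun u _ => ?_
    rw [Finset.sum_congr rfl fun v hv => h u v ((G.mem_neighborFinset u v).1 hv),
      Finset.sum_const, nsmul_eq_mul, SimpleGraph.card_neighborFinset_eq_degree]
  rw [h1, h2, ← Finset.sum_mul, ← Nat.cast_sum, G.sum_degrees_eq_twice_card_edges]
  push_cast
  ring

theorem edgeFinset_card_pos [Nonempty V] {G : SimpleGraph V} [DecidableRel G.Adj] {D : ℕ}
    (hreg : G.IsRegularOfDegree (D + 1)) : 0 < G.edgeFinset.card := by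
  have h := G.sum_degrees_eq_twice_card_edges
  have h2 : 0 < ∑ v, G.degree v :=
    Finset.sum_pos (fun v _ => by rw [hreg v]; omega) Finset.univ_nonempty
  omega

theorem energyPerEdge_eq [Nonempty V] {G : SimpleGraph V} [DecidableRel G.Adj] {D : ℕ}
    (hreg : G.IsRegularOfDegree (D + 1)) (c : Couplings) {ψ : (V → ℤˣ) → ℂ} {w x y z : ℂ}
    (hw : ∀ u v, G.Adj u v → expect ψ (opAt 1 u * opAt 1 v) = w)
    (hx : ∀ u v, G.Adj u v → expect ψ (opAt pauliX u * opAt pauliX v) = x)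
    (hy : ∀ u v, G.Adj u v → expect ψ (opAt pauliY u * opAt pauliY v) = y)
    (hz : ∀ u v, G.Adj u v → expect ψ (opAt pauliZ u * opAt pauliZ v) = z) :
    energyPerEdge c G ψ = c.cI * w.re + c.cX * x.re + c.cY * y.re + c.cZ * z.re := by
  have h : dotProduct (star ψ) ((hamiltonian c G).mulVec ψ)
      = ((G.edgeFinset.card : ℝ) : ℂ) * (c.cI * w + c.cX * x + c.cY * y + c.cZ * z) := by
    have e : dotProduct (star ψ) ((hamiltonian c G).mulVec ψ)
        = c.cI * expect ψ (edgeSum G 1) + c.cX * expect ψ (edgeSum G pauliX)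
          + c.cY * expect ψ (edgeSum G pauliY) + c.cZ * expect ψ (edgeSum G pauliZ) := by
      simp only [expect, hamiltonian, Matrix.add_mulVec, Matrix.smul_mulVec, dotProduct_add,
        dotProduct_smul, smul_eq_mul]
    rw [e, expect_edgeSum hw, expect_edgeSum hx, expect_edgeSum hy, expect_edgeSum hz]
    push_cast
    ring
  have hm : (G.edgeFinset.card : ℝ) ≠ 0 := by exact_mod_cast (edgeFinset_card_pos hreg).ne'
  rw [energyPerEdge, h, Complex.re_ofReal_mul, mul_div_cancel_left₀ _ hm]
  simp

/-- All edges have the same expectation values, so the average over the edges is the value on one of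
them. -/
theorem energyPerEdge_mcState [Nonempty V] {G : SimpleGraph V} [DecidableRel G.Adj] {p D : ℕ}
    (hp : 1 ≤ p) (hreg : G.IsRegularOfDegree (D + 1)) (hG : ((2 * p + 1 : ℕ) : ℕ∞) < G.egirth)
    (c : Couplings) (γ β : Fin p → ℝ) :
    energyPerEdge c G (mcState G D γ β) = c.cI + c.cX * (edgeX γ β D).re
      + c.cY * (edgeY γ β D).re + c.cZ * (edgeZ γ β D).re := by
  rw [energyPerEdge_eq hreg c (w := 1) (x := edgeX γ β D) (y := edgeY γ β D) (z := edgeZ γ β D)]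
  · simp
  · intro u v _
    rw [opAt_one, opAt_one, mul_one, mcState_eq_layeredState, expect_layeredState_one]
  · intro u v huv
    rw [← signedFlip_pauliX]
    exact expect_edge hp hG hreg huv γ β _ _
  · intro u v huv
    rw [← signedFlip_pauliY]
    exact expect_edge hp hG hreg huv γ β _ _
  · intro u v huv
    rw [← signedFlip_pauliZ]
    exact expect_edge hp hG hreg huv γ β _ _

theorem zeroState_eq_single : (zeroState : (V → ℤˣ) → ℂ) = Pi.single 1 1 := by
  funext x
  rw [zeroState, Finset.prod_ite_zero, Finset.prod_const_one]
  by_cases h : x = 1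
  · subst h; simp
  · rw [Pi.single_eq_of_ne h, if_neg]
    exact fun h' => h (funext fun v => h' v (Finset.mem_univ v))

theorem expect_zeroState (O : Matrix (V → ℤˣ) (V → ℤˣ) ℂ) : expect zeroState O = O 1 1 := by
  rw [expect, zeroState_eq_single, Matrix.mulVec_single_one]
  simp [dotProduct, Pi.single_apply]

theorem opAt_mul_opAt_pauli_one {u v : V} (huv : u ≠ v) (A : Matrix ℤˣ ℤˣ ℂ) :
    (opAt A u * opAt A v) 1 1 = A 1 1 * A 1 1 := by
  rw [opAt_mul_opAt _ _ huv, tens, Matrix.of_apply,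
    ← Finset.mul_prod_erase _ _ (Finset.mem_univ v),
    ← Finset.mul_prod_erase _ _ (Finset.mem_erase.2 ⟨huv, Finset.mem_univ u⟩),
    Finset.prod_eq_one fun w hw => ?_]
  · simp [huv]
  · obtain ⟨h1, h2, _⟩ := by simpa only [Finset.mem_erase] using hw
    simp [h1, h2]

theorem energyPerEdge_EPR_zeroState [Nonempty V] {G : SimpleGraph V} [DecidableRel G.Adj] {D : ℕ}
    (hreg : G.IsRegularOfDegree (D + 1)) : energyPerEdge EPR G zeroState = 1 := by
  have h : ∀ A : Matrix ℤˣ ℤˣ ℂ, ∀ u v, G.Adj u v →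
      expect zeroState (opAt A u * opAt A v) = A 1 1 * A 1 1 := fun A u v huv => by
    rw [expect_zeroState, opAt_mul_opAt_pauli_one huv.ne]
  rw [energyPerEdge_eq hreg EPR (h 1) (h pauliX) (h pauliY) (h pauliZ)]
  have e : (1 : ℤˣ) ≠ -1 := by decide
  simp [EPR, pauliX, pauliY, pauliZ, sgn, e]
  norm_num

/-- On admissible graphs the quantity is a function of D alone, so uniformity over the graphs is
automatic. -/
theorem isDegreeLimit_of_tendsto {p : ℕ}
    {F : (V : Type u) → [Fintype V] → [DecidableEq V] → (G : SimpleGraph V) →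
      [DecidableRel G.Adj] → (D : ℕ) → ℝ} {t : ℕ → ℝ} {L : EReal}
    (h : ∀ (V : Type u) [Fintype V] [DecidableEq V] [Nonempty V] (G : SimpleGraph V)
      [DecidableRel G.Adj] (D : ℕ), G.IsRegularOfDegree (D + 1) →
      ((2 * p + 1 : ℕ) : ℕ∞) < G.egirth → F V G D = t D)
    (ht : Tendsto (fun D => (t D : EReal)) atTop (𝓝 L)) : IsDegreeLimit.{u} p F L := by
  intro U hU
  filter_upwards [ht hU] with D hD V _ _ _ G _ hreg hG
  rw [h V G D hreg hG]
  exact hD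

variable {p : ℕ}

theorem tendsto_of_sqrt_mul {g : ℕ → ℝ} {l : ℝ}
    (h : Tendsto (fun D : ℕ => Real.sqrt D * g D) atTop (𝓝 l)) : Tendsto g atTop (𝓝 0) := by
  have h2 := tendsto_invSqrt.mul h
  rw [zero_mul] at h2
  refine h2.congr' ?_
  filter_upwards [eventually_ge_atTop 1] with D hD
  have : Real.sqrt D ≠ 0 := (Real.sqrt_pos.2 (by exact_mod_cast hD)).ne'
  field_simp

theorem tendsto_sqrt_mul_re {g : ℕ → ℂ} {l : ℂ}
    (h : Tendsto (fun D : ℕ => (Real.sqrt D : ℂ) * g D) atTop (𝓝 l)) :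
    Tendsto (fun D : ℕ => Real.sqrt D * (g D).re) atTop (𝓝 l.re) := by
  have := (Complex.continuous_re.tendsto l).comp h
  refine this.congr fun D => ?_
  simp only [Function.comp, Complex.re_ofReal_mul]

/-- The limit of `⟨X⟩` on one vertex. -/
def limitX (γ β : Fin p → ℝ) : ℂ := ∑ a, f' β a * limitFactor γ β p a

theorem tendsto_rootX_re (γ β : Fin p → ℝ) :
    Tendsto (fun D => (rootX γ β D).re) atTop (𝓝 (limitX γ β).re) :=
  (Complex.continuous_re.tendsto _).comp (tendsto_of_sub_isBigO (rootX_sub γ β))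

theorem abs_limitX_re_le (γ β : Fin p → ℝ) : |(limitX γ β).re| ≤ 1 :=
  le_of_tendsto (tendsto_rootX_re γ β).abs (Eventually.of_forall fun D => (rootX_im γ β D).2)

theorem limitX_im (γ β : Fin p → ℝ) : (limitX γ β).im = 0 := by
  have h := (Complex.continuous_im.tendsto _).comp (tendsto_of_sub_isBigO (rootX_sub γ β))
  have h2 : (Complex.im ∘ fun D => rootX γ β D) = fun _ => 0 :=
    funext fun D => (rootX_im γ β D).1
  rw [h2] at h
  exact (tendsto_nhds_unique h tendsto_const_nhds)

theorem sqrt_mul_edgeX_sub (γ β : Fin p → ℝ) :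
    Tendsto (fun D : ℕ => Real.sqrt D * ((edgeX γ β D).re - (rootX γ β D).re ^ 2)) atTop (𝓝 0) := by
  refine (tendsto_sqrt_mul_re (tendsto_sqrt_mul (edgeX_sub_sq γ β))).congr fun D => ?_
  rw [Complex.sub_re, sq (rootX γ β D), Complex.mul_re, (rootX_im γ β D).1]
  ring

theorem tendsto_edgeX_re (γ β : Fin p → ℝ) :
    Tendsto (fun D => (edgeX γ β D).re) atTop (𝓝 ((limitX γ β).re ^ 2)) := by
  have h := (tendsto_of_sqrt_mul (sqrt_mul_edgeX_sub γ β)).add ((tendsto_rootX_re γ β).pow 2)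
  simpa using h

theorem tendsto_sqrt_mul_edgeX_of_ne (γ β : Fin p → ℝ) (h : limitX γ β ≠ 0) :
    Tendsto (fun D : ℕ => Real.sqrt D * (edgeX γ β D).re) atTop atTop := by
  have hre : 0 < (limitX γ β).re ^ 2 :=
    sq_pos_of_ne_zero fun h0 => h (Complex.ext h0 (limitX_im γ β))
  exact (Real.tendsto_sqrt_atTop.comp tendsto_natCast_atTop_atTop).atTop_mul_pos hre
    (tendsto_edgeX_re γ β)

/-- If the limit of ⟨X⟩ is zero, then ⟨X⟩ = O(1/D), so √D ⟨X⟩² tends to zero. Convergence without a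
rate would not be enough. -/
theorem tendsto_sqrt_mul_edgeX_of_eq (γ β : Fin p → ℝ) (h : limitX γ β = 0) :
    Tendsto (fun D : ℕ => Real.sqrt D * (edgeX γ β D).re) atTop (𝓝 0) := by
  have h1 := tendsto_sqrt_mul (rootX_sub γ β)
  have h2 : Tendsto (fun D : ℕ => Real.sqrt D * (rootX γ β D).re) atTop (𝓝 0) := by
    refine (tendsto_sqrt_mul_re h1).congr fun D => ?_
    rw [← limitX, h, sub_zero]
  have h3 := h2.mul (tendsto_rootX_re γ β)
  have h4 := (sqrt_mul_edgeX_sub γ β).add h3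
  rw [zero_mul, add_zero] at h4
  refine h4.congr fun D => ?_
  ring

/-- The limit of the normalized energy of the XY model. -/
theorem tendsto_nu_XY (hp : 1 ≤ p) (γ β : Fin p → ℝ) :
    Tendsto (fun D : ℕ => Real.sqrt D * (-1 / 2 * (edgeY γ β D).re + -1 / 2 * (edgeZ γ β D).re))
      atTop (𝓝 (nuXYFormula γ β).re) := by
  have hy := (tendsto_sqrt_mul_re (tendsto_sqrt_mul_edgeY hp γ β)).const_mul (-1 / 2)
  have hz := (tendsto_sqrt_mul_re (tendsto_sqrt_mul_edgeZ hp γ β)).const_mul (-1 / 2)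
  have h := hy.add hz
  have e : -1 / 2 * (Complex.I * ∑ j, (Gam γ j : ℂ) * GMat' γ β p (mid p) j ^ 2).re
      + -1 / 2 * (-Complex.I * ∑ j, (Gam γ j : ℂ) * GMat γ β p (mid p) j ^ 2).re
      = (nuXYFormula γ β).re := by
    have e2 : nuXYFormula γ β
        = ((-1 / 2 : ℝ) : ℂ) * (Complex.I * ∑ j, (Gam γ j : ℂ) * GMat' γ β p (mid p) j ^ 2)
          + ((-1 / 2 : ℝ) : ℂ) * (-Complex.I * ∑ j, (Gam γ j : ℂ) * GMat γ β p (mid p) j ^ 2) := by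
      simp only [nuXYFormula, mul_sub, Finset.sum_sub_distrib]
      push_cast
      ring
    rw [e2, Complex.add_re, Complex.re_ofReal_mul, Complex.re_ofReal_mul]
  rw [e] at h
  refine h.congr fun D => ?_
  ring

/-- The YY and ZZ terms tend to zero, since they converge after multiplication by √D. What remains
is (1 + x²)/2, where x is the limit of ⟨X⟩ and |x| ≤ 1; the all-zeros state has energy 1 per edge.
-/
theorem energy_limit (hp : 1 ≤ p) (γ β : Fin p → ℝ) :
    ∃ e : ℝ,
      IsDegreeLimit.{u} p (fun _ _ _ G _ D => energyPerEdge EPR G (mcState G D γ β)) e ∧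
      ∀ (V : Type u) [Fintype V] [DecidableEq V] [Nonempty V] (G : SimpleGraph V)
        [DecidableRel G.Adj] (D : ℕ),
        G.IsRegularOfDegree (D + 1) → ((2 * p + 1 : ℕ) : ℕ∞) < G.egirth →
        e ≤ energyPerEdge EPR G zeroState := by
  refine ⟨1 / 2 + 1 / 2 * (limitX γ β).re ^ 2, ?_, ?_⟩
  · refine isDegreeLimit_of_tendsto
      (fun V _ _ _ G _ D hreg hG => energyPerEdge_mcState hp hreg hG EPR γ β) ?_
    refine (continuous_coe_real_ereal.tendsto _).comp ?_
    have hy := tendsto_of_sqrt_mul (tendsto_sqrt_mul_re (tendsto_sqrt_mul_edgeY hp γ β))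
    have hz := tendsto_of_sqrt_mul (tendsto_sqrt_mul_re (tendsto_sqrt_mul_edgeZ hp γ β))
    have h := ((((tendsto_edgeX_re γ β).const_mul (1 / 2)).const_add (1 / 2)).add
      (hy.const_mul (-1 / 2))).add (hz.const_mul (1 / 2))
    rw [mul_zero, mul_zero, add_zero, add_zero] at h
    exact h
  · intro V _ _ _ G _ D hreg _
    rw [energyPerEdge_EPR_zeroState hreg]
    have := (sq_le_one_iff_abs_le_one _).2 (abs_limitX_re_le γ β)
    linarith

/-- QMC differs from XY by the term -½ √D ⟨XX⟩. It tends to 0 if the limit of ⟨X⟩ is zero, and then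
the two limits agree; otherwise it tends to -∞ and so does the QMC energy. -/
theorem nu_limit (hp : 1 ≤ p) (γ β : Fin p → ℝ) :
    ∃ (νXY : ℝ) (νQMC : EReal),
      IsDegreeLimit.{u} p (fun _ _ _ G _ D => nu XY G D γ β) νXY ∧
      IsDegreeLimit.{u} p (fun _ _ _ G _ D => nu QMC G D γ β) νQMC ∧
      νQMC ≤ (νXY : EReal) ∧ (νXY : ℂ) = nuXYFormula γ β := by
  have hformula : (((nuXYFormula γ β).re : ℝ) : ℂ) = nuXYFormula γ β :=
    Complex.conj_eq_iff_re.1 (star_nuXYFormula hp γ β)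
  have hXY : IsDegreeLimit.{u} p (fun _ _ _ G _ D => nu XY G D γ β) (nuXYFormula γ β).re := by
    refine isDegreeLimit_of_tendsto (fun V _ _ _ G _ D hreg hG => ?_)
      ((continuous_coe_real_ereal.tendsto _).comp (tendsto_nu_XY hp γ β))
    rw [nu, energyPerEdge_mcState hp hreg hG XY γ β]
    simp only [XY]
    ring
  have hQMC : ∀ L, Tendsto (fun D : ℕ => ((Real.sqrt D * (-1 / 2 * (edgeY γ β D).re
      + -1 / 2 * (edgeZ γ β D).re) + -(1 / 2) * (Real.sqrt D * (edgeX γ β D).re) : ℝ) : EReal))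
      atTop (𝓝 L) → IsDegreeLimit.{u} p (fun _ _ _ G _ D => nu QMC G D γ β) L := fun L hL => by
    refine isDegreeLimit_of_tendsto (fun V _ _ _ G _ D hreg hG => ?_) hL
    rw [nu, energyPerEdge_mcState hp hreg hG QMC γ β]
    simp only [QMC]
    ring
  by_cases hx : limitX γ β = 0
  · refine ⟨_, _, hXY, hQMC _ ?_, le_refl _, hformula⟩
    refine (continuous_coe_real_ereal.tendsto _).comp ?_
    have h := (tendsto_nu_XY hp γ β).add
      ((tendsto_sqrt_mul_edgeX_of_eq γ β hx).const_mul (-(1 / 2)))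
    rw [mul_zero, add_zero] at h
    exact h
  · refine ⟨_, ⊥, hXY, hQMC _ ?_, bot_le, hformula⟩
    refine EReal.tendsto_coe_nhds_bot_iff.2 ?_
    exact (tendsto_nu_XY hp γ β).add_atBot
      ((tendsto_sqrt_mul_edgeX_of_ne γ β hx).const_mul_atTop_of_neg (by norm_num))

end Energy

/-! ### Reasoning about programs -/

/-- Started in `s`, the program `P` ends in a state that satisfies `Q`, within `T` time steps, `C`
memory cells, and with integers at most `M`. -/
structure Ok (C M : ℕ) (P : Prog) (s : State) (T : ℕ) (Q : State → Prop) : Prop where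
  post : Q (P.run s)
  time_le : P.time s ≤ T
  cells_le : P.cells s ≤ C
  peak_le : P.peak s ≤ M

section Rules

variable {C M T T' : ℕ} {P P' : Prog} {s : State} {Q Q' : State → Prop}

theorem Ok.mono (h : Ok C M P s T Q) (hT : T ≤ T') (hQ : ∀ s', Q s' → Q' s') : Ok C M P s T' Q' :=
  ⟨hQ _ h.post, h.time_le.trans hT, h.cells_le, h.peak_le⟩

theorem Ok.seq (h : Ok C M P s T Q) (h' : ∀ s', Q s' → Ok C M P' s' T' Q') :
    Ok C M (Prog.seq P P') s (T + T') Q' :=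
  have h2 := h' _ h.post
  ⟨h2.post, add_le_add h.time_le h2.time_le, max_le h.cells_le h2.cells_le,
    max_le h.peak_le h2.peak_le⟩

theorem Ok.assign {r : ℕ} {e : IntExpr} (hpk : e.peak s ≤ M) (hQ : Q (s.setReg r (e.eval s))) :
    Ok C M (Prog.assign r e) s (e.time + 1) Q :=
  ⟨hQ, le_rfl, Nat.zero_le _, hpk⟩

theorem Ok.ite {e : IntExpr} (hpk : e.peak s ≤ M) (h : e.eval s ≠ 0 → Ok C M P s T Q)
    (h' : e.eval s = 0 → Ok C M P' s T Q) : Ok C M (Prog.ite e P P') s (e.time + 1 + T) Q := by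
  by_cases he : e.eval s = 0
  · have h2 := h' he
    exact ⟨by simpa [Prog.run, he] using h2.post, by simpa [Prog.time, he] using h2.time_le,
      by simpa [Prog.cells, he] using h2.cells_le, by simpa [Prog.peak, he, hpk] using h2.peak_le⟩
  · have h2 := h he
    exact ⟨by simpa [Prog.run, he] using h2.post, by simpa [Prog.time, he] using h2.time_le,
      by simpa [Prog.cells, he] using h2.cells_le, by simpa [Prog.peak, he, hpk] using h2.peak_le⟩

/-- The invariant describes the state before the counter is set, whereas the body starts after it
has been set. One bound `T` serves all passes. -/
theorem Ok.loop {r n : ℕ} {e : IntExpr} {Inv : ℕ → State → Prop} (h0 : Inv 0 s)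
    (hn : e.eval s = n) (hpk : e.peak s ≤ M)
    (hb : ∀ i < n, ∀ s', Inv i s' → Ok C M P (s'.setReg r i) T (Inv (i + 1))) :
    Ok C M (Prog.loop r e P) s (e.time + 1 + n * (1 + T)) (Inv n) := by
  have hI : ∀ i, i ≤ n → Inv i (iterBody r P.run s i) := by
    intro i
    induction i with
    | zero => exact fun _ => h0
    | succ i ih => exact fun hi => (hb i hi _ (ih (by omega))).post
  have hO : ∀ i ∈ Finset.range n, Ok C M P ((iterBody r P.run s i).setReg r i) T (Inv (i + 1)) :=
    fun i hi => hb i (Finset.mem_range.1 hi) _ (hI i (Finset.mem_range.1 hi).le)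
  refine ⟨?_, ?_, ?_, ?_⟩
  · rw [Prog.run, hn]
    exact hI n le_rfl
  · rw [Prog.time, hn]
    refine Nat.add_le_add_left ?_ _
    refine (Finset.sum_le_card_nsmul _ _ (1 + T)
      fun i hi => Nat.add_le_add_left (hO i hi).time_le 1).trans ?_
    rw [Finset.card_range, smul_eq_mul]
  · rw [Prog.cells, hn]
    exact Finset.sup_le fun i hi => (hO i hi).cells_le
  · rw [Prog.peak, hn]
    exact max_le hpk (Finset.sup_le fun i hi => (hO i hi).peak_le)

end Rules

/-! ### Arrays

Register `4` holds the address `B` behind the output cells. From there on the memory is divided into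
ten interleaved arrays: entry `i` of array `k` is at address `B + 10 i + k`. -/

/-- Entry `i` of array `k`. -/
def State.arr (s : State) (k i : ℕ) : ℂ := s.mem (s.reg 4 + 10 * i + k)

/-- Overwrite entry `i` of array `k`. -/
def State.setArr (s : State) (k i : ℕ) (z : ℂ) : State := s.setMem (s.reg 4 + 10 * i + k) z

/-- The address of entry `e` of array `k`. -/
def cell (k e : IntExpr) : IntExpr := .add (.add (.reg 4) (.mul (.lit 10) e)) k

/-- The value of entry `e` of array `k`. -/
def ld (k e : IntExpr) : CxExpr := .load (cell k e)

/-- Assign `v` to entry `e` of array `k`. -/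
def st (k e : IntExpr) (v : CxExpr) : Prog := .store (cell k e) v

section Arrays

variable (s : State)

@[simp] theorem reg_setReg (r v r' : ℕ) :
    (s.setReg r v).reg r' = if r' = r then v else s.reg r' := by
  simp [State.setReg, Function.update_apply]

@[simp] theorem mem_setReg (r v : ℕ) : (s.setReg r v).mem = s.mem := rfl

@[simp] theorem reg_setMem (i : ℕ) (z : ℂ) : (s.setMem i z).reg = s.reg := rfl

@[simp] theorem reg_setArr (k i : ℕ) (z : ℂ) : (s.setArr k i z).reg = s.reg := rfl

theorem mem_setMem (i : ℕ) (z : ℂ) (j : ℕ) :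
    (s.setMem i z).mem j = if j = i then z else s.mem j := by
  simp [State.setMem, Function.update_apply]

theorem mem_setArr_of_lt (k i : ℕ) (z : ℂ) {j : ℕ} (h : j < s.reg 4) :
    (s.setArr k i z).mem j = s.mem j := by
  rw [State.setArr, mem_setMem, if_neg (by omega)]

theorem arr_setReg {r : ℕ} (h : r ≠ 4) (v k i : ℕ) : (s.setReg r v).arr k i = s.arr k i := by
  simp [State.arr, h.symm]

theorem arr_setMem_of_lt {j : ℕ} (h : j < s.reg 4) (z : ℂ) (k i : ℕ) :
    (s.setMem j z).arr k i = s.arr k i := by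
  rw [State.arr, mem_setMem, reg_setMem, if_neg (by omega), State.arr]

/-- Relative to the base, the array number is the residue of the address modulo 10, so distinct
arrays never share a cell. -/
theorem arr_setArr {k k' : ℕ} (hk : k < 10) (hk' : k' < 10) (i i' : ℕ) (z : ℂ) :
    (s.setArr k i z).arr k' i' = if k' = k ∧ i' = i then z else s.arr k' i' := by
  rw [State.arr, reg_setArr, State.setArr, mem_setMem, State.arr]
  by_cases h : k' = k ∧ i' = i
  · rw [if_pos h, if_pos (by omega)]
  · rw [if_neg h, if_neg (by omega)]

@[simp] theorem eval_ld (k e : IntExpr) : (ld k e).eval s = s.arr (k.eval s) (e.eval s) := rfl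

@[simp] theorem time_ld (k e : IntExpr) : (ld k e).time = k.time + e.time + 6 := by
  simp only [ld, cell, CxExpr.time, IntExpr.time]; omega

@[simp] theorem cells_ld (k e : IntExpr) :
    (ld k e).cells s = s.reg 4 + 10 * e.eval s + k.eval s + 1 := rfl

@[simp] theorem peak_ld (k e : IntExpr) :
    (ld k e).peak s = (cell k e).peak s := rfl

@[simp] theorem time_st (k e : IntExpr) (v : CxExpr) :
    (st k e v).time s = k.time + e.time + v.time + 6 := by
  simp only [st, cell, Prog.time, IntExpr.time]; omega

end Arrays

theorem Ok.weaken {C M T T' : ℕ} {P : Prog} {s : State} {Q : State → Prop} (hT : T ≤ T')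
    (h : Ok C M P s T Q) : Ok C M P s T' Q := h.mono hT fun _ h => h

/-- The evaluation of `v` stays within `C` cells and the word size `M`. -/
def Fits (C M : ℕ) (s : State) (v : CxExpr) : Prop := v.cells s ≤ C ∧ v.peak s ≤ M

theorem Ok.st {C M : ℕ} {s : State} {Q : State → Prop} {k e : IntExpr} {v : CxExpr} {k' i : ℕ} {z : ℂ}
    (hk : k.eval s = k') (he : e.eval s = i) (hv : v.eval s = z)
    (hside : Fits C M s (ld k e) ∧ Fits C M s v) (hQ : Q (s.setArr k' i z)) :
    Ok C M (st k e v) s (k.time + e.time + v.time + 6) Q := by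
  subst hk he hv
  exact ⟨hQ, (time_st s k e v).le, max_le hside.1.1 hside.2.1, max_le hside.1.2 hside.2.2⟩

section Fits

variable {C M : ℕ} {s : State}

theorem fits_rat (q : ℚ) : Fits C M s (.rat q) ↔ True := by
  simp [Fits, CxExpr.cells, CxExpr.peak]

theorem fits_imag : Fits C M s .imag ↔ True := by
  simp [Fits, CxExpr.cells, CxExpr.peak]

theorem fits_add (a b : CxExpr) : Fits C M s (.add a b) ↔ Fits C M s a ∧ Fits C M s b := by
  simp only [Fits, CxExpr.cells, CxExpr.peak, max_le_iff]; tauto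

theorem fits_sub (a b : CxExpr) : Fits C M s (.sub a b) ↔ Fits C M s a ∧ Fits C M s b := by
  simp only [Fits, CxExpr.cells, CxExpr.peak, max_le_iff]; tauto

theorem fits_mul (a b : CxExpr) : Fits C M s (.mul a b) ↔ Fits C M s a ∧ Fits C M s b := by
  simp only [Fits, CxExpr.cells, CxExpr.peak, max_le_iff]; tauto

theorem fits_exp (a : CxExpr) : Fits C M s (.exp a) ↔ Fits C M s a := Iff.rfl

/-- The partial sums of an address do not exceed the address, hence they stay below `C` and `M`; the
literal 10 in the address accounts for `10 ≤ C`. Only the peaks of the subexpressions remain to be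
checked. -/
theorem fits_ld (h10 : 10 ≤ C) (hCM : C ≤ M) (k e : IntExpr) : Fits C M s (ld k e) ↔
    (k.peak s ≤ M ∧ e.peak s ≤ M) ∧ s.reg 4 + 10 * e.eval s + k.eval s + 1 ≤ C := by
  rw [Fits, cells_ld, peak_ld]
  simp only [cell, IntExpr.peak, IntExpr.eval, max_le_iff]
  omega

theorem fits_ld_reg (h10 : 10 ≤ C) (hCM : C ≤ M) (k r : ℕ) : Fits C M s (ld (.lit k) (.reg r)) ↔
    s.reg 4 + 10 * s.reg r + k + 1 ≤ C := by
  rw [fits_ld h10 hCM]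
  simp only [IntExpr.peak, IntExpr.eval]
  omega

theorem fits_ld_lit (h10 : 10 ≤ C) (hCM : C ≤ M) (k i : ℕ) : Fits C M s (ld (.lit k) (.lit i)) ↔
    s.reg 4 + 10 * i + k + 1 ≤ C := by
  rw [fits_ld h10 hCM]
  simp only [IntExpr.peak, IntExpr.eval]
  omega

theorem fits_ld_reg_reg (h10 : 10 ≤ C) (hCM : C ≤ M) (k r : ℕ) :
    Fits C M s (ld (.reg k) (.reg r)) ↔ s.reg 4 + 10 * s.reg r + s.reg k + 1 ≤ C := by
  rw [fits_ld h10 hCM]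
  simp only [IntExpr.peak, IntExpr.eval]
  omega

end Fits

/-- `s'` agrees with `s` in the registers below `R`, the cells in front of the arrays, and the arrays
below `L`. -/
structure Keep (R L : ℕ) (s s' : State) : Prop where
  base : s'.reg 4 = s.reg 4
  reg : ∀ r < R, s'.reg r = s.reg r
  low : ∀ j < s.reg 4, s'.mem j = s.mem j
  arr : ∀ k < L, ∀ i, s'.arr k i = s.arr k i

section Keep

variable {R L R' L' : ℕ} {s s' s'' : State}

theorem Keep.refl (R L : ℕ) (s : State) : Keep R L s s :=
  ⟨rfl, fun _ _ => rfl, fun _ _ => rfl, fun _ _ _ => rfl⟩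

theorem Keep.trans (h : Keep R L s s') (h' : Keep R L s' s'') : Keep R L s s'' :=
  ⟨h'.base.trans h.base, fun r hr => (h'.reg r hr).trans (h.reg r hr),
    fun j hj => (h'.low j (by rw [h.base]; exact hj)).trans (h.low j hj),
    fun k hk i => (h'.arr k hk i).trans (h.arr k hk i)⟩

/-- A subroutine that preserves more registers and arrays than its caller promises can thus be
composed with the other steps of the caller. -/
theorem Keep.mono (h : Keep R L s s') (hR : R' ≤ R) (hL : L' ≤ L) : Keep R' L' s s' :=
  ⟨h.base, fun r hr => h.reg r (hr.trans_le hR), h.low, fun k hk i => h.arr k (hk.trans_le hL) i⟩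

theorem Keep.setReg (h : Keep R L s s') {r : ℕ} (hr : R ≤ r) (h4 : r ≠ 4) (v : ℕ) :
    Keep R L s (s'.setReg r v) :=
  ⟨by simp [h4.symm, h.base], fun r' hr' => by
    rw [reg_setReg, if_neg (by omega), h.reg r' hr'], h.low,
    fun k hk i => by rw [arr_setReg _ h4, h.arr k hk i]⟩

theorem Keep.setArr (h : Keep R L s s') {k : ℕ} (hk : L ≤ k) (hk10 : k < 10) (i : ℕ) (z : ℂ) :
    Keep R L s (s'.setArr k i z) :=
  ⟨h.base, h.reg, fun j hj => by rw [mem_setArr_of_lt _ _ _ _ (by rw [h.base]; exact hj), h.low j hj],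
    fun k' hk' i' => by
      rw [arr_setArr _ hk10 (by omega), if_neg (by omega), h.arr k' hk' i']⟩

end Keep

/-- The registers `1, …, 4` hold the numbers `n = 2p+1`, `n²`, `2^n` and the base of the arrays. -/
structure Env (p : ℕ) (s : State) : Prop where
  r0 : s.reg 0 = p
  r1 : s.reg 1 = 2 * p + 1
  r2 : s.reg 2 = (2 * p + 1) * (2 * p + 1)
  r3 : s.reg 3 = 2 ^ (2 * p + 1)
  r4 : s.reg 4 = 2 * ((2 * p + 1) * (2 * p + 1)) + 1

theorem Env.keep {p R L : ℕ} {s s' : State} (hs : Env p s) (h : Keep R L s s') (hR : 5 ≤ R) :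
    Env p s' :=
  ⟨(h.reg 0 (by omega)).trans hs.r0, (h.reg 1 (by omega)).trans hs.r1,
    (h.reg 2 (by omega)).trans hs.r2, (h.reg 3 (by omega)).trans hs.r3,
    (h.reg 4 (by omega)).trans hs.r4⟩

/-- The space and word size suffice for arrays of length `X`. -/
structure Caps (p X C M : ℕ) : Prop where
  sq_le : (2 * p + 1) * (2 * p + 1) ≤ X
  cells : 2 * ((2 * p + 1) * (2 * p + 1)) + 1 + 10 * X + 10 ≤ C
  peak : C + 2 ^ (2 * p + 1) + 2 ^ (2 * p + 1) ≤ M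

theorem Caps.ten_le {p X C M : ℕ} (h : Caps p X C M) : 10 ≤ C := by
  have := h.cells
  omega

theorem Caps.le {p X C M : ℕ} (h : Caps p X C M) : C ≤ M := by
  have h1 := h.peak
  have h2 := Nat.two_pow_pos (2 * p + 1)
  omega

/-! ### Powers of two -/

/-- `r := 2 ^ e`, with scratch register `r + 1`. -/
def powProg (r : ℕ) (e : IntExpr) : Prog :=
  .seq (.assign r (.lit 1)) (.loop (r + 1) e (.assign r (.mul (.reg r) (.lit 2))))

theorem powProg_ok {C M : ℕ} {s : State} {r x m : ℕ} (hr : 4 < r) (hx : x < r) (hm : s.reg x = m)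
    (hM : 2 ^ m ≤ M) (h2 : 2 ≤ M) :
    Ok C M (powProg r (.reg x)) s (5 * m + 4)
      (fun s' => Keep r 10 s s' ∧ s'.mem = s.mem ∧ s'.reg r = 2 ^ m) := by
  have hmM : m ≤ M := Nat.lt_two_pow_self.le.trans hM
  refine (Ok.seq (Q := fun s' => Keep r 10 s s' ∧ s'.mem = s.mem ∧ s'.reg r = 1 ∧ s'.reg x = m)
    (Ok.assign (by simp [IntExpr.peak]; omega) ?_) fun s1 h1 => Ok.loop (T := 4) (n := m)
      (Inv := fun i s' => Keep r 10 s s' ∧ s'.mem = s.mem ∧ s'.reg r = 2 ^ i) ?_ ?_ ?_ ?_).mono ?_ ?_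
  · refine ⟨(Keep.refl _ _ _).setReg le_rfl (by omega) _, rfl, by simp [IntExpr.eval], ?_⟩
    rw [reg_setReg, if_neg (by omega), hm]
  · exact ⟨h1.1, h1.2.1, by simpa using h1.2.2.1⟩
  · exact h1.2.2.2
  · simpa [IntExpr.peak, h1.2.2.2] using hmM
  · intro i hi s' hs'
    have h3 : 2 ^ (i + 1) ≤ M := (Nat.pow_le_pow_right (by omega) (by omega)).trans hM
    rw [pow_succ] at h3
    have e : ((s'.setReg (r + 1) i).reg r) = 2 ^ i := by
      rw [reg_setReg, if_neg (by omega), hs'.2.2]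
    refine Ok.assign (e := .mul (.reg r) (.lit 2)) ?_ ⟨?_, hs'.2.1, ?_⟩
    · simp only [IntExpr.peak, IntExpr.eval, e]; omega
    · exact (hs'.1.setReg (by omega) (by omega) _).setReg le_rfl (by omega) _
    · rw [reg_setReg, if_pos rfl]
      simp only [IntExpr.eval, e, pow_succ]
  · simp [IntExpr.time]; omega
  · exact fun s' h => h

set_option linter.unusedSimpArgs false

/-! ### The weight of a bitstring -/

/-- The sign encoded by bit `j` of `x`. -/
def sbit (x j : ℕ) : ℂ := if x / 2 ^ j % 2 = 0 then 1 else -1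

/-- The weight `f` of the bitstring encoded by `x`, in terms of the tables `P` of `e^{iθ}` and `N` of
`e^{-iθ}`. -/
def tableWeight (P N : ℕ → ℂ) (p x : ℕ) : ℂ :=
  1 / 2 * ∏ i ∈ Finset.range (2 * p), (1 / 2 * (P i + sbit x i * sbit x (i + 1) * N i))

/-- Array `7` := the signs of the bitstring in register `7`. -/
def signProg : Prog :=
  .seq (.assign 8 (.reg 7)) (.loop 9 (.reg 1)
    (.seq (.ite (.mod (.reg 8) (.lit 2)) (st (.lit 7) (.reg 9) (.rat (-1)))
      (st (.lit 7) (.reg 9) (.rat 1))) (.assign 8 (.div (.reg 8) (.lit 2)))))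

section

variable {p X C M : ℕ} {s : State}

theorem le_sq_self (p : ℕ) : 2 * p + 1 ≤ (2 * p + 1) * (2 * p + 1) := Nat.le_mul_self _

/-- Register 8 holds the number shifted right by i bits at the start of pass i, so its parity is bit
i. -/
theorem signProg_ok (hcap : Caps p X C M) (hs : Env p s) {a : ℕ} (ha : s.reg 7 = a)
    (haN : a < 2 ^ (2 * p + 1)) :
    Ok C M signProg s (50 * (2 * p + 1))
      (fun s' => Keep 8 7 s s' ∧ ∀ j < 2 * p + 1, s'.arr 7 j = sbit a j) := by
  have h1 := le_sq_self p
  have h2 := hcap.sq_le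
  have h3 := hcap.cells
  have h4 := hcap.peak
  have h10 := hcap.ten_le
  have hCM := hcap.le
  have hN := Nat.two_pow_pos (2 * p + 1)
  have h5 := hs.r4
  refine ((Ok.seq (Q := fun s' => Keep 8 7 s s' ∧ s'.reg 8 = a)
    (Ok.assign (by simp [IntExpr.peak]; omega) ?_) fun s1 hs1 => Ok.loop (T := 24) (n := 2 * p + 1)
      (Inv := fun i s' => Keep 8 7 s s' ∧ s'.reg 8 = a / 2 ^ i ∧ ∀ j < i, s'.arr 7 j = sbit a j)
      ?_ ?_ ?_ ?_)).mono ?_ ?_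
  · exact ⟨(Keep.refl _ _ _).setReg le_rfl (by omega) _, by simp [IntExpr.eval, ha]⟩
  · exact ⟨hs1.1, by simpa using hs1.2, by simp⟩
  · exact (hs.keep hs1.1 (by omega)).r1
  · simp only [IntExpr.peak, (hs.keep hs1.1 (by omega)).r1]; omega
  · rintro i hi s' ⟨hk, h8, harr⟩
    have hai : a / 2 ^ i ≤ a := Nat.div_le_self _ _
    have hb : s'.reg 4 = s.reg 4 := hk.base
    have hset : ∀ z, z = sbit a i → Keep 8 7 s ((s'.setReg 9 i).setArr 7 i z) ∧
        ((s'.setReg 9 i).setArr 7 i z).reg 8 = a / 2 ^ i ∧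
        ∀ j < i + 1, ((s'.setReg 9 i).setArr 7 i z).arr 7 j = sbit a j := fun z hz => by
      refine ⟨(hk.setReg (by omega) (by omega) _).setArr le_rfl (by omega) _ _, by simp [h8], ?_⟩
      intro j hj
      rw [arr_setArr _ (by omega) (by omega), arr_setReg _ (by omega)]
      split_ifs with h
      · rw [h.2, hz]
      · exact harr j (by omega)
    refine Ok.weaken ?_ (Ok.seq (Ok.ite (T := 9) (Q := fun s' => Keep 8 7 s s' ∧
        s'.reg 8 = a / 2 ^ i ∧ ∀ j < i + 1, s'.arr 7 j = sbit a j) ?_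
      (fun h => Ok.st (k' := 7) (i := i) (z := -1) ?_ ?_ ?_ ?_ (hset _ ?_))
      (fun h => Ok.st (k' := 7) (i := i) (z := 1) ?_ ?_ ?_ ?_ (hset _ ?_)))
      fun s2 hs2 => Ok.assign ?_ ⟨?_, ?_, ?_⟩)
    · simp [IntExpr.time]
    · simp [IntExpr.peak, IntExpr.eval, h8]; omega
    · simp [IntExpr.eval]
    · simp [IntExpr.eval]
    · simp [CxExpr.eval]
    · simp [fits_rat, fits_add, fits_mul, fits_exp, fits_ld_reg h10 hCM, fits_ld_lit h10 hCM,
        fits_ld_reg_reg h10 hCM, fits_ld h10 hCM, IntExpr.peak, IntExpr.eval, hb]; omega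
    · exact (if_neg (by simpa [IntExpr.eval, h8] using h)).symm
    · simp [IntExpr.eval]
    · simp [IntExpr.eval]
    · simp [CxExpr.eval]
    · simp [fits_rat, fits_add, fits_mul, fits_exp, fits_ld_reg h10 hCM, fits_ld_lit h10 hCM,
        fits_ld_reg_reg h10 hCM, fits_ld h10 hCM, IntExpr.peak, IntExpr.eval, hb]; omega
    · exact (if_pos (by simpa [IntExpr.eval, h8] using h)).symm
    · simp [IntExpr.peak, IntExpr.eval, hs2.2.1]; omega
    · exact hs2.1.setReg le_rfl (by omega) _
    · simp [IntExpr.eval, hs2.2.1, Nat.div_div_eq_div_mul, pow_succ]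
    · intro j hj
      rw [arr_setReg _ (by omega), hs2.2.2 j hj]
  · simp [IntExpr.time]; omega
  · exact fun s' h => ⟨h.1, h.2.2⟩

/-- Array `7` := the signs of the bitstring in register `7`; cell `0` of array `8` := its weight. -/
def weightProg : Prog :=
  .seq signProg (.seq (st (.lit 8) (.lit 0) (.rat (1 / 2)))
    (.loop 8 (.mul (.lit 2) (.reg 0)) (st (.lit 8) (.lit 0) (.mul (ld (.lit 8) (.lit 0))
      (.mul (.rat (1 / 2)) (.add (ld (.lit 1) (.reg 8)) (.mul (.mul (ld (.lit 7) (.reg 8))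
        (ld (.lit 7) (.add (.reg 8) (.lit 1)))) (ld (.lit 2) (.reg 8)))))))))

theorem weightProg_ok (hcap : Caps p X C M) (hs : Env p s) {a : ℕ} (ha : s.reg 7 = a)
    (haN : a < 2 ^ (2 * p + 1)) :
    Ok C M weightProg s (150 * (2 * p + 1))
      (fun s' => Keep 8 7 s s' ∧ (∀ j < 2 * p + 1, s'.arr 7 j = sbit a j) ∧
        s'.arr 8 0 = tableWeight (s.arr 1) (s.arr 2) p a) := by
  have h1 := le_sq_self p
  have h2 := hcap.sq_le
  have h3 := hcap.cells
  have h4 := hcap.peak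
  have h10 := hcap.ten_le
  have hCM := hcap.le
  have hN := Nat.two_pow_pos (2 * p + 1)
  have h5 := hs.r4
  refine (Ok.seq (signProg_ok hcap hs ha haN) fun s1 hs1 =>
    (Ok.seq (Ok.st (k' := 8) (i := 0) (z := 1 / 2)
      (Q := fun s' => Keep 8 7 s s' ∧ (∀ j < 2 * p + 1, s'.arr 7 j = sbit a j) ∧
        s'.arr 8 0 = 1 / 2) ?_ ?_ ?_ ?_ ?_) fun s2 hs2 =>
    Ok.loop (T := 70) (n := 2 * p)
      (Inv := fun i s' => Keep 8 7 s s' ∧ (∀ j < 2 * p + 1, s'.arr 7 j = sbit a j) ∧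
        s'.arr 8 0 = 1 / 2 * ∏ l ∈ Finset.range i,
          (1 / 2 * (s.arr 1 l + sbit a l * sbit a (l + 1) * s.arr 2 l)))
      ?_ ?_ ?_ ?_)).mono ?_ ?_
  · simp [IntExpr.eval]
  · simp [IntExpr.eval]
  · simp [CxExpr.eval]
  · simp [fits_rat, fits_add, fits_mul, fits_exp, fits_ld_reg h10 hCM, fits_ld_lit h10 hCM,
        fits_ld_reg_reg h10 hCM, fits_ld h10 hCM, IntExpr.peak, IntExpr.eval, hs1.1.base]; omega
  · refine ⟨hs1.1.setArr (by omega) (by omega) _ _, fun j hj => ?_, ?_⟩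
    · rw [arr_setArr _ (by omega) (by omega), if_neg (by omega), hs1.2 j hj]
    · rw [arr_setArr _ (by omega) (by omega), if_pos ⟨rfl, rfl⟩]
  · exact ⟨hs2.1, hs2.2.1, by simpa using hs2.2.2⟩
  · simp [IntExpr.eval, (hs.keep hs2.1 (by omega)).r0]
  · simp [IntExpr.peak, IntExpr.eval, (hs.keep hs2.1 (by omega)).r0]; omega
  · rintro i hi s' ⟨hk, harr, hw⟩
    have hb : s'.reg 4 = s.reg 4 := hk.base
    refine Ok.weaken ?_ (Ok.st (k' := 8) (i := 0) (z := s'.arr 8 0 *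
      (1 / 2 * (s.arr 1 i + sbit a i * sbit a (i + 1) * s.arr 2 i))) ?_ ?_ ?_ ?_ ⟨?_, ?_, ?_⟩)
    · simp [CxExpr.time, IntExpr.time]
    · simp [IntExpr.eval]
    · simp [IntExpr.eval]
    · simp [CxExpr.eval, IntExpr.eval, arr_setReg, harr i (by omega), harr (i + 1) (by omega),
        hk.arr 1, hk.arr 2]
    · simp [fits_rat, fits_add, fits_mul, fits_exp, fits_ld_reg h10 hCM, fits_ld_lit h10 hCM,
        fits_ld_reg_reg h10 hCM, fits_ld h10 hCM, IntExpr.peak, IntExpr.eval, hb]; omega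
    · exact (hk.setReg (by omega) (by omega) _).setArr (by omega) (by omega) _ _
    · intro j hj
      rw [arr_setArr _ (by omega) (by omega), if_neg (by omega), arr_setReg _ (by omega), harr j hj]
    · rw [arr_setArr _ (by omega) (by omega), if_pos ⟨rfl, rfl⟩, Finset.prod_range_succ, hw]
      ring
  · simp [CxExpr.time, IntExpr.time]; omega
  · exact fun s' h => h

end

/-! ### One step of the iteration in space `O(p²)` -/

/-- Registers `a`, `b` := the row and the column of the matrix entry whose number is in register `q`. -/
def decodeProg (q a b : ℕ) : Prog :=
  .seq (.assign a (.div (.reg q) (.reg 1))) (.assign b (.mod (.reg q) (.reg 1)))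

/-- `∑_{j,k} Γ_j Γ_k x_j x_k W_{j,k}`. -/
def tableQuad (Γ W : ℕ → ℂ) (n x : ℕ) : ℂ :=
  ∑ q ∈ Finset.range (n * n), Γ (q / n) * Γ (q % n) * sbit x (q / n) * sbit x (q % n) * W q

/-- The weight of a bitstring in one step of the iteration. -/
def tableFactor (Γ P N W : ℕ → ℂ) (p x : ℕ) : ℂ :=
  tableWeight P N p x * Complex.exp (-1 / 2 * tableQuad Γ W (2 * p + 1) x)

/-- Entry `q` of the next matrix. -/
def tableStep (Γ P N W : ℕ → ℂ) (p q : ℕ) : ℂ :=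
  ∑ x ∈ Finset.range (2 ^ (2 * p + 1)), tableFactor Γ P N W p x * sbit x (q / (2 * p + 1))
    * sbit x (q % (2 * p + 1))

/-- `φ` computes one step of the iteration, with the destination array given in register `6`. -/
def ComputesStep (φ : Prog) (p C M T : ℕ) : Prop :=
  ∀ s d, Env p s → s.reg 6 = d → 4 ≤ d → d ≤ 5 → Ok C M φ s T fun s' => Keep 7 d s s' ∧
    ∀ q < (2 * p + 1) * (2 * p + 1),
      s'.arr d q = tableStep (s.arr 0) (s.arr 1) (s.arr 2) (s.arr 3) p q

section

variable {p X C M : ℕ} {s : State}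

theorem decodeProg_ok (hcap : Caps p X C M) (hs : Env p s) {q a b i : ℕ} (hq : s.reg q = i)
    (hi : i < (2 * p + 1) * (2 * p + 1)) (hqa : q < a) (hab : a < b) (ha : 4 < a) :
    Ok C M (decodeProg q a b) s 8 (fun s' => Keep a 10 s s' ∧
      s'.reg a = i / (2 * p + 1) ∧ s'.reg b = i % (2 * p + 1)) := by
  have h1 := le_sq_self p
  have h2 := hcap.sq_le
  have h3 := hcap.cells
  have h4 := hcap.peak
  have h10 := hcap.ten_le
  have hCM := hcap.le
  have hN := Nat.two_pow_pos (2 * p + 1)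
  have h5 := hs.r1
  have h6 := Nat.div_le_self i (2 * p + 1)
  have h7 := Nat.mod_le i (2 * p + 1)
  refine Ok.weaken ?_ (Ok.seq (Q := fun s' => Keep a 10 s s' ∧ s'.reg a = i / (2 * p + 1))
    (Ok.assign ?_ ⟨?_, ?_⟩) fun s' hs' => Ok.assign ?_ ⟨?_, ?_, ?_⟩)
  · simp [IntExpr.time]
  · simp only [IntExpr.peak, IntExpr.eval, hq, h5, max_le_iff]; omega
  · exact (Keep.refl _ _ _).setReg le_rfl (by omega) _
  · simp [IntExpr.eval, hq, h5]
  · have e1 := hs'.1.reg q hqa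
    have e2 := hs'.1.reg 1 (by omega)
    simp only [IntExpr.peak, IntExpr.eval, e1, e2, hq, h5, max_le_iff]; omega
  · exact hs'.1.setReg (by omega) (by omega) _
  · rw [reg_setReg, if_neg (by omega), hs'.2]
  · rw [reg_setReg, if_pos rfl]
    simp only [IntExpr.eval, hs'.1.reg q hqa, hs'.1.reg 1 (by omega), hq, h5]

/-- Cell `0` of array `9` := the quadratic form at the bitstring whose signs are in array `7`. -/
def quadProg : Prog :=
  .seq (st (.lit 9) (.lit 0) (.rat 0)) (.loop 8 (.reg 2) (.seq (decodeProg 8 9 10)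
    (st (.lit 9) (.lit 0) (.add (ld (.lit 9) (.lit 0)) (.mul (.mul (.mul (.mul (ld (.lit 0) (.reg 9))
      (ld (.lit 0) (.reg 10))) (ld (.lit 7) (.reg 9))) (ld (.lit 7) (.reg 10)))
      (ld (.lit 3) (.reg 8)))))))

theorem quadProg_ok (hcap : Caps p X C M) (hs : Env p s) {a : ℕ}
    (hS : ∀ j < 2 * p + 1, s.arr 7 j = sbit a j) :
    Ok C M quadProg s (110 * ((2 * p + 1) * (2 * p + 1)))
      (fun s' => Keep 8 9 s s' ∧ s'.arr 9 0 = tableQuad (s.arr 0) (s.arr 3) (2 * p + 1) a) := by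
  have h1 := le_sq_self p
  have h2 := hcap.sq_le
  have h3 := hcap.cells
  have h4 := hcap.peak
  have h10 := hcap.ten_le
  have hCM := hcap.le
  have hN := Nat.two_pow_pos (2 * p + 1)
  have h5 := hs.r4
  refine (Ok.seq (Ok.st (k' := 9) (i := 0) (z := 0)
      (Q := fun s' => Keep 8 9 s s' ∧ s'.arr 9 0 = 0) ?_ ?_ ?_ ?_ ?_) fun s2 hs2 =>
    Ok.loop (T := 90) (n := (2 * p + 1) * (2 * p + 1))
      (Inv := fun i s' => Keep 8 9 s s' ∧ s'.arr 9 0 = ∑ q ∈ Finset.range i,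
        s.arr 0 (q / (2 * p + 1)) * s.arr 0 (q % (2 * p + 1)) * sbit a (q / (2 * p + 1))
          * sbit a (q % (2 * p + 1)) * s.arr 3 q)
      ?_ ?_ ?_ ?_).mono ?_ ?_
  · simp [IntExpr.eval]
  · simp [IntExpr.eval]
  · simp [CxExpr.eval]
  · simp [fits_rat, fits_add, fits_mul, fits_exp, fits_ld_reg h10 hCM, fits_ld_lit h10 hCM,
        fits_ld_reg_reg h10 hCM, fits_ld h10 hCM, IntExpr.peak, IntExpr.eval]; omega
  · exact ⟨(Keep.refl _ _ _).setArr (by omega) (by omega) _ _, by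
      rw [arr_setArr _ (by omega) (by omega), if_pos ⟨rfl, rfl⟩]⟩
  · exact ⟨hs2.1, by simpa using hs2.2⟩
  · exact (hs.keep hs2.1 (by omega)).r2
  · simp only [IntExpr.peak, (hs.keep hs2.1 (by omega)).r2]; omega
  · rintro i hi s' ⟨hk, hsum⟩
    have hj : i / (2 * p + 1) < 2 * p + 1 := Nat.div_lt_of_lt_mul hi
    have hk' : i % (2 * p + 1) < 2 * p + 1 := Nat.mod_lt _ (by omega)
    have hk1 : Keep 8 9 s (s'.setReg 8 i) := hk.setReg (by omega) (by omega) _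
    refine Ok.weaken ?_ (Ok.seq (decodeProg_ok hcap (hs.keep hk1 (by omega)) (i := i) (by simp) hi
      (by omega) (by omega) (by omega)) fun s3 ⟨hk3, h9, h9m⟩ => Ok.st (k' := 9) (i := 0)
      (z := s'.arr 9 0 + s.arr 0 (i / (2 * p + 1)) * s.arr 0 (i % (2 * p + 1))
          * sbit a (i / (2 * p + 1)) * sbit a (i % (2 * p + 1)) * s.arr 3 i) ?_ ?_ ?_ ?_ ⟨?_, ?_⟩)
    · simp [CxExpr.time, IntExpr.time]
    · simp [IntExpr.eval]
    · simp [IntExpr.eval]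
    · have h8 : s3.reg 8 = i := by rw [hk3.reg 8 (by omega)]; simp
      simp [CxExpr.eval, IntExpr.eval, hk3.arr, arr_setReg, hk.arr, h8, h9, h9m, hS _ hj, hS _ hk']
    · have h8 : s3.reg 8 = i := by rw [hk3.reg 8 (by omega)]; simp
      have hb : s3.reg 4 = s.reg 4 := hk3.base.trans hk1.base
      simp [fits_rat, fits_add, fits_mul, fits_exp, fits_ld_reg h10 hCM, fits_ld_lit h10 hCM,
        fits_ld_reg_reg h10 hCM, fits_ld h10 hCM, IntExpr.peak, IntExpr.eval, hb, h8, h9, h9m]; omega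
    · exact (hk1.trans (hk3.mono (by omega) (by omega))).setArr (by omega) (by omega) _ _
    · rw [arr_setArr _ (by omega) (by omega), if_pos ⟨rfl, rfl⟩, Finset.sum_range_succ, hsum]
  · simp [CxExpr.time, IntExpr.time]; omega
  · exact fun s' h => h

/-- Add the contribution of one bitstring to the destination array. -/
def accumulateProg : Prog :=
  .loop 8 (.reg 2) (.seq (decodeProg 8 9 10) (st (.reg 6) (.reg 8) (.add (ld (.reg 6) (.reg 8))
    (.mul (.mul (ld (.lit 8) (.lit 0)) (ld (.lit 7) (.reg 9))) (ld (.lit 7) (.reg 10))))))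

theorem accumulateProg_ok (hcap : Caps p X C M) (hs : Env p s) {a d : ℕ} (hd : s.reg 6 = d)
    (hd5 : d ≤ 5) (hS : ∀ j < 2 * p + 1, s.arr 7 j = sbit a j) :
    Ok C M accumulateProg s (100 * ((2 * p + 1) * (2 * p + 1)))
      (fun s' => Keep 8 d s s' ∧ ∀ q < (2 * p + 1) * (2 * p + 1), s'.arr d q = s.arr d q
        + s.arr 8 0 * sbit a (q / (2 * p + 1)) * sbit a (q % (2 * p + 1))) := by
  have h1 := le_sq_self p
  have h2 := hcap.sq_le
  have h3 := hcap.cells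
  have h4 := hcap.peak
  have h10 := hcap.ten_le
  have hCM := hcap.le
  have hN := Nat.two_pow_pos (2 * p + 1)
  have h5 := hs.r4
  refine (Ok.loop (T := 80) (n := (2 * p + 1) * (2 * p + 1))
      -- `Keep` is silent about arrays above `d`, but the body reads arrays 7 and 8. The invariant
      -- therefore adds that the arrays above `d` do not change.
      (Inv := fun i s' => Keep 8 d s s' ∧ (∀ k, d < k → k < 10 → ∀ j, s'.arr k j = s.arr k j) ∧
        ∀ q, s'.arr d q = s.arr d q + if q < i then
        s.arr 8 0 * sbit a (q / (2 * p + 1)) * sbit a (q % (2 * p + 1)) else 0)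
      ?_ ?_ ?_ ?_).mono ?_ ?_
  · exact ⟨Keep.refl _ _ _, fun _ _ _ _ => rfl, by simp⟩
  · exact hs.r2
  · simp only [IntExpr.peak, hs.r2]; omega
  · rintro i hi s' ⟨hk, hrest, hsum⟩
    have hj : i / (2 * p + 1) < 2 * p + 1 := Nat.div_lt_of_lt_mul hi
    have hk' : i % (2 * p + 1) < 2 * p + 1 := Nat.mod_lt _ (by omega)
    have hk1 : Keep 8 d s (s'.setReg 8 i) := hk.setReg (by omega) (by omega) _
    refine Ok.weaken ?_ (Ok.seq (decodeProg_ok hcap (hs.keep hk1 (by omega)) (i := i) (by simp) hi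
      (by omega) (by omega) (by omega)) fun s3 ⟨hk3, h9, h9m⟩ => Ok.st (k' := d) (i := i)
      (z := s'.arr d i + s.arr 8 0 * sbit a (i / (2 * p + 1)) * sbit a (i % (2 * p + 1)))
      ?_ ?_ ?_ ?_ ⟨?_, ?_, ?_⟩)
    · simp [CxExpr.time, IntExpr.time]
    · simp [IntExpr.eval, hk3.reg, hk.reg, hd]
    · simp [IntExpr.eval, hk3.reg]
    · have h8 : s3.reg 8 = i := by rw [hk3.reg 8 (by omega)]; simp
      have h6 : s3.reg 6 = d := by rw [hk3.reg 6 (by omega), hk1.reg 6 (by omega), hd]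
      simp [CxExpr.eval, IntExpr.eval, hk3.arr, arr_setReg, hrest 7 (by omega), hrest 8 (by omega),
        h6, h8, h9, h9m, hS _ hj, hS _ hk', hk3.arr d (by omega)]
    · have h8 : s3.reg 8 = i := by rw [hk3.reg 8 (by omega)]; simp
      have h6 : s3.reg 6 = d := by rw [hk3.reg 6 (by omega), hk1.reg 6 (by omega), hd]
      have hb : s3.reg 4 = s.reg 4 := hk3.base.trans hk1.base
      simp [fits_rat, fits_add, fits_mul, fits_exp, fits_ld_reg h10 hCM, fits_ld_lit h10 hCM,
        fits_ld_reg_reg h10 hCM, fits_ld h10 hCM, IntExpr.peak, IntExpr.eval, hb, h6, h8, h9, h9m]; omega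
    · exact (hk1.trans (hk3.mono (by omega) (by omega))).setArr (by omega) (by omega) _ _
    · intro k hdk hk10 j
      rw [arr_setArr _ (by omega) (by omega), if_neg (by omega), hk3.arr k hk10,
        arr_setReg _ (by omega), hrest k hdk hk10]
    · intro q
      rw [arr_setArr _ (by omega) (by omega)]
      by_cases hq : q = i
      · subst hq
        rw [if_pos ⟨rfl, rfl⟩, hsum q, if_neg (by omega), if_pos (by omega), add_zero]
      · rw [if_neg (by omega), hk3.arr d (by omega), arr_setReg _ (by omega), hsum q]
        simp only [show q < i + 1 ↔ q < i by omega]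
  · simp [IntExpr.time]; omega
  · exact fun s' h => ⟨h.1, fun q hq => by rw [h.2.2 q, if_pos hq]⟩

/-- One step of the iteration. -/
def smallStep : Prog :=
  .seq (.loop 7 (.reg 2) (st (.reg 6) (.reg 7) (.rat 0)))
    (.loop 7 (.reg 3) (.seq weightProg (.seq quadProg (.seq
      (st (.lit 8) (.lit 0) (.mul (ld (.lit 8) (.lit 0))
        (.exp (.mul (.rat (-1 / 2)) (ld (.lit 9) (.lit 0)))))) accumulateProg))))

/-- Nothing is stored per bitstring: its weight, in O(p) steps, and its quadratic form, in O(p²)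
steps, are recomputed, and its contribution is added at once to all O(p²) entries. -/
theorem smallStep_computes (hcap : Caps p X C M) :
    ComputesStep smallStep p C M (500 * ((2 * p + 1) * (2 * p + 1) * 2 ^ (2 * p + 1))) := by
  intro s d hs hd h4d hd5
  have h1 := le_sq_self p
  have h2 := hcap.sq_le
  have h3 := hcap.cells
  have h4 := hcap.peak
  have h10 := hcap.ten_le
  have hCM := hcap.le
  have hN := Nat.two_pow_pos (2 * p + 1)
  have h5 := hs.r4
  refine (Ok.seq (Q := fun s' => Keep 7 d s s' ∧ ∀ q < (2 * p + 1) * (2 * p + 1), s'.arr d q = 0)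
    ((Ok.loop (T := 9) (n := (2 * p + 1) * (2 * p + 1))
      (Inv := fun i s' => Keep 7 d s s' ∧ ∀ q < i, s'.arr d q = 0) ?_ ?_ ?_ ?_))
    fun s1 hs1 => Ok.loop (T := 400 * ((2 * p + 1) * (2 * p + 1))) (n := 2 ^ (2 * p + 1))
      (Inv := fun i s' => Keep 7 d s s' ∧ ∀ q < (2 * p + 1) * (2 * p + 1), s'.arr d q =
        ∑ x ∈ Finset.range i, tableFactor (s.arr 0) (s.arr 1) (s.arr 2) (s.arr 3) p x
          * sbit x (q / (2 * p + 1)) * sbit x (q % (2 * p + 1))) ?_ ?_ ?_ ?_).mono ?_ ?_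
  · exact ⟨Keep.refl _ _ _, by simp⟩
  · exact hs.r2
  · simp only [IntExpr.peak, hs.r2]; omega
  · rintro i hi s' ⟨hk, h0⟩
    have hk1 : Keep 7 d s (s'.setReg 7 i) := hk.setReg (by omega) (by omega) _
    have h6 : s'.reg 6 = d := by rw [hk.reg 6 (by omega), hd]
    refine Ok.weaken ?_ (Ok.st (k' := d) (i := i) (z := 0) ?_ ?_ ?_ ?_ ⟨?_, ?_⟩)
    · simp [CxExpr.time, IntExpr.time]
    · simp [IntExpr.eval, h6]
    · simp [IntExpr.eval]
    · simp [CxExpr.eval]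
    · simp [fits_rat, fits_add, fits_mul, fits_exp, fits_ld_reg h10 hCM, fits_ld_lit h10 hCM,
        fits_ld_reg_reg h10 hCM, fits_ld h10 hCM, IntExpr.peak, IntExpr.eval, hk.base, h6]; omega
    · exact hk1.setArr (by omega) (by omega) _ _
    · intro q hq
      rw [arr_setArr _ (by omega) (by omega), arr_setReg _ (by omega)]
      split_ifs with h
      · rfl
      · exact h0 q (by omega)
  · exact ⟨hs1.1, by simpa using hs1.2⟩
  · exact (hs.keep hs1.1 (by omega)).r3
  · simp only [IntExpr.peak, (hs.keep hs1.1 (by omega)).r3]; omega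
  · rintro x hx s' ⟨hk, hsum⟩
    have hk1 : Keep 7 d s (s'.setReg 7 x) := hk.setReg (by omega) (by omega) _
    refine Ok.weaken ?_ (Ok.seq (weightProg_ok hcap (hs.keep hk1 (by omega)) (a := x) (by simp) hx)
      fun s2 ⟨hk2, hS2, hw2⟩ => Ok.seq (quadProg_ok hcap
        (hs.keep (hk1.trans (hk2.mono (by omega) (by omega))) (by omega)) hS2)
      fun s3 ⟨hk3, hq3⟩ => Ok.seq (Ok.st (k' := 8) (i := 0)
        (Q := fun s' => Keep 7 7 s3 s' ∧ (∀ j < 2 * p + 1, s'.arr 7 j = sbit x j) ∧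
          s'.arr 8 0 = tableFactor (s.arr 0) (s.arr 1) (s.arr 2) (s.arr 3) p x)
        (z := s3.arr 8 0 * Complex.exp (-1 / 2 * s3.arr 9 0)) ?_ ?_ ?_ ?_ ?_)
      fun s4 ⟨hk4, hS4, hw4⟩ => Ok.mono (accumulateProg_ok (d := d) hcap ?_ ?_ hd5 hS4) le_rfl ?_)
    · simp [CxExpr.time, IntExpr.time]; omega
    · simp [IntExpr.eval]
    · simp [IntExpr.eval]
    · simp [CxExpr.eval, IntExpr.eval]
    · have hb : s3.reg 4 = s.reg 4 := hk3.base.trans (hk2.base.trans hk1.base)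
      simp [fits_rat, fits_add, fits_mul, fits_exp, fits_ld_reg h10 hCM, fits_ld_lit h10 hCM,
        fits_ld_reg_reg h10 hCM, fits_ld h10 hCM, IntExpr.peak, IntExpr.eval, hb]; omega
    · have e : ∀ k < d, s2.arr k = s.arr k := fun k hk' => funext fun i => by
        rw [hk2.arr k (by omega), hk1.arr k hk']
      have e' : ∀ k < d, (s'.setReg 7 x).arr k = s.arr k := fun k hk' => funext fun i => by
        rw [hk1.arr k hk']
      refine ⟨(Keep.refl _ _ _).setArr (by omega) (by omega) _ _, fun j hj => ?_, ?_⟩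
      · rw [arr_setArr _ (by omega) (by omega), if_neg (by omega), hk3.arr 7 (by omega), hS2 j hj]
      · rw [arr_setArr _ (by omega) (by omega), if_pos ⟨rfl, rfl⟩, hk3.arr 8 (by omega), hw2, hq3,
          e 0 (by omega), e 3 (by omega), e' 1 (by omega), e' 2 (by omega), tableFactor]
    · exact hs.keep (hk1.trans ((hk2.mono (by omega) (by omega)).trans
        ((hk3.mono (by omega) (by omega)).trans (hk4.mono (by omega) (by omega))))) (by omega)
    · rw [hk4.reg 6 (by omega), hk3.reg 6 (by omega), hk2.reg 6 (by omega), hk1.reg 6 (by omega), hd]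
    · rintro s5 ⟨hk5, h5'⟩
      refine ⟨hk1.trans ((hk2.mono (by omega) (by omega)).trans ((hk3.mono (by omega) (by omega)).trans
        ((hk4.mono (by omega) (by omega)).trans (hk5.mono (by omega) (by omega))))), fun q hq => ?_⟩
      rw [h5' q hq, hw4, hk4.arr d (by omega), hk3.arr d (by omega), hk2.arr d (by omega),
        arr_setReg _ (by omega), hsum q hq, Finset.sum_range_succ]
  · simp only [IntExpr.time]
    generalize (2 * p + 1) * (2 * p + 1) = m at *
    generalize 2 ^ (2 * p + 1) = N at *
    nlinarith
  · exact fun s' h => h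

end

/-! ### The Walsh–Hadamard transform -/

/-- The character `(-1)^{x · y}` on the lowest `t` bits. -/
def chi (t x y : ℕ) : ℂ := ∏ j ∈ Finset.range t, if y / 2 ^ j % 2 = 0 then 1 else sbit x j

theorem chi_comm (t x y : ℕ) : chi t x y = chi t y x := by
  refine Finset.prod_congr rfl fun j _ => ?_
  by_cases hx : x / 2 ^ j % 2 = 0 <;> by_cases hy : y / 2 ^ j % 2 = 0 <;> simp [sbit, hx, hy]

theorem sbit_add_two_pow {t j : ℕ} (h : j < t) (y : ℕ) : sbit (y + 2 ^ t) j = sbit y j := by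
  have e : 2 ^ t = 2 ^ j * (2 * 2 ^ (t - j - 1)) := by
    rw [← pow_succ', ← pow_add]; congr 1; omega
  rw [sbit, sbit, e, Nat.add_mul_div_left _ _ (Nat.two_pow_pos j), Nat.add_mul_mod_self_left]

theorem chi_add_two_pow (t y c : ℕ) : chi t (y + 2 ^ t) c = chi t y c :=
  Finset.prod_congr rfl fun j hj => by rw [sbit_add_two_pow (Finset.mem_range.1 hj)]

theorem chi_succ_of_lt {t c : ℕ} (h : c < 2 ^ t) (y : ℕ) : chi (t + 1) y c = chi t y c := by
  rw [chi, Finset.prod_range_succ, Nat.div_eq_of_lt h, if_pos (Nat.zero_mod 2), mul_one, chi]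

theorem chi_succ_two_pow_add {t c : ℕ} (h : c < 2 ^ t) (y : ℕ) :
    chi (t + 1) y (2 ^ t + c) = chi t y c * sbit y t := by
  have e : (2 ^ t + c) / 2 ^ t % 2 = 1 := by
    rw [Nat.add_div_left _ (Nat.two_pow_pos t), Nat.div_eq_of_lt h]
  rw [chi, Finset.prod_range_succ, e, if_neg one_ne_zero, chi_comm t y c, chi]
  congr 1
  refine Finset.prod_congr rfl fun j hj => ?_
  have h1 := sbit_add_two_pow (Finset.mem_range.1 hj) c
  rw [add_comm] at h1
  by_cases hx : y / 2 ^ j % 2 = 0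
  · simp [sbit, hx]
  · rw [if_neg hx, ← h1]
    simp only [sbit, hx, if_false]

/-- The result of the first `t` stages of the transform. -/
def whtPart (A : ℕ → ℂ) (t y : ℕ) : ℂ :=
  ∑ c ∈ Finset.range (2 ^ t), chi t y c * A (y - y % 2 ^ t + c)

theorem whtPart_zero (A : ℕ → ℂ) (y : ℕ) : whtPart A 0 y = A y := by
  simp [whtPart, chi, Nat.mod_one]

/-- After `t` stages an entry is the transform within its block of 2^t entries. Doubling the block
splits the sum by the top bit of `c`, and the upper half acquires the sign of bit `t` of `y`. -/
theorem whtPart_succ (A : ℕ → ℂ) (t y : ℕ) : whtPart A (t + 1) y =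
    ∑ c ∈ Finset.range (2 ^ t), chi t y c * A (y - y % 2 ^ (t + 1) + c)
      + sbit y t * ∑ c ∈ Finset.range (2 ^ t), chi t y c * A (y - y % 2 ^ (t + 1) + 2 ^ t + c) := by
  rw [whtPart, pow_succ, mul_two, Finset.sum_range_add, Finset.mul_sum]
  congr 1
  · exact Finset.sum_congr rfl fun c hc => by rw [chi_succ_of_lt (Finset.mem_range.1 hc)]
  · refine Finset.sum_congr rfl fun c hc => ?_
    rw [chi_succ_two_pow_add (Finset.mem_range.1 hc), add_assoc]
    ring

theorem whtPart_succ_of_even (A : ℕ → ℂ) {t y : ℕ} (h : y / 2 ^ t % 2 = 0) :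
    whtPart A (t + 1) y = whtPart A t y + whtPart A t (y + 2 ^ t) := by
  have hle := Nat.mod_le y (2 ^ t)
  rw [whtPart_succ, Nat.mod_pow_succ, h, mul_zero, add_zero, sbit, if_pos h, one_mul, whtPart, whtPart,
    Nat.add_mod_right]
  congr 1
  refine Finset.sum_congr rfl fun c _ => ?_
  rw [chi_add_two_pow]
  congr 2
  omega

theorem whtPart_succ_of_odd (A : ℕ → ℂ) {t y : ℕ} (h : (y + 2 ^ t) / 2 ^ t % 2 ≠ 0) :
    whtPart A (t + 1) (y + 2 ^ t) = whtPart A t y - whtPart A t (y + 2 ^ t) := by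
  have hle := Nat.mod_le y (2 ^ t)
  have h1 : (y + 2 ^ t) / 2 ^ t % 2 = 1 := by omega
  rw [whtPart_succ, Nat.mod_pow_succ, h1, mul_one, sbit, if_neg h, whtPart, whtPart,
    Nat.add_mod_right, neg_one_mul, ← sub_eq_add_neg]
  congr 1
  · refine Finset.sum_congr rfl fun c _ => ?_
    rw [chi_add_two_pow]
    congr 2
    omega
  · refine Finset.sum_congr rfl fun c _ => ?_
    congr 2
    omega

theorem whtPart_full (A : ℕ → ℂ) {n y : ℕ} (h : y < 2 ^ n) :
    whtPart A n y = ∑ c ∈ Finset.range (2 ^ n), chi n y c * A c := by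
  simp [whtPart, Nat.mod_eq_of_lt h]

/-- One stage of the transform. -/
def butterfly (t : ℕ) (A : ℕ → ℂ) (y : ℕ) : ℂ :=
  if y / 2 ^ t % 2 = 0 then A y + A (y + 2 ^ t) else A (y - 2 ^ t) - A y

/-- Clear bit `t`. -/
def clearBit (t y : ℕ) : ℕ := if y / 2 ^ t % 2 = 0 then y else y - 2 ^ t

theorem two_pow_le_of_odd {t y : ℕ} (h : y / 2 ^ t % 2 ≠ 0) : 2 ^ t ≤ y := by
  by_contra hlt
  rw [Nat.div_eq_of_lt (by omega)] at h
  exact h rfl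

theorem add_two_pow_div (t y : ℕ) : (y + 2 ^ t) / 2 ^ t = y / 2 ^ t + 1 :=
  Nat.add_div_right _ (Nat.two_pow_pos t)

theorem clearBit_even (t y : ℕ) : clearBit t y / 2 ^ t % 2 = 0 := by
  rw [clearBit]
  split_ifs with h
  · exact h
  · obtain ⟨w, rfl⟩ := Nat.exists_eq_add_of_le' (two_pow_le_of_odd h)
    rw [add_two_pow_div] at h
    rw [Nat.add_sub_cancel]
    omega

/-- The two members of a butterfly are the indices with equal `clearBit`, which is the index at
which the loop treats both. -/
theorem clearBit_eq_iff {t z : ℕ} (h : z / 2 ^ t % 2 = 0) (y : ℕ) :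
    clearBit t y = z ↔ y = z ∨ y = z + 2 ^ t := by
  constructor
  · rw [clearBit]
    split_ifs with hy
    · exact fun h => Or.inl h
    · have := two_pow_le_of_odd hy
      have := Nat.two_pow_pos t
      exact fun h => Or.inr (by omega)
  · rintro (rfl | rfl)
    · exact if_pos h
    · rw [clearBit, if_neg (by rw [add_two_pow_div]; omega), Nat.add_sub_cancel]

theorem clearBit_le (t y : ℕ) : clearBit t y ≤ y := by
  rw [clearBit]
  split_ifs
  exacts [le_rfl, Nat.sub_le _ _]

theorem add_two_pow_lt {t n z : ℕ} (ht : t < n) (hz : z < 2 ^ n) (h : z / 2 ^ t % 2 = 0) :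
    z + 2 ^ t < 2 ^ n := by
  have e : 2 ^ n = 2 * 2 ^ (n - t - 1) * 2 ^ t := by
    rw [← pow_succ', ← pow_add]; congr 1; omega
  rw [e] at hz ⊢
  have h1 := (Nat.div_lt_iff_lt_mul (Nat.two_pow_pos t)).2 hz
  refine (Nat.div_lt_iff_lt_mul (Nat.two_pow_pos t)).1 ?_
  rw [add_two_pow_div]
  omega

theorem butterfly_whtPart {A A' : ℕ → ℂ} {t n : ℕ} (ht : t < n)
    (hA : ∀ y < 2 ^ n, A' y = whtPart A t y) {y : ℕ} (hy : y < 2 ^ n) :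
    butterfly t A' y = whtPart A (t + 1) y := by
  rw [butterfly]
  split_ifs with h
  · rw [whtPart_succ_of_even A h, hA y hy, hA _ (add_two_pow_lt ht hy h)]
  · obtain ⟨w, rfl⟩ := Nat.exists_eq_add_of_le' (two_pow_le_of_odd h)
    rw [whtPart_succ_of_odd A h, hA _ hy, Nat.add_sub_cancel,
      hA w ((Nat.le_add_right _ _).trans_lt hy)]

/-- Apply the transform to the first `2^n` entries of array `6`. -/
def whtProg : Prog :=
  .loop 7 (.reg 1) (.seq (powProg 8 (.reg 7)) (.loop 10 (.reg 3)
    (.ite (.mod (.div (.reg 10) (.reg 8)) (.lit 2)) .skip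
      (.seq (st (.lit 6) (.reg 10) (.add (ld (.lit 6) (.reg 10))
          (ld (.lit 6) (.add (.reg 10) (.reg 8)))))
        (st (.lit 6) (.add (.reg 10) (.reg 8)) (.sub (ld (.lit 6) (.reg 10))
          (.mul (.rat 2) (ld (.lit 6) (.add (.reg 10) (.reg 8))))))))))

theorem Ok.skip {C M : ℕ} {s : State} {Q : State → Prop} (h : Q s) : Ok C M .skip s 1 Q :=
  ⟨h, le_rfl, Nat.zero_le _, Nat.zero_le _⟩

section

variable {p X C M : ℕ} {s : State}

/-- The loop visits all indices but acts only where bit `t` is clear, on z and z + 2^t together, so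
entry y is final once the counter has passed `clearBit t y`. The first store overwrites entry z by
the sum; the difference is recovered as the sum minus twice the other entry, without a scratch cell.
-/
theorem butterflyProg_ok (hcap : Caps p X C M) (hX : 2 * 2 ^ (2 * p + 1) ≤ X) (hs : Env p s)
    {t : ℕ} (ht : t < 2 * p + 1) (h8 : s.reg 8 = 2 ^ t) :
    Ok C M (.loop 10 (.reg 3) (.ite (.mod (.div (.reg 10) (.reg 8)) (.lit 2)) .skip
      (.seq (st (.lit 6) (.reg 10) (.add (ld (.lit 6) (.reg 10))
          (ld (.lit 6) (.add (.reg 10) (.reg 8)))))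
        (st (.lit 6) (.add (.reg 10) (.reg 8)) (.sub (ld (.lit 6) (.reg 10))
          (.mul (.rat 2) (ld (.lit 6) (.add (.reg 10) (.reg 8)))))))))
      s (100 * 2 ^ (2 * p + 1)) (fun s' => Keep 9 6 s s' ∧
        ∀ y < 2 ^ (2 * p + 1), s'.arr 6 y = butterfly t (s.arr 6) y) := by
  have h1 := le_sq_self p
  have h2 := hcap.sq_le
  have h3 := hcap.cells
  have h4 := hcap.peak
  have h10 := hcap.ten_le
  have hCM := hcap.le
  have hN := Nat.two_pow_pos (2 * p + 1)
  have hT : 2 ^ t ≤ 2 ^ (2 * p + 1) := Nat.pow_le_pow_right (by omega) ht.le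
  have hT0 := Nat.two_pow_pos t
  have h5 := hs.r4
  refine (Ok.loop (T := 90) (n := 2 ^ (2 * p + 1)) (Inv := fun i s' => Keep 9 6 s s' ∧
    ∀ y, s'.arr 6 y = if clearBit t y < i then butterfly t (s.arr 6) y else s.arr 6 y)
    ?_ ?_ ?_ ?_).mono ?_ ?_
  · exact ⟨Keep.refl _ _ _, by simp⟩
  · exact hs.r3
  · simp only [IntExpr.peak, hs.r3]; omega
  · rintro z hz s' ⟨hk, harr⟩
    have hb : s'.reg 4 = s.reg 4 := hk.base
    have h8' : s'.reg 8 = 2 ^ t := by rw [hk.reg 8 (by omega), h8]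
    have hk1 : Keep 9 6 s (s'.setReg 10 z) := hk.setReg (by omega) (by omega) _
    have hdiv := Nat.div_le_self z (2 ^ t)
    refine Ok.weaken ?_ (Ok.ite (T := 80) ?_ (fun h => Ok.weaken ?_ (Ok.skip ⟨hk1, ?_⟩))
      fun h => Ok.weaken ?_ (Ok.seq (Ok.st (k' := 6) (i := z) (z := s.arr 6 z + s.arr 6 (z + 2 ^ t))
        (Q := fun s2 => s2 = (s'.setReg 10 z).setArr 6 z (s.arr 6 z + s.arr 6 (z + 2 ^ t)))
        ?_ ?_ ?_ ?_ rfl) fun s2 hs2 => Ok.st (k' := 6) (i := z + 2 ^ t)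
        (z := s.arr 6 z - s.arr 6 (z + 2 ^ t)) ?_ ?_ ?_ ?_ ⟨?_, ?_⟩))
    · simp [IntExpr.time]
    · simp [IntExpr.peak, IntExpr.eval, h8']; omega
    · omega
    · intro y
      have hz' : z / 2 ^ t % 2 ≠ 0 := by simpa [IntExpr.eval, h8'] using h
      have hne : clearBit t y ≠ z := fun e => hz' (e ▸ clearBit_even t y)
      rw [arr_setReg _ (by omega), harr y]
      simp only [show clearBit t y < z + 1 ↔ clearBit t y < z by omega]
    · simp [CxExpr.time, IntExpr.time]
    · simp [IntExpr.eval]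
    · simp [IntExpr.eval]
    · have hz' : z / 2 ^ t % 2 = 0 := by simpa [IntExpr.eval, h8'] using h
      have c1 := (clearBit_eq_iff hz' z).2 (Or.inl rfl)
      have c2 := (clearBit_eq_iff hz' (z + 2 ^ t)).2 (Or.inr rfl)
      simp [CxExpr.eval, IntExpr.eval, arr_setReg, h8', harr, c1, c2]
    · simp [fits_rat, fits_add, fits_mul, fits_ld_reg h10 hCM, fits_ld h10 hCM, IntExpr.peak,
        IntExpr.eval, hb, h8']; omega
    · simp [IntExpr.eval]
    · simp [IntExpr.eval, hs2, h8']
    · have hz' : z / 2 ^ t % 2 = 0 := by simpa [IntExpr.eval, h8'] using h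
      have c2 := (clearBit_eq_iff hz' (z + 2 ^ t)).2 (Or.inr rfl)
      have e2 : s2.arr 6 z = s.arr 6 z + s.arr 6 (z + 2 ^ t) := by
        rw [hs2, arr_setArr _ (by omega) (by omega), if_pos ⟨rfl, rfl⟩]
      have e3 : s2.arr 6 (z + 2 ^ t) = s.arr 6 (z + 2 ^ t) := by
        rw [hs2, arr_setArr _ (by omega) (by omega), if_neg (by omega), arr_setReg _ (by omega), harr,
          c2, if_neg (by omega)]
      have e4 : s2.reg 10 = z := by simp [hs2]
      have e5 : s2.reg 8 = 2 ^ t := by simp [hs2, h8']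
      simp [CxExpr.eval, IntExpr.eval, e2, e3, e4, e5]
      ring
    · have e4 : s2.reg 10 = z := by simp [hs2]
      have e5 : s2.reg 8 = 2 ^ t := by simp [hs2, h8']
      have e6 : s2.reg 4 = s.reg 4 := by simp [hs2, hb]
      simp [fits_rat, fits_sub, fits_mul, fits_ld_reg h10 hCM, fits_ld h10 hCM, IntExpr.peak,
        IntExpr.eval, e4, e5, e6]; omega
    · rw [hs2]
      exact (hk1.setArr (by omega) (by omega) _ _).setArr (by omega) (by omega) _ _
    · intro y
      have hz' : z / 2 ^ t % 2 = 0 := by simpa [IntExpr.eval, h8'] using h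
      have c := clearBit_eq_iff hz' y
      have hodd : (z + 2 ^ t) / 2 ^ t % 2 ≠ 0 := by rw [add_two_pow_div]; omega
      rw [hs2, arr_setArr _ (by omega) (by omega), arr_setArr _ (by omega) (by omega),
        arr_setReg _ (by omega), harr y]
      by_cases y1 : y = z + 2 ^ t
      · rw [if_pos ⟨rfl, y1⟩, if_pos (by have := c.2 (Or.inr y1); omega), y1, butterfly, if_neg hodd,
          Nat.add_sub_cancel]
      · rw [if_neg (fun h => y1 h.2)]
        by_cases y2 : y = z
        · rw [if_pos ⟨rfl, y2⟩, if_pos (by have := c.2 (Or.inl y2); omega), y2, butterfly, if_pos hz']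
        · rw [if_neg (fun h => y2 h.2)]
          have hne : clearBit t y ≠ z := fun e => (c.1 e).elim y2 y1
          simp only [show clearBit t y < z + 1 ↔ clearBit t y < z by omega]
  · simp only [IntExpr.time]; omega
  · exact fun s' h => ⟨h.1, fun y hy => by rw [h.2 y, if_pos ((clearBit_le t y).trans_lt hy)]⟩

theorem whtProg_ok (hcap : Caps p X C M) (hX : 2 * 2 ^ (2 * p + 1) ≤ X) (hs : Env p s) :
    Ok C M whtProg s (200 * ((2 * p + 1) * 2 ^ (2 * p + 1))) (fun s' => Keep 7 6 s s' ∧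
      ∀ y < 2 ^ (2 * p + 1), s'.arr 6 y =
        ∑ c ∈ Finset.range (2 ^ (2 * p + 1)), chi (2 * p + 1) y c * s.arr 6 c) := by
  have h1 := le_sq_self p
  have h2 := hcap.sq_le
  have h3 := hcap.cells
  have h4 := hcap.peak
  have hN := Nat.two_pow_pos (2 * p + 1)
  have hnN : 2 * p + 1 < 2 ^ (2 * p + 1) := Nat.lt_two_pow_self
  refine (Ok.loop (T := 110 * 2 ^ (2 * p + 1)) (n := 2 * p + 1) (Inv := fun t s' => Keep 7 6 s s' ∧
    ∀ y < 2 ^ (2 * p + 1), s'.arr 6 y = whtPart (s.arr 6) t y) ?_ ?_ ?_ ?_).mono ?_ ?_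
  · exact ⟨Keep.refl _ _ _, fun y _ => (whtPart_zero _ _).symm⟩
  · exact hs.r1
  · simp only [IntExpr.peak, hs.r1]; omega
  · rintro t ht s' ⟨hk, harr⟩
    have hk1 : Keep 7 6 s (s'.setReg 7 t) := hk.setReg (by omega) (by omega) _
    have hT : 2 ^ t ≤ 2 ^ (2 * p + 1) := Nat.pow_le_pow_right (by omega) ht.le
    refine Ok.weaken ?_ (Ok.seq (powProg_ok (x := 7) (m := t) (by omega) (by omega) (by simp)
      (by omega) (by omega)) fun s2 ⟨hk2, hm2, h8⟩ => Ok.mono (butterflyProg_ok hcap hX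
        (hs.keep (hk1.trans (hk2.mono (by omega) (by omega))) (by omega)) ht h8) le_rfl
        fun s3 ⟨hk3, h3'⟩ => ⟨?_, ?_⟩)
    · omega
    · exact hk1.trans ((hk2.mono (by omega) (by omega)).trans (hk3.mono (by omega) (by omega)))
    · intro y hy
      rw [h3' y hy]
      refine butterfly_whtPart ht (fun y hy => ?_) hy
      rw [hk2.arr 6 (by omega), arr_setReg _ (by omega), harr y hy]
  · simp only [IntExpr.time]
    nlinarith
  · exact fun s' h => ⟨h.1, fun y hy => by rw [h.2 y hy, whtPart_full _ hy]⟩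

end

/-! ### One step of the iteration in time `O(p 4^p)` -/

/-- The bit mask of the pair of positions with number `q`. -/
def pairMask (n q : ℕ) : ℕ := if q / n = q % n then 0 else 2 ^ (q / n) + 2 ^ (q % n)

theorem two_pow_add_bit {j k : ℕ} (h : j ≠ k) (i : ℕ) :
    (2 ^ j + 2 ^ k) / 2 ^ i % 2 = 0 ↔ ¬(i = j ∨ i = k) := by
  wlog hjk : j < k generalizing j k
  · rw [add_comm, this h.symm (by omega), or_comm]
  have e : (2 ^ j + 2 ^ k) / 2 ^ i % 2 = 0 ↔ (2 ^ k + 2 ^ j).testBit i = false := by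
    rw [Nat.testBit_eq_decide_div_mod_eq, add_comm, decide_eq_false_iff_not]
    omega
  rw [e]
  rcases lt_trichotomy i k with hik | rfl | hik
  · rw [Nat.testBit_two_pow_add_gt hik, Nat.testBit_two_pow, decide_eq_false_iff_not]
    omega
  · rw [Nat.testBit_two_pow_add_eq, Nat.testBit_two_pow]
    simp
    omega
  · have h1 : 2 ^ j < 2 ^ k := Nat.pow_lt_pow_right (by omega) hjk
    have h2 : 2 ^ (k + 1) ≤ 2 ^ i := Nat.pow_le_pow_right (by omega) hik
    rw [pow_succ] at h2
    rw [Nat.testBit_lt_two_pow (by omega)]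
    simp
    omega

/-- A product of two signs is the character at the mask with these two bits. For equal positions the
product is 1, the trivial character, hence the mask 0. -/
theorem chi_pairMask {n q : ℕ} (hq : q < n * n) (x : ℕ) :
    chi n x (pairMask n q) = sbit x (q / n) * sbit x (q % n) := by
  have hn : 0 < n := Nat.pos_of_ne_zero fun h => by simp [h] at hq
  have hj : q / n < n := Nat.div_lt_of_lt_mul hq
  have hk : q % n < n := Nat.mod_lt _ hn
  rw [pairMask]
  split_ifs with h
  · rw [h, sbit]
    simp only [chi, Nat.zero_div, Nat.zero_mod, if_true, Finset.prod_const_one]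
    split_ifs <;> norm_num
  · have hb := two_pow_add_bit h
    rw [chi, Finset.prod_eq_mul (q / n) (q % n) h]
    · rw [if_neg (fun h0 => (hb _).1 h0 (Or.inl rfl)), if_neg (fun h0 => (hb _).1 h0 (Or.inr rfl))]
    · exact fun i _ hi => if_pos ((hb i).2 (by tauto))
    · exact fun h0 => absurd (Finset.mem_range.2 hj) h0
    · exact fun h0 => absurd (Finset.mem_range.2 hk) h0

theorem pairMask_lt {n q : ℕ} (hq : q < n * n) : pairMask n q < 2 ^ n := by
  have hn : 0 < n := Nat.pos_of_ne_zero fun h => by simp [h] at hq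
  have hj : q / n < n := Nat.div_lt_of_lt_mul hq
  have hk : q % n < n := Nat.mod_lt _ hn
  rw [pairMask]
  split_ifs with h
  · exact Nat.two_pow_pos n
  · rcases lt_or_gt_of_ne h with h | h
    · have h1 : 2 ^ (q / n) < 2 ^ (q % n) := Nat.pow_lt_pow_right (by omega) h
      have h2 : 2 ^ (q % n + 1) ≤ 2 ^ n := Nat.pow_le_pow_right (by omega) hk
      rw [pow_succ] at h2
      omega
    · have h1 : 2 ^ (q % n) < 2 ^ (q / n) := Nat.pow_lt_pow_right (by omega) h
      have h2 : 2 ^ (q / n + 1) ≤ 2 ^ n := Nat.pow_le_pow_right (by omega) hj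
      rw [pow_succ] at h2
      omega

/-- Registers `8`, `9`, `10` := the row, the column and the bit mask of the entry in register `7`. -/
def maskProg : Prog :=
  .seq (decodeProg 7 8 9) (.seq (powProg 10 (.reg 8)) (.seq (powProg 12 (.reg 9))
    -- Subtraction is truncated, so this sum is |j - k|, a test for j ≠ k.
    (.ite (.add (.sub (.reg 8) (.reg 9)) (.sub (.reg 9) (.reg 8)))
      (.assign 10 (.add (.reg 10) (.reg 12))) (.assign 10 (.lit 0)))))

section

variable {p X C M : ℕ} {s : State}

theorem maskProg_ok (hcap : Caps p X C M) (hs : Env p s) {i : ℕ} (hq : s.reg 7 = i)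
    (hi : i < (2 * p + 1) * (2 * p + 1)) :
    Ok C M maskProg s (50 * (2 * p + 1)) (fun s' => Keep 8 10 s s' ∧
      s'.reg 8 = i / (2 * p + 1) ∧ s'.reg 9 = i % (2 * p + 1) ∧
      s'.reg 10 = pairMask (2 * p + 1) i) := by
  have h1 := le_sq_self p
  have h2 := hcap.sq_le
  have h3 := hcap.cells
  have h4 := hcap.peak
  have hj : i / (2 * p + 1) < 2 * p + 1 := Nat.div_lt_of_lt_mul hi
  have hk : i % (2 * p + 1) < 2 * p + 1 := Nat.mod_lt _ (by omega)
  have hj2 : 2 ^ (i / (2 * p + 1)) ≤ 2 ^ (2 * p + 1) := Nat.pow_le_pow_right (by omega) hj.le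
  have hk2 : 2 ^ (i % (2 * p + 1)) ≤ 2 ^ (2 * p + 1) := Nat.pow_le_pow_right (by omega) hk.le
  have hN := Nat.two_pow_pos (2 * p + 1)
  refine Ok.weaken ?_ (Ok.seq (decodeProg_ok hcap hs hq hi (by omega) (by omega) (by omega))
    fun s1 ⟨hk1, h8, h9⟩ => Ok.seq (Ok.weaken (T' := 10 * p + 9) ?_
      (powProg_ok (by omega) (by omega) h8 (by omega) (by omega)))
    fun s2 ⟨hk2', _, h10⟩ => Ok.seq (Ok.weaken (T' := 10 * p + 9) ?_
      (powProg_ok (x := 9) (m := i % (2 * p + 1)) (by omega) (by omega) ?_ (by omega) (by omega)))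
    fun s3 ⟨hk3, _, h12⟩ =>
      have e8 : s3.reg 8 = i / (2 * p + 1) := by
        rw [hk3.reg 8 (by omega), hk2'.reg 8 (by omega), h8]
      have e9 : s3.reg 9 = i % (2 * p + 1) := by
        rw [hk3.reg 9 (by omega), hk2'.reg 9 (by omega), h9]
      have e10 : s3.reg 10 = 2 ^ (i / (2 * p + 1)) := by rw [hk3.reg 10 (by omega), h10]
      Ok.ite (T := 4) ?_ (fun h => Ok.assign ?_ ⟨?_, ?_, ?_, ?_⟩)
      fun h => Ok.weaken (T := 2) ?_ (Ok.assign ?_ ⟨?_, ?_, ?_, ?_⟩))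
  · simp only [IntExpr.time]; omega
  · omega
  · omega
  · rw [hk2'.reg 9 (by omega), h9]
  · simp only [IntExpr.peak, IntExpr.eval, e8, e9]; omega
  · simp only [IntExpr.peak, IntExpr.eval, e10, h12]; omega
  · exact ((hk1.mono (by omega) (by omega)).trans ((hk2'.mono (by omega) (by omega)).trans
      (hk3.mono (by omega) (by omega)))).setReg (by omega) (by omega) _
  · simp [e8]
  · simp [e9]
  · have hne : i / (2 * p + 1) ≠ i % (2 * p + 1) := fun e => by
      simp [IntExpr.eval, e8, e9, e] at h
    rw [pairMask, if_neg hne]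
    simp [IntExpr.eval, e10, h12]
  · simp
  · simp [IntExpr.peak]
  · exact ((hk1.mono (by omega) (by omega)).trans ((hk2'.mono (by omega) (by omega)).trans
      (hk3.mono (by omega) (by omega)))).setReg (by omega) (by omega) _
  · simp [e8]
  · simp [e9]
  · have he : i / (2 * p + 1) = i % (2 * p + 1) := by
      simp only [IntExpr.eval, e8, e9] at h
      omega
    rw [pairMask, if_pos he]
    simp [IntExpr.eval]

/-- Array `6` := the coefficients of the quadratic form, at their bit masks. -/
def scatterProg : Prog :=
  .seq (.loop 7 (.reg 3) (st (.lit 6) (.reg 7) (.rat 0)))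
    (.loop 7 (.reg 2) (.seq maskProg (st (.lit 6) (.reg 10) (.add (ld (.lit 6) (.reg 10))
      (.mul (.mul (ld (.lit 0) (.reg 8)) (ld (.lit 0) (.reg 9))) (ld (.lit 3) (.reg 7)))))))

/-- Ensures that matrices fit into the arrays of the transform. The factor 2 is needed: for p = 1
the matrix has 9 entries, but there are only 8 bitstrings. -/
theorem sq_le_two_pow (p : ℕ) : (2 * p + 1) * (2 * p + 1) ≤ 2 * 2 ^ (2 * p + 1) := by
  have h : p + 1 ≤ 2 ^ p := Nat.lt_two_pow_self
  have e : 2 ^ (2 * p + 1) = 2 ^ p * 2 ^ p * 2 := by rw [pow_succ, two_mul, pow_add]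
  rw [e]
  nlinarith

/-- Transposed pairs share a mask, and so do all diagonal pairs; therefore coefficients are
accumulated rather than stored, and the invariant collects all pairs with a given mask. -/
theorem scatterProg_ok (hcap : Caps p X C M) (hX : 2 * 2 ^ (2 * p + 1) ≤ X) (hs : Env p s) :
    Ok C M scatterProg s (300 * ((2 * p + 1) * 2 ^ (2 * p + 1))) (fun s' => Keep 7 6 s s' ∧
      ∀ y < 2 ^ (2 * p + 1), s'.arr 6 y = ∑ q ∈ Finset.range ((2 * p + 1) * (2 * p + 1)),
        if pairMask (2 * p + 1) q = y then
          s.arr 0 (q / (2 * p + 1)) * s.arr 0 (q % (2 * p + 1)) * s.arr 3 q else 0) := by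
  have h1 := le_sq_self p
  have h2 := hcap.sq_le
  have h3 := hcap.cells
  have h4 := hcap.peak
  have h10 := hcap.ten_le
  have hCM := hcap.le
  have hN := Nat.two_pow_pos (2 * p + 1)
  have h5 := hs.r4
  refine (Ok.seq (Q := fun s' => Keep 7 6 s s' ∧ ∀ y < 2 ^ (2 * p + 1), s'.arr 6 y = 0)
    (Ok.loop (T := 9) (n := 2 ^ (2 * p + 1))
      (Inv := fun i s' => Keep 7 6 s s' ∧ ∀ q < i, s'.arr 6 q = 0) ?_ ?_ ?_ ?_)
    fun s1 hs1 => Ok.loop (T := 100 * (2 * p + 1)) (n := (2 * p + 1) * (2 * p + 1))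
      (Inv := fun i s' => Keep 7 6 s s' ∧ ∀ y < 2 ^ (2 * p + 1), s'.arr 6 y =
        ∑ q ∈ Finset.range i, if pairMask (2 * p + 1) q = y then
          s.arr 0 (q / (2 * p + 1)) * s.arr 0 (q % (2 * p + 1)) * s.arr 3 q else 0)
      ?_ ?_ ?_ ?_).mono ?_ ?_
  · exact ⟨Keep.refl _ _ _, by simp⟩
  · exact hs.r3
  · simp only [IntExpr.peak, hs.r3]; omega
  · rintro i hi s' ⟨hk, h0⟩
    refine Ok.weaken ?_ (Ok.st (k' := 6) (i := i) (z := 0) ?_ ?_ ?_ ?_ ⟨?_, ?_⟩)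
    · simp [CxExpr.time, IntExpr.time]
    · simp [IntExpr.eval]
    · simp [IntExpr.eval]
    · simp [CxExpr.eval]
    · simp [fits_rat, fits_ld_reg h10 hCM, hk.base]; omega
    · exact (hk.setReg (by omega) (by omega) _).setArr (by omega) (by omega) _ _
    · intro q hq
      rw [arr_setArr _ (by omega) (by omega), arr_setReg _ (by omega)]
      split_ifs with h
      · rfl
      · exact h0 q (by omega)
  · exact ⟨hs1.1, by simpa using hs1.2⟩
  · exact (hs.keep hs1.1 (by omega)).r2
  · simp only [IntExpr.peak, (hs.keep hs1.1 (by omega)).r2]; omega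
  · rintro i hi s' ⟨hk, hsum⟩
    have hj : i / (2 * p + 1) < 2 * p + 1 := Nat.div_lt_of_lt_mul hi
    have hk' : i % (2 * p + 1) < 2 * p + 1 := Nat.mod_lt _ (by omega)
    have hmask := pairMask_lt hi
    have hk1 : Keep 7 6 s (s'.setReg 7 i) := hk.setReg (by omega) (by omega) _
    refine Ok.weaken ?_ (Ok.seq (maskProg_ok hcap (hs.keep hk1 (by omega)) (i := i) (by simp) hi)
      fun s3 ⟨hk3, h8, h9, hm⟩ =>
      have h7 : s3.reg 7 = i := by rw [hk3.reg 7 (by omega)]; simp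
      Ok.st (k' := 6) (i := pairMask (2 * p + 1) i)
      (z := s'.arr 6 (pairMask (2 * p + 1) i)
        + s.arr 0 (i / (2 * p + 1)) * s.arr 0 (i % (2 * p + 1)) * s.arr 3 i) ?_ ?_ ?_ ?_ ⟨?_, ?_⟩)
    · simp [CxExpr.time, IntExpr.time]; omega
    · simp [IntExpr.eval]
    · simp [IntExpr.eval, hm]
    · simp [CxExpr.eval, IntExpr.eval, hk3.arr, arr_setReg, hk.arr, h7, h8, h9, hm]
    · have hb : s3.reg 4 = s.reg 4 := hk3.base.trans hk1.base
      simp [fits_add, fits_mul, fits_ld_reg h10 hCM, hb, h7, h8, h9, hm]; omega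
    · exact (hk1.trans (hk3.mono (by omega) (by omega))).setArr (by omega) (by omega) _ _
    · intro y hy
      rw [arr_setArr _ (by omega) (by omega), Finset.sum_range_succ]
      by_cases hyq : y = pairMask (2 * p + 1) i
      · rw [if_pos ⟨rfl, hyq⟩, if_pos hyq.symm, ← hyq, hsum y hy]
      · rw [if_neg (fun h => hyq h.2), if_neg (Ne.symm hyq), add_zero, hk3.arr 6 (by omega),
          arr_setReg _ (by omega), hsum y hy]
  · have h6 := sq_le_two_pow p
    simp only [CxExpr.time, IntExpr.time]
    generalize hn : 2 * p + 1 = n at *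
    generalize 2 ^ n = N at *
    -- The n² masks, at cost O(n) each, stay within O(n 2^n) because n² ≤ 2 · 2^n.
    have h7 : n * n * (1 + 100 * n) ≤ 2 * N * (101 * n) :=
      Nat.mul_le_mul h6 (by omega)
    have h8 : 2 * N * (101 * n) = 202 * (n * N) := by ring
    have h9 : N ≤ n * N := Nat.le_mul_of_pos_left _ (by omega)
    omega
  · exact fun s' h => h

/-- Copy the entries of array `6` at the bit masks to the destination array. -/
def gatherProg : Prog :=
  .loop 7 (.reg 2) (.seq maskProg (st (.reg 6) (.reg 7) (ld (.lit 6) (.reg 10))))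

theorem gatherProg_ok (hcap : Caps p X C M) (hX : 2 * 2 ^ (2 * p + 1) ≤ X) (hs : Env p s) {d : ℕ}
    (hd : s.reg 6 = d) (hd5 : d ≤ 5) :
    Ok C M gatherProg s (300 * ((2 * p + 1) * 2 ^ (2 * p + 1))) (fun s' => Keep 7 d s s' ∧
      ∀ q < (2 * p + 1) * (2 * p + 1), s'.arr d q = s.arr 6 (pairMask (2 * p + 1) q)) := by
  have h1 := le_sq_self p
  have h2 := hcap.sq_le
  have h3 := hcap.cells
  have h4 := hcap.peak
  have h10 := hcap.ten_le
  have hCM := hcap.le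
  have hN := Nat.two_pow_pos (2 * p + 1)
  have h5 := hs.r4
  refine (Ok.loop (T := 100 * (2 * p + 1)) (n := (2 * p + 1) * (2 * p + 1))
      (Inv := fun i s' => Keep 7 d s s' ∧ (∀ y, s'.arr 6 y = s.arr 6 y) ∧
        ∀ q < i, s'.arr d q = s.arr 6 (pairMask (2 * p + 1) q)) ?_ ?_ ?_ ?_).mono ?_ ?_
  · exact ⟨Keep.refl _ _ _, fun _ => rfl, by simp⟩
  · exact hs.r2
  · simp only [IntExpr.peak, hs.r2]; omega
  · rintro i hi s' ⟨hk, h6, hsum⟩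
    have hmask := pairMask_lt hi
    have hk1 : Keep 7 d s (s'.setReg 7 i) := hk.setReg (by omega) (by omega) _
    refine Ok.weaken ?_ (Ok.seq (maskProg_ok hcap (hs.keep hk1 (by omega)) (i := i) (by simp) hi)
      fun s3 ⟨hk3, h8, h9, hm⟩ =>
      have h7 : s3.reg 7 = i := by rw [hk3.reg 7 (by omega)]; simp
      have hd' : s3.reg 6 = d := by rw [hk3.reg 6 (by omega), hk1.reg 6 (by omega), hd]
      Ok.st (k' := d) (i := i)
      (z := s.arr 6 (pairMask (2 * p + 1) i)) ?_ ?_ ?_ ?_ ⟨?_, ?_, ?_⟩)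
    · simp [CxExpr.time, IntExpr.time]; omega
    · simp [IntExpr.eval, hd']
    · simp [IntExpr.eval, h7]
    · simp [IntExpr.eval, hk3.arr, arr_setReg, h6, hm]
    · have hb : s3.reg 4 = s.reg 4 := hk3.base.trans hk1.base
      simp [fits_ld_reg h10 hCM, fits_ld_reg_reg h10 hCM, hb, h7, hd', hm]; omega
    · exact (hk1.trans (hk3.mono (by omega) (by omega))).setArr (by omega) (by omega) _ _
    · intro y
      rw [arr_setArr _ (by omega) (by omega), if_neg (by omega), hk3.arr 6 (by omega),
        arr_setReg _ (by omega), h6 y]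
    · intro q hq
      rw [arr_setArr _ (by omega) (by omega)]
      split_ifs with h
      · rw [h.2]
      · rw [hk3.arr d (by omega), arr_setReg _ (by omega), hsum q (by omega)]
  · have h6 := sq_le_two_pow p
    simp only [IntExpr.time]
    generalize hn : 2 * p + 1 = n at *
    generalize 2 ^ n = N at *
    have h7 : n * n * (1 + 100 * n) ≤ 2 * N * (101 * n) :=
      Nat.mul_le_mul h6 (by omega)
    have h8 : 2 * N * (101 * n) = 202 * (n * N) := by ring
    have h9 : N ≤ n * N := Nat.le_mul_of_pos_left _ (by omega)
    omega
  · exact fun s' h => ⟨h.1, h.2.2⟩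

/-- Replace the values of the quadratic form in array `6` by the weights of the bitstrings. -/
def factorProg : Prog :=
  .loop 7 (.reg 3) (.seq weightProg (st (.lit 6) (.reg 7) (.mul (ld (.lit 8) (.lit 0))
    (.exp (.mul (.rat (-1 / 2)) (ld (.lit 6) (.reg 7)))))))

theorem factorProg_ok (hcap : Caps p X C M) (hX : 2 * 2 ^ (2 * p + 1) ≤ X) (hs : Env p s) :
    Ok C M factorProg s (300 * ((2 * p + 1) * 2 ^ (2 * p + 1))) (fun s' => Keep 7 6 s s' ∧
      ∀ x < 2 ^ (2 * p + 1), s'.arr 6 x = tableWeight (s.arr 1) (s.arr 2) p x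
        * Complex.exp (-1 / 2 * s.arr 6 x)) := by
  have h1 := le_sq_self p
  have h2 := hcap.sq_le
  have h3 := hcap.cells
  have h4 := hcap.peak
  have h10 := hcap.ten_le
  have hCM := hcap.le
  have hN := Nat.two_pow_pos (2 * p + 1)
  have h5 := hs.r4
  refine (Ok.loop (T := 250 * (2 * p + 1)) (n := 2 ^ (2 * p + 1))
      (Inv := fun i s' => Keep 7 6 s s' ∧ ∀ x, s'.arr 6 x = if x < i then
        tableWeight (s.arr 1) (s.arr 2) p x * Complex.exp (-1 / 2 * s.arr 6 x) else s.arr 6 x)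
      ?_ ?_ ?_ ?_).mono ?_ ?_
  · exact ⟨Keep.refl _ _ _, by simp⟩
  · exact hs.r3
  · simp only [IntExpr.peak, hs.r3]; omega
  · rintro i hi s' ⟨hk, hsum⟩
    have hk1 : Keep 7 6 s (s'.setReg 7 i) := hk.setReg (by omega) (by omega) _
    have e : ∀ k < 6, (s'.setReg 7 i).arr k = s.arr k := fun k hk' => funext fun i => hk1.arr k hk' i
    refine Ok.weaken ?_ (Ok.seq (weightProg_ok hcap (hs.keep hk1 (by omega)) (a := i) (by simp) hi)
      fun s3 ⟨hk3, _, hw⟩ =>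
      have h7 : s3.reg 7 = i := by rw [hk3.reg 7 (by omega)]; simp
      Ok.st (k' := 6) (i := i)
      (z := tableWeight (s.arr 1) (s.arr 2) p i * Complex.exp (-1 / 2 * s.arr 6 i))
      ?_ ?_ ?_ ?_ ⟨?_, ?_⟩)
    · simp [CxExpr.time, IntExpr.time]; omega
    · simp [IntExpr.eval]
    · simp [IntExpr.eval, h7]
    · have h6 : s3.arr 6 i = s.arr 6 i := by
        rw [hk3.arr 6 (by omega), arr_setReg _ (by omega), hsum, if_neg (by omega)]
      simp [CxExpr.eval, IntExpr.eval, h7, hw, h6, e]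
    · have hb : s3.reg 4 = s.reg 4 := hk3.base.trans hk1.base
      simp [fits_rat, fits_mul, fits_exp, fits_ld_reg h10 hCM, fits_ld_lit h10 hCM, hb, h7]; omega
    · exact (hk1.trans (hk3.mono (by omega) (by omega))).setArr (by omega) (by omega) _ _
    · intro x
      rw [arr_setArr _ (by omega) (by omega)]
      by_cases hx : x = i
      · rw [if_pos ⟨rfl, hx⟩, if_pos (by omega), hx]
      · rw [if_neg (fun h => hx h.2), hk3.arr 6 (by omega), arr_setReg _ (by omega), hsum x]
        simp only [show x < i + 1 ↔ x < i by omega]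
  · simp only [IntExpr.time]
    generalize hn : 2 * p + 1 = n at *
    generalize 2 ^ n = N at *
    nlinarith
  · exact fun s' h => ⟨h.1, fun x hx => by rw [h.2 x, if_pos hx]⟩

/-- One step of the iteration. -/
def fastStep : Prog :=
  .seq scatterProg (.seq whtProg (.seq factorProg (.seq whtProg gatherProg)))

/-- With the coefficients at their masks, the first transform evaluates the quadratic form at all
strings at once. After weighting the exponentials, the second transform contains the sum against x_j
x_k at the mask of (j, k). Each phase costs O(p 4^p). -/
theorem fastStep_computes (hcap : Caps p X C M) (hX : 2 * 2 ^ (2 * p + 1) ≤ X) :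
    ComputesStep fastStep p C M (1300 * ((2 * p + 1) * 2 ^ (2 * p + 1))) := by
  intro s d hs hd h4d hd5
  refine Ok.weaken ?_ (Ok.seq (scatterProg_ok hcap hX hs) fun s1 ⟨hk1, h1⟩ =>
    Ok.seq (whtProg_ok hcap hX (hs.keep hk1 (by omega))) fun s2 ⟨hk2, h2⟩ =>
    Ok.seq (factorProg_ok hcap hX (hs.keep (hk1.trans hk2) (by omega))) fun s3 ⟨hk3, h3⟩ =>
    Ok.seq (whtProg_ok hcap hX (hs.keep (hk1.trans (hk2.trans hk3)) (by omega))) fun s4 ⟨hk4, h4⟩ =>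
    Ok.mono (gatherProg_ok (d := d) hcap hX
      (hs.keep (hk1.trans (hk2.trans (hk3.trans hk4))) (by omega)) ?_ hd5) le_rfl
      fun s5 ⟨hk5, h5⟩ => ⟨?_, ?_⟩)
  · omega
  · rw [(hk1.trans (hk2.trans (hk3.trans hk4))).reg 6 (by omega), hd]
  · exact ((hk1.trans (hk2.trans (hk3.trans hk4))).mono (by omega) (by omega)).trans hk5
  · intro q hq
    rw [h5 q hq, h4 _ (pairMask_lt hq), tableStep]
    refine Finset.sum_congr rfl fun x hx => ?_
    have hx' := Finset.mem_range.1 hx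
    have e : ∀ k < 6, s2.arr k = s.arr k := fun k hk => funext fun i => (hk1.trans hk2).arr k hk i
    have hq' : s2.arr 6 x = tableQuad (s.arr 0) (s.arr 3) (2 * p + 1) x := by
      rw [h2 x hx', tableQuad,
        Finset.sum_congr rfl fun c hc => by rw [h1 c (Finset.mem_range.1 hc), Finset.mul_sum],
        Finset.sum_comm]
      refine Finset.sum_congr rfl fun r hr => ?_
      have hr' := Finset.mem_range.1 hr
      simp only [mul_ite, mul_zero]
      rw [Finset.sum_ite_eq, if_pos (Finset.mem_range.2 (pairMask_lt hr')), chi_pairMask hr']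
      ring
    rw [chi_comm, chi_pairMask hq, h3 x hx', hq', e 1 (by omega), e 2 (by omega), tableFactor]
    ring

end

/-! ### The iteration in terms of tables -/

/-- The matrices `G^{(m)}`, as lists of entries. -/
def tableG (Γ P N : ℕ → ℂ) (p : ℕ) : ℕ → ℕ → ℂ
  | 0 => fun _ => 1
  | m + 1 => tableStep Γ P N (tableG Γ P N p m) p

/-- Negate entry `p - 1`. -/
def flipEntry (N : ℕ → ℂ) (p : ℕ) : ℕ → ℂ := Function.update N (p - 1) (-N (p - 1))

/-- The matrices `G'^{(m)}` for `m ≥ 1`, as lists of entries. -/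
def tableG' (Γ P N : ℕ → ℂ) (p m : ℕ) : ℕ → ℂ :=
  tableStep Γ P (flipEntry N p) (tableG Γ P N p (m - 1)) p

theorem tableStep_congr (Γ P N : ℕ → ℂ) {W W' : ℕ → ℂ} {p : ℕ}
    (h : ∀ q < (2 * p + 1) * (2 * p + 1), W q = W' q) : tableStep Γ P N W p = tableStep Γ P N W' p := by
  funext q
  have e : ∀ x, tableQuad Γ W (2 * p + 1) x = tableQuad Γ W' (2 * p + 1) x := fun x =>
    Finset.sum_congr rfl fun q hq => by rw [h q (Finset.mem_range.1 hq)]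
  simp only [tableStep, tableFactor, e]

/-- The bitstring encoded by an integer. -/
def bitsOf (p x : ℕ) : Bits p := fun j => if x / 2 ^ (j : ℕ) % 2 = 0 then 1 else -1

theorem sgn_bitsOf (p x : ℕ) (j : Fin (2 * p + 1)) : sgn (bitsOf p x j) = sbit x j := by
  rw [bitsOf, sbit]
  split_ifs <;> simp [sgn]

theorem bitsOf_injective (p : ℕ) : Function.Injective fun x : Fin (2 ^ (2 * p + 1)) => bitsOf p x := by
  intro x y h
  refine Fin.ext (Nat.eq_of_testBit_eq fun i => ?_)
  by_cases hi : i < 2 * p + 1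
  · have h1 : bitsOf p x ⟨i, hi⟩ = bitsOf p y ⟨i, hi⟩ := congrFun h _
    simp only [bitsOf] at h1
    have hne : (1 : ℤˣ) ≠ -1 := by decide
    rw [Nat.testBit_eq_decide_div_mod_eq, Nat.testBit_eq_decide_div_mod_eq, decide_eq_decide]
    split_ifs at h1 with h2 h3 h3
    · omega
    · exact absurd h1 hne
    · exact absurd h1.symm hne
    · omega
  · have h2 : 2 ^ (2 * p + 1) ≤ 2 ^ i := Nat.pow_le_pow_right (by omega) (by omega)
    rw [Nat.testBit_lt_two_pow (x.is_lt.trans_le h2), Nat.testBit_lt_two_pow (y.is_lt.trans_le h2)]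

theorem sum_bitsOf {p : ℕ} (F : Bits p → ℂ) :
    ∑ x ∈ Finset.range (2 ^ (2 * p + 1)), F (bitsOf p x) = ∑ a, F a := by
  rw [Finset.sum_range fun x => F (bitsOf p x)]
  refine Fintype.sum_bijective (fun x : Fin (2 ^ (2 * p + 1)) => bitsOf p x)
    ((Fintype.bijective_iff_injective_and_card _).2 ⟨bitsOf_injective p, ?_⟩) _ _ fun _ => rfl
  rw [Fintype.card_fin, Fintype.card_fun, Fintype.card_units_int, Fintype.card_fin]

section

variable {p : ℕ}

/-- The angles in the order in which they occur in `f`. -/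
def angle (β : Fin p → ℝ) (i : ℕ) : ℝ :=
  if h : i < p then β ⟨i, h⟩ else if h' : 2 * p - 1 - i < p then -β ⟨2 * p - 1 - i, h'⟩ else 0

/-- The tables agree with the input. -/
structure Tables (γ β : Fin p → ℝ) (Γ P N : ℕ → ℂ) : Prop where
  gam : ∀ j : Fin (2 * p + 1), Γ j = Gam γ j
  pos : ∀ i < 2 * p, P i = Complex.exp (Complex.I * angle β i)
  neg : ∀ i < 2 * p, N i = Complex.exp (-(Complex.I * angle β i))

variable {γ β : Fin p → ℝ} {Γ P N : ℕ → ℂ}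

/-- Table entry i belongs to positions i and i + 1; the right half of `weight` counts from the outer
end, whence the reflected product. Separate `l` and `N'` permit a sign to be moved from a bit into
the table, which covers f and f' at once. -/
theorem weight_bitsOf (h : Tables γ β Γ P N) {N' : ℕ → ℂ} {x : ℕ} {l : Bits p}
    (hl : ∀ (i : ℕ) (hi : i < p), sgn (l ⟨i, by omega⟩) * sgn (l ⟨i + 1, by omega⟩) * N i
      = sbit x i * sbit x (i + 1) * N' i)
    (hN : ∀ i, p ≤ i → i < 2 * p → N' i = N i) : weight β l (bitsOf p x) = tableWeight P N' p x := by
  rw [weight, tableWeight, mul_assoc]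
  congr 1
  have e : Finset.range (2 * p) = Finset.range (p + p) := by rw [two_mul]
  rw [e, Finset.prod_range_add]
  congr 1
  · rw [← Fin.prod_univ_eq_prod_range fun i => 1 / 2 * (P i + sbit x i * sbit x (i + 1) * N' i)]
    refine Finset.prod_congr rfl fun i _ => ?_
    rw [rot_eq, ← hl i i.is_lt, h.pos i (by omega), h.neg i (by omega), angle, dif_pos i.is_lt]
  · rw [← Finset.prod_range_reflect,
      ← Fin.prod_univ_eq_prod_range fun k => 1 / 2 * (P (p + (p - 1 - k)) + sbit x (p + (p - 1 - k))
        * sbit x (p + (p - 1 - k) + 1) * N' (p + (p - 1 - k)))]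
    refine Finset.prod_congr rfl fun i _ => ?_
    have e1 : p + (p - 1 - i) = 2 * p - 1 - i := by omega
    have e2 : 2 * p - 1 - i + 1 = 2 * p - i := by omega
    have e3 : angle β (2 * p - 1 - i) = -β i := by
      rw [angle, dif_neg (by omega), dif_pos (by omega)]
      congr 2
      ext
      simp only
      omega
    rw [rot_eq, sgn_bitsOf, sgn_bitsOf, e1, hN _ (by omega) (by omega), h.pos _ (by omega), h.neg _ (by omega),
      e2, e3]

theorem f_bitsOf (h : Tables γ β Γ P N) (x : ℕ) : f β (bitsOf p x) = tableWeight P N p x :=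
  weight_bitsOf h (fun i hi => by rw [sgn_bitsOf, sgn_bitsOf]) fun _ _ _ => rfl

/-- The bit -a_0 occurs in a single factor, between positions p - 1 and p, where by `rot_eq` its
sign can be attached to the table entry of e^{-iθ}. -/
theorem f'_bitsOf (h : Tables γ β Γ P N) (x : ℕ) :
    f' β (bitsOf p x) = tableWeight P (flipEntry N p) p x := by
  refine weight_bitsOf h (fun i hi => ?_) fun i hi hi' => ?_
  · rw [Function.update_of_ne (by simp [mid, Fin.ext_iff]; omega), sgn_bitsOf]
    by_cases hip : i = p - 1
    · have e : (⟨i + 1, by omega⟩ : Fin (2 * p + 1)) = mid p := by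
        ext; simp only [mid]; omega
      rw [e, Function.update_self, sgn_neg, sgn_bitsOf, flipEntry, ← hip, Function.update_self,
        ← e]
      ring
    · rw [Function.update_of_ne (by simp [mid, Fin.ext_iff]; omega), sgn_bitsOf, flipEntry,
        Function.update_of_ne hip]
  · rw [flipEntry, Function.update_of_ne (by omega)]

theorem sum_range_sq (n : ℕ) (F : ℕ → ℕ → ℂ) :
    ∑ q ∈ Finset.range (n * n), F (q / n) (q % n) = ∑ j : Fin n, ∑ k : Fin n, F j k := by
  rw [Finset.sum_range fun q => F (q / n) (q % n), ← Fintype.sum_prod_type',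
    ← finProdFinEquiv.sum_comp]
  refine Finset.sum_congr rfl fun x _ => ?_
  have hn : 0 < n := x.1.pos
  simp only [finProdFinEquiv_apply_val]
  rw [Nat.add_mul_div_left _ _ hn, Nat.div_eq_of_lt x.2.is_lt, Nat.add_mul_mod_self_left,
    Nat.mod_eq_of_lt x.2.is_lt, zero_add]

/-- Entry `q` of a matrix is in row `q / n` and column `q % n`. -/
def entry (G : Matrix (Fin (2 * p + 1)) (Fin (2 * p + 1)) ℂ) (j k : ℕ) : ℂ :=
  G (Fin.ofNat (2 * p + 1) j) (Fin.ofNat (2 * p + 1) k)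

theorem entry_coe (G : Matrix (Fin (2 * p + 1)) (Fin (2 * p + 1)) ℂ) (j k : Fin (2 * p + 1)) :
    entry G j k = G j k := by
  simp [entry]

theorem gaussFactor_bitsOf (h : Tables γ β Γ P N) {W : ℕ → ℂ}
    {G : Matrix (Fin (2 * p + 1)) (Fin (2 * p + 1)) ℂ}
    (hW : ∀ q < (2 * p + 1) * (2 * p + 1), W q = entry G (q / (2 * p + 1)) (q % (2 * p + 1)))
    (x : ℕ) :
    gaussFactor γ G (bitsOf p x) = Complex.exp (-1 / 2 * tableQuad Γ W (2 * p + 1) x) := by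
  have e : tableQuad Γ W (2 * p + 1) x = ∑ j : Fin (2 * p + 1), ∑ k : Fin (2 * p + 1),
      Γ j * Γ k * sbit x j * sbit x k * entry G j k := by
    rw [← sum_range_sq (2 * p + 1) fun j k => Γ j * Γ k * sbit x j * sbit x k * entry G j k]
    exact Finset.sum_congr rfl fun q hq => by rw [hW q (Finset.mem_range.1 hq)]
  rw [gaussFactor, e]
  simp only [sgn_bitsOf, h.gam, entry_coe]
  congr 1
  ring

theorem tableStep_eq (Γ P N W : ℕ → ℂ) (F : Bits p → ℂ)
    (hF : ∀ x, tableFactor Γ P N W p x = F (bitsOf p x)) {q : ℕ}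
    (hq : q < (2 * p + 1) * (2 * p + 1)) :
    tableStep Γ P N W p q = ∑ a, F a * sgn (a (Fin.ofNat (2 * p + 1) (q / (2 * p + 1))))
      * sgn (a (Fin.ofNat (2 * p + 1) (q % (2 * p + 1)))) := by
  rw [tableStep, ← sum_bitsOf]
  refine Finset.sum_congr rfl fun x _ => ?_
  rw [hF, sgn_bitsOf, sgn_bitsOf, Fin.val_ofNat, Fin.val_ofNat, Nat.mod_mod,
    Nat.mod_eq_of_lt (Nat.div_lt_of_lt_mul hq)]

theorem tableG_eq (h : Tables γ β Γ P N) (m : ℕ) : ∀ q < (2 * p + 1) * (2 * p + 1),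
    tableG Γ P N p m q = entry (GMat γ β m) (q / (2 * p + 1)) (q % (2 * p + 1)) := by
  induction m with
  | zero => exact fun q _ => rfl
  | succ m ih =>
    intro q hq
    rw [tableG, tableStep_eq Γ P N _ (fun a => f β a * gaussFactor γ (GMat γ β m) a)
      (fun x => by rw [tableFactor, f_bitsOf h, gaussFactor_bitsOf h ih]) hq, entry]
    simp only [GMat, Matrix.of_apply]
    exact Finset.sum_congr rfl fun a _ => by ring

/-- The case m = 0 is excluded because the initial G' is set to 1 by convention and does not arise
from a step. -/
theorem tableG'_eq (h : Tables γ β Γ P N) {m : ℕ} (hm : 1 ≤ m) {q : ℕ}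
    (hq : q < (2 * p + 1) * (2 * p + 1)) :
    tableG' Γ P N p m q = entry (GMat' γ β m) (q / (2 * p + 1)) (q % (2 * p + 1)) := by
  obtain ⟨m, rfl⟩ : ∃ k, m = k + 1 := ⟨m - 1, by omega⟩
  rw [tableG', Nat.add_sub_cancel,
    tableStep_eq Γ P _ _ (fun a => f' β a * gaussFactor γ (GMat γ β m) a)
      (fun x => by rw [tableFactor, f'_bitsOf h, gaussFactor_bitsOf h (tableG_eq h m)]) hq, entry]
  simp only [GMat', Matrix.of_apply]
  exact Finset.sum_congr rfl fun a _ => by ring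

end

/-! ### The complete program -/

theorem fits_load {C M : ℕ} {s : State} (e : IntExpr) :
    Fits C M s (.load e) ↔ e.eval s + 1 ≤ C ∧ e.peak s ≤ M := Iff.rfl

theorem Ok.store {C M : ℕ} {s : State} {Q : State → Prop} {e : IntExpr} {v : CxExpr} {i : ℕ} {z : ℂ}
    (he : e.eval s = i) (hv : v.eval s = z)
    (hside : Fits C M s (.load e) ∧ Fits C M s v) (hQ : Q (s.setMem i z)) :
    Ok C M (.store e v) s (e.time + v.time + 1) Q := by
  subst he hv
  exact ⟨hQ, le_rfl, max_le hside.1.1 hside.2.1, max_le hside.1.2 hside.2.2⟩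

/-- Compute the registers `1, …, 4`. -/
def setupProg : Prog :=
  .seq (.assign 1 (.add (.mul (.lit 2) (.reg 0)) (.lit 1))) (.seq (.assign 2 (.mul (.reg 1) (.reg 1)))
    (.seq (powProg 5 (.reg 1)) (.seq (.assign 3 (.reg 5))
      (.assign 4 (.add (.mul (.lit 2) (.reg 2)) (.lit 1))))))

/-- Array `0` := the vector `Γ`. -/
def gamProg : Prog :=
  -- With truncated subtraction, p - j is nonzero exactly for j < p and j - p exactly for j > p;
  -- this separates the three parts of Γ.
  .loop 5 (.reg 1) (.ite (.sub (.reg 0) (.reg 5)) (st (.lit 0) (.reg 5) (.load (.reg 5)))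
    (.ite (.sub (.reg 5) (.reg 0))
      (st (.lit 0) (.reg 5) (.sub (.rat 0) (.load (.sub (.mul (.lit 2) (.reg 0)) (.reg 5)))))
      (st (.lit 0) (.reg 5) (.rat 0))))

/-- Arrays `1` and `2` := the tables of `e^{iθ}` and of `e^{-iθ}`. -/
def angleProg : Prog :=
  .loop 5 (.mul (.lit 2) (.reg 0)) (.seq
    (.ite (.sub (.reg 0) (.reg 5)) (st (.lit 9) (.lit 0) (.load (.add (.reg 0) (.reg 5))))
      (st (.lit 9) (.lit 0) (.sub (.rat 0)
        -- For i ≥ p the cell 3p - 1 - i = p + (2p - 1 - i) holds the angle of the mirrored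
        -- rotation, which enters with the opposite sign.
        (.load (.sub (.sub (.mul (.lit 3) (.reg 0)) (.lit 1)) (.reg 5))))))
    (.seq (st (.lit 1) (.reg 5) (.exp (.mul .imag (ld (.lit 9) (.lit 0)))))
      (st (.lit 2) (.reg 5) (.exp (.sub (.rat 0) (.mul .imag (ld (.lit 9) (.lit 0))))))))

/-- Array `3` := the matrix `G^{(0)}`. -/
def onesProg : Prog := .loop 5 (.reg 2) (st (.lit 3) (.reg 5) (.rat 1))

/-- Negate the entry of array `2` that distinguishes `f'` from `f`. -/
def flipProg : Prog :=
  st (.lit 2) (.sub (.reg 0) (.lit 1)) (.sub (.rat 0) (ld (.lit 2) (.sub (.reg 0) (.lit 1))))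

/-- Array `3` := array `5`. -/
def copyProg : Prog := .loop 7 (.reg 2) (st (.lit 3) (.reg 7) (ld (.lit 5) (.reg 7)))

/-- Compute the next matrices `G'` and `G` with the step `φ`. -/
def roundProg (φ : Prog) : Prog :=
  .seq flipProg (.seq (.assign 6 (.lit 4)) (.seq φ (.seq flipProg (.seq (.assign 6 (.lit 5))
    (.seq φ copyProg)))))

/-- Cell `0` of array `9` := the sum in the formula for the energy. -/
def energyProg : Prog :=
  .seq (st (.lit 9) (.lit 0) (.rat 0)) (.loop 5 (.reg 1) (.seq
    (.assign 6 (.add (.mul (.reg 0) (.reg 1)) (.reg 5)))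
    (st (.lit 9) (.lit 0) (.add (ld (.lit 9) (.lit 0)) (.mul (ld (.lit 0) (.reg 5))
      (.sub (.mul (ld (.lit 5) (.reg 6)) (ld (.lit 5) (.reg 6)))
        (.mul (ld (.lit 4) (.reg 6)) (ld (.lit 4) (.reg 6)))))))))

/-- Write the results to the output cells. -/
def outputProg : Prog :=
  .seq (.loop 5 (.reg 2) (.seq (.store (.add (.lit 1) (.reg 5)) (ld (.lit 5) (.reg 5)))
    (.store (.add (.add (.lit 1) (.reg 2)) (.reg 5)) (ld (.lit 4) (.reg 5)))))
    (.store (.lit 0) (.mul (.mul .imag (.rat (1 / 2))) (ld (.lit 9) (.lit 0))))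

/-- Evaluate the iteration with the step `φ`. -/
def evalProg (φ : Prog) : Prog :=
  .seq setupProg (.seq gamProg (.seq angleProg (.seq onesProg (.seq (.loop 5 (.reg 0) (roundProg φ))
    (.seq energyProg outputProg)))))

section

variable {p X C M : ℕ} {s : State}

theorem setupProg_ok (hcap : Caps p X C M) (h0 : s.reg 0 = p) :
    Ok C M setupProg s (50 * (2 * p + 1)) (fun s' => Env p s' ∧ s'.mem = s.mem) := by
  have h1 := le_sq_self p
  have h2 := hcap.sq_le
  have h3 := hcap.cells
  have h4 := hcap.peak
  have hN := Nat.two_pow_pos (2 * p + 1)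
  refine Ok.weaken ?_ (Ok.seq (Q := fun s' => s' = s.setReg 1 (2 * p + 1)) (Ok.assign ?_ ?_)
    fun s1 hs1 => Ok.seq (Q := fun s' => s' = s1.setReg 2 ((2 * p + 1) * (2 * p + 1)))
      (Ok.assign ?_ ?_)
    fun s2 hs2 => Ok.seq (powProg_ok (x := 1) (m := 2 * p + 1) (by omega) (by omega) ?_ (by omega)
      (by omega))
    fun s3 ⟨hk3, hm3, h5⟩ => Ok.seq (Q := fun s' => s' = s3.setReg 3 (2 ^ (2 * p + 1)))
      (Ok.assign ?_ ?_) fun s4 hs4 =>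
      have e2 : s4.reg 2 = (2 * p + 1) * (2 * p + 1) := by simp [hs4, hk3.reg, hs2]
      Ok.assign ?_ ⟨⟨?_, ?_, ?_, ?_, ?_⟩, ?_⟩)
  · simp only [IntExpr.time]; omega
  · simp only [IntExpr.peak, IntExpr.eval, h0]; omega
  · simp [IntExpr.eval, h0]
  · simp [IntExpr.peak, IntExpr.eval, hs1]; omega
  · simp [IntExpr.eval, hs1]
  · simp [hs2, hs1]
  · simp only [IntExpr.peak, h5]; omega
  · simp [IntExpr.eval, h5]
  · simp [IntExpr.peak, IntExpr.eval, e2]; omega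
  · simp [hs4, hk3.reg, hs2, hs1, h0]
  · simp [hs4, hk3.reg, hs2, hs1]
  · simp [e2]
  · simp [hs4]
  · simp [IntExpr.eval, e2]
  · simp [hs4, hm3, hs2, hs1]

theorem gamProg_ok (hcap : Caps p X C M) (hs : Env p s) {γ : Fin p → ℝ}
    (hin : ∀ j : Fin p, s.mem j = γ j) :
    Ok C M gamProg s (50 * (2 * p + 1)) (fun s' => Keep 5 0 s s' ∧
      ∀ j : Fin (2 * p + 1), s'.arr 0 j = Gam γ j) := by
  have h1 := le_sq_self p
  have h2 := hcap.sq_le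
  have h3 := hcap.cells
  have h4 := hcap.peak
  have h10 := hcap.ten_le
  have hCM := hcap.le
  have h5 := hs.r4
  refine (Ok.loop (T := 40) (n := 2 * p + 1) (Inv := fun i s' => Keep 5 0 s s' ∧
    ∀ j : Fin (2 * p + 1), (j : ℕ) < i → s'.arr 0 j = Gam γ j) ?_ ?_ ?_ ?_).mono ?_ ?_
  · exact ⟨Keep.refl _ _ _, fun _ h => absurd h (Nat.not_lt_zero _)⟩
  · exact hs.r1
  · simp only [IntExpr.peak, hs.r1]; omega
  · rintro i hi s' ⟨hk, harr⟩
    have hb : s'.reg 4 = s.reg 4 := hk.base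
    have e0 : s'.reg 0 = p := (hs.keep hk (by omega)).r0
    have hin' : ∀ j : Fin p, s'.mem j = γ j := fun j => by
      rw [hk.low j (by omega), hin]
    have hset : ∀ z : ℂ, z = (Gam γ ⟨i, hi⟩ : ℂ) → Keep 5 0 s ((s'.setReg 5 i).setArr 0 i z) ∧
        ∀ j : Fin (2 * p + 1), (j : ℕ) < i + 1 →
          ((s'.setReg 5 i).setArr 0 i z).arr 0 j = Gam γ j := fun z hz => by
      refine ⟨(hk.setReg (by omega) (by omega) _).setArr (by omega) (by omega) _ _, fun j hj => ?_⟩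
      rw [arr_setArr _ (by omega) (by omega), arr_setReg _ (by omega)]
      by_cases h : (j : ℕ) = i
      · rw [if_pos ⟨rfl, h⟩, hz]
        congr 2
        exact Fin.ext h.symm
      · rw [if_neg (fun h' => h h'.2), harr j (by omega)]
    refine Ok.weaken ?_ (Ok.ite (T := 26) ?_ (fun h => Ok.weaken ?_ (Ok.st (k' := 0) (i := i)
        (z := (Gam γ ⟨i, hi⟩ : ℂ)) ?_ ?_ ?_ ?_ (hset _ rfl)))
      fun h => Ok.weaken ?_ (Ok.ite (T := 18) ?_
        (fun h' => Ok.weaken ?_ (Ok.st (k' := 0) (i := i)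
          (z := (Gam γ ⟨i, hi⟩ : ℂ)) ?_ ?_ ?_ ?_ (hset _ rfl)))
        fun h' => Ok.weaken ?_ (Ok.st (k' := 0) (i := i)
          (z := (Gam γ ⟨i, hi⟩ : ℂ)) ?_ ?_ ?_ ?_ (hset _ rfl))))
    · simp [IntExpr.time]
    · simp [IntExpr.peak, IntExpr.eval, e0]; omega
    · simp [IntExpr.time, CxExpr.time]
    · simp [IntExpr.eval]
    · simp [IntExpr.eval]
    · have hlt : i < p := by simp [IntExpr.eval, e0] at h; omega
      simp [CxExpr.eval, IntExpr.eval, Gam, hlt, hin' ⟨i, hlt⟩]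
    · have hlt : i < p := by simp [IntExpr.eval, e0] at h; omega
      simp [fits_load, fits_ld_reg h10 hCM, IntExpr.eval, IntExpr.peak, hb]; omega
    · simp [IntExpr.time]
    · simp [IntExpr.peak, IntExpr.eval, e0]; omega
    · simp [IntExpr.time, CxExpr.time]
    · simp [IntExpr.eval]
    · simp [IntExpr.eval]
    · have hlt : p < i := by simp [IntExpr.eval, e0] at h'; omega
      have := hin' ⟨2 * p - i, by omega⟩
      simp only at this
      simp [CxExpr.eval, IntExpr.eval, Gam, hlt, hlt.le.not_gt, e0, this]
    · have hlt : p < i := by simp [IntExpr.eval, e0] at h'; omega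
      simp [fits_load, fits_sub, fits_rat, fits_ld_reg h10 hCM, IntExpr.eval, IntExpr.peak, hb, e0]
      omega
    · simp [IntExpr.time, CxExpr.time]
    · simp [IntExpr.eval]
    · simp [IntExpr.eval]
    · have e1 : i = p := by
        simp [IntExpr.eval, e0] at h h'
        omega
      simp [CxExpr.eval, Gam, e1]
    · simp [fits_rat, fits_ld_reg h10 hCM, hb]; omega
  · simp only [IntExpr.time]; omega
  · exact fun s' h => ⟨h.1, fun j => h.2 j j.is_lt⟩

theorem angleProg_ok (hcap : Caps p X C M) (hs : Env p s) {β : Fin p → ℝ}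
    (hin : ∀ j : Fin p, s.mem (p + j) = β j) :
    Ok C M angleProg s (100 * (2 * p + 1)) (fun s' => Keep 5 1 s s' ∧ ∀ i < 2 * p,
      s'.arr 1 i = Complex.exp (Complex.I * angle β i) ∧
      s'.arr 2 i = Complex.exp (-(Complex.I * angle β i))) := by
  have h1 := le_sq_self p
  have h2 := hcap.sq_le
  have h3 := hcap.cells
  have h4 := hcap.peak
  have h10 := hcap.ten_le
  have hCM := hcap.le
  have h5 := hs.r4
  refine (Ok.loop (T := 80) (n := 2 * p) (Inv := fun i s' => Keep 5 1 s s' ∧ ∀ j < i,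
      s'.arr 1 j = Complex.exp (Complex.I * angle β j) ∧
      s'.arr 2 j = Complex.exp (-(Complex.I * angle β j))) ?_ ?_ ?_ ?_).mono ?_ ?_
  · exact ⟨Keep.refl _ _ _, fun _ h => absurd h (Nat.not_lt_zero _)⟩
  · simp [IntExpr.eval, hs.r0]
  · simp [IntExpr.eval, IntExpr.peak, hs.r0]; omega
  · rintro i hi s' ⟨hk, harr⟩
    have hb : s'.reg 4 = s.reg 4 := hk.base
    have e0 : s'.reg 0 = p := (hs.keep hk (by omega)).r0
    have hk1 : Keep 5 1 s (s'.setReg 5 i) := hk.setReg (by omega) (by omega) _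
    have hin' : ∀ j : Fin p, s'.mem (p + j) = β j := fun j => by
      rw [hk.low _ (by omega), hin]
    have hset : ∀ z : ℂ, z = (angle β i : ℂ) →
        Keep 6 9 (s'.setReg 5 i) ((s'.setReg 5 i).setArr 9 0 z) ∧
        ((s'.setReg 5 i).setArr 9 0 z).arr 9 0 = angle β i := fun z hz => by
      refine ⟨(Keep.refl _ _ _).setArr (by omega) (by omega) _ _, ?_⟩
      rw [arr_setArr _ (by omega) (by omega), if_pos ⟨rfl, rfl⟩, hz]
    refine Ok.weaken ?_ (Ok.seq (Ok.ite (T := 24) (Q := fun s2 => Keep 6 9 (s'.setReg 5 i) s2 ∧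
        s2.arr 9 0 = angle β i) ?_
      (fun h => Ok.weaken ?_ (Ok.st (k' := 9) (i := 0) (z := (angle β i : ℂ)) ?_ ?_ ?_ ?_ (hset _ rfl)))
      fun h => Ok.weaken ?_ (Ok.st (k' := 9) (i := 0) (z := (angle β i : ℂ)) ?_ ?_ ?_ ?_ (hset _ rfl)))
      fun s2 ⟨hk2, h9⟩ =>
      have r5 : s2.reg 5 = i := by rw [hk2.reg 5 (by omega)]; simp
      have r4 : s2.reg 4 = s.reg 4 := hk2.base.trans hk1.base
      Ok.seq (Ok.st (k' := 1) (i := i)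
        (z := Complex.exp (Complex.I * angle β i))
        (Q := fun s3 => s3 = s2.setArr 1 i (Complex.exp (Complex.I * angle β i))) ?_ ?_ ?_ ?_ rfl)
      fun s3 hs3 =>
      have h9' : s3.arr 9 0 = angle β i := by
        rw [hs3, arr_setArr _ (by omega) (by omega), if_neg (by omega), h9]
      Ok.st (k' := 2) (i := i) (z := Complex.exp (-(Complex.I * angle β i)))
        ?_ ?_ ?_ ?_ ⟨?_, ?_⟩)
    · simp [IntExpr.time, CxExpr.time]
    · simp [IntExpr.peak, IntExpr.eval, e0]; omega
    · simp [IntExpr.time, CxExpr.time]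
    · simp [IntExpr.eval]
    · simp [IntExpr.eval]
    · have hlt : i < p := by simp [IntExpr.eval, e0] at h; omega
      simp [CxExpr.eval, IntExpr.eval, angle, hlt, e0, hin' ⟨i, hlt⟩]
    · simp [fits_load, fits_ld_lit h10 hCM, IntExpr.eval, IntExpr.peak, hb, e0]; omega
    · simp [IntExpr.time, CxExpr.time]
    · simp [IntExpr.eval]
    · simp [IntExpr.eval]
    · have hge : p ≤ i := by simp [IntExpr.eval, e0] at h; omega
      have h6 := hin' ⟨2 * p - 1 - i, by omega⟩
      have e3 : 3 * p - 1 - i = p + (2 * p - 1 - i) := by omega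
      rw [angle, dif_neg (by omega), dif_pos (by omega)]
      simp only at h6
      simp [CxExpr.eval, IntExpr.eval, e0, e3, h6]
    · have hge : p ≤ i := by simp [IntExpr.eval, e0] at h; omega
      simp [fits_load, fits_sub, fits_rat, fits_ld_lit h10 hCM, IntExpr.eval, IntExpr.peak, hb, e0]
      omega
    · simp [IntExpr.eval]
    · simp [IntExpr.eval, r5]
    · simp [CxExpr.eval, IntExpr.eval, h9]
    · simp [fits_exp, fits_mul, fits_imag, fits_ld_lit h10 hCM, fits_ld_reg h10 hCM, r4, r5]; omega
    · simp [IntExpr.eval]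
    · simp [IntExpr.eval, hs3, r5]
    · simp [CxExpr.eval, IntExpr.eval, h9']
    · simp [fits_exp, fits_mul, fits_sub, fits_rat, fits_imag, fits_ld_lit h10 hCM,
        fits_ld_reg h10 hCM, hs3, r4, r5]; omega
    · rw [hs3]
      exact ((hk1.trans (hk2.mono (by omega) (by omega))).setArr (by omega) (by omega) _ _).setArr
        (by omega) (by omega) _ _
    · intro j hj
      rw [hs3, arr_setArr _ (by omega) (by omega), arr_setArr _ (by omega) (by omega),
        arr_setArr _ (by omega) (by omega), arr_setArr _ (by omega) (by omega)]
      by_cases h : j = i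
      · simp [h]
      · have h7 := harr j (by omega)
        simp [h, hk2.arr 1, hk2.arr 2, arr_setReg, h7]
  · simp only [IntExpr.time]; omega
  · exact fun s' h => h

theorem onesProg_ok (hcap : Caps p X C M) (hs : Env p s) :
    Ok C M onesProg s (20 * ((2 * p + 1) * (2 * p + 1))) (fun s' => Keep 5 3 s s' ∧
      ∀ q < (2 * p + 1) * (2 * p + 1), s'.arr 3 q = 1) := by
  have h1 := le_sq_self p
  have h2 := hcap.sq_le
  have h3 := hcap.cells
  have h4 := hcap.peak
  have h10 := hcap.ten_le
  have hCM := hcap.le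
  have h5 := hs.r4
  refine (Ok.loop (T := 9) (n := (2 * p + 1) * (2 * p + 1)) (Inv := fun i s' => Keep 5 3 s s' ∧
    ∀ q < i, s'.arr 3 q = 1) ?_ ?_ ?_ ?_).mono ?_ ?_
  · exact ⟨Keep.refl _ _ _, fun _ h => absurd h (Nat.not_lt_zero _)⟩
  · exact hs.r2
  · simp only [IntExpr.peak, hs.r2]; omega
  · rintro i hi s' ⟨hk, h0⟩
    refine Ok.weaken ?_ (Ok.st (k' := 3) (i := i) (z := 1) ?_ ?_ ?_ ?_ ⟨?_, ?_⟩)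
    · simp [CxExpr.time, IntExpr.time]
    · simp [IntExpr.eval]
    · simp [IntExpr.eval]
    · simp [CxExpr.eval]
    · simp [fits_rat, fits_ld_reg h10 hCM, hk.base]; omega
    · exact (hk.setReg (by omega) (by omega) _).setArr (by omega) (by omega) _ _
    · intro q hq
      rw [arr_setArr _ (by omega) (by omega), arr_setReg _ (by omega)]
      split_ifs with h
      · rfl
      · exact h0 q (by omega)
  · simp only [IntExpr.time]; omega
  · exact fun s' h => h

theorem flipProg_ok (hcap : Caps p X C M) (hs : Env p s) :
    Ok C M flipProg s 30 (fun s' => Keep 7 2 s s' ∧ s'.arr 2 = flipEntry (s.arr 2) p ∧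
      ∀ k, 2 < k → k < 10 → s'.arr k = s.arr k) := by
  have h1 := le_sq_self p
  have h2 := hcap.sq_le
  have h3 := hcap.cells
  have h4 := hcap.peak
  have h10 := hcap.ten_le
  have hCM := hcap.le
  have h5 := hs.r4
  refine Ok.weaken ?_ (Ok.st (k' := 2) (i := p - 1) (z := -s.arr 2 (p - 1)) ?_ ?_ ?_ ?_ ⟨?_, ?_, ?_⟩)
  · simp [CxExpr.time, IntExpr.time]
  · simp [IntExpr.eval]
  · simp [IntExpr.eval, hs.r0]
  · simp [CxExpr.eval, IntExpr.eval, hs.r0]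
  · simp [fits_rat, fits_sub, fits_ld h10 hCM, IntExpr.eval, IntExpr.peak, hs.r0]; omega
  · exact (Keep.refl _ _ _).setArr (by omega) (by omega) _ _
  · funext i
    rw [arr_setArr _ (by omega) (by omega), flipEntry, Function.update_apply]
    simp
  · intro k hk hk10
    funext i
    rw [arr_setArr _ (by omega) (by omega), if_neg (by omega)]

theorem copyProg_ok (hcap : Caps p X C M) (hs : Env p s) :
    Ok C M copyProg s (30 * ((2 * p + 1) * (2 * p + 1))) (fun s' => Keep 7 3 s s' ∧
      (∀ k, 3 < k → k < 10 → s'.arr k = s.arr k) ∧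
      ∀ q < (2 * p + 1) * (2 * p + 1), s'.arr 3 q = s.arr 5 q) := by
  have h1 := le_sq_self p
  have h2 := hcap.sq_le
  have h3 := hcap.cells
  have h4 := hcap.peak
  have h10 := hcap.ten_le
  have hCM := hcap.le
  have h5 := hs.r4
  refine (Ok.loop (T := 18) (n := (2 * p + 1) * (2 * p + 1)) (Inv := fun i s' => Keep 7 3 s s' ∧
    (∀ k, 3 < k → k < 10 → s'.arr k = s.arr k) ∧ ∀ q < i, s'.arr 3 q = s.arr 5 q)
    ?_ ?_ ?_ ?_).mono ?_ ?_
  · exact ⟨Keep.refl _ _ _, fun _ _ _ => rfl, fun _ h => absurd h (Nat.not_lt_zero _)⟩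
  · exact hs.r2
  · simp only [IntExpr.peak, hs.r2]; omega
  · rintro i hi s' ⟨hk, hrest, h0⟩
    refine Ok.weaken ?_ (Ok.st (k' := 3) (i := i) (z := s.arr 5 i) ?_ ?_ ?_ ?_ ⟨?_, ?_, ?_⟩)
    · simp [CxExpr.time, IntExpr.time]
    · simp [IntExpr.eval]
    · simp [IntExpr.eval]
    · simp [IntExpr.eval, arr_setReg, hrest]
    · simp [fits_ld_reg h10 hCM, hk.base]; omega
    · exact (hk.setReg (by omega) (by omega) _).setArr (by omega) (by omega) _ _
    · intro k hk3 hk10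
      funext j
      rw [arr_setArr _ (by omega) (by omega), if_neg (by omega), arr_setReg _ (by omega),
        hrest k hk3 hk10]
    · intro q hq
      rw [arr_setArr _ (by omega) (by omega), arr_setReg _ (by omega)]
      split_ifs with h
      · rw [h.2]
      · exact h0 q (by omega)
  · simp only [IntExpr.time]; omega
  · exact fun s' h => h

end

theorem Keep.arr_eq {R L k : ℕ} {s s' : State} (h : Keep R L s s') (hk : k < L) :
    s'.arr k = s.arr k := funext (h.arr k hk)

theorem arr_setReg_eq (s : State) {r : ℕ} (h : r ≠ 4) (v k : ℕ) : (s.setReg r v).arr k = s.arr k :=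
  funext (arr_setReg s h v k)

theorem flipEntry_flipEntry (N : ℕ → ℂ) (p : ℕ) : flipEntry (flipEntry N p) p = N := by
  simp [flipEntry]

section

variable {p X C M T : ℕ} {s : State} {φ : Prog}

/-- A step with destination d preserves the arrays below d. So with G' sent to array 4 before G is
sent to array 5, the old matrix in array 3 survives both steps and G' survives the second. Array 2
changes in between, but the second flip restores it. -/
theorem roundProg_ok (hcap : Caps p X C M) (hφ : ComputesStep φ p C M T) (hs : Env p s) :
    Ok C M (roundProg φ) s (2 * T + 100 * ((2 * p + 1) * (2 * p + 1))) (fun s' => Keep 6 3 s s' ∧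
      ∀ q < (2 * p + 1) * (2 * p + 1),
        s'.arr 3 q = tableStep (s.arr 0) (s.arr 1) (s.arr 2) (s.arr 3) p q ∧
        s'.arr 4 q = tableStep (s.arr 0) (s.arr 1) (flipEntry (s.arr 2) p) (s.arr 3) p q ∧
        s'.arr 5 q = tableStep (s.arr 0) (s.arr 1) (s.arr 2) (s.arr 3) p q) := by
  have h1 := le_sq_self p
  have h3 := hcap.ten_le
  have h4 := hcap.le
  refine Ok.weaken ?_ (Ok.seq (flipProg_ok hcap hs) fun s1 ⟨hk1, hN1, hr1⟩ =>
    Ok.seq (Q := fun s' => s' = s1.setReg 6 4) (Ok.assign ?_ rfl) fun s2 hs2 =>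
    have hk2 : Keep 6 2 s s2 := hs2 ▸ (hk1.mono (by omega) le_rfl).setReg (by omega) (by omega) _
    have a2 : ∀ k, s2.arr k = s1.arr k := fun k => by rw [hs2, arr_setReg_eq _ (by omega)]
    Ok.seq (hφ s2 4 (hs.keep hk2 (by omega)) (by simp [hs2]) le_rfl (by omega)) fun s3 ⟨hk3, h3'⟩ =>
    have hk3' : Keep 6 2 s s3 := hk2.trans (hk3.mono (by omega) (by omega))
    Ok.seq (flipProg_ok hcap (hs.keep hk3' (by omega))) fun s4 ⟨hk4, hN4, hr4⟩ =>
    Ok.seq (Q := fun s' => s' = s4.setReg 6 5) (Ok.assign ?_ rfl) fun s5 hs5 =>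
    have hk5 : Keep 6 2 s s5 := hs5 ▸ (hk3'.trans
      (hk4.mono (by omega) le_rfl)).setReg (by omega) (by omega) _
    have a5 : ∀ k, s5.arr k = s4.arr k := fun k => by rw [hs5, arr_setReg_eq _ (by omega)]
    Ok.seq (hφ s5 5 (hs.keep hk5 (by omega)) (by simp [hs5]) (by omega) le_rfl) fun s6 ⟨hk6, h6'⟩ =>
    have hk6' : Keep 6 2 s s6 := hk5.trans (hk6.mono (by omega) (by omega))
    Ok.mono (copyProg_ok hcap (hs.keep hk6' (by omega))) le_rfl fun s7 ⟨hk7, hr7, h7⟩ =>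
    have hk7' : Keep 6 2 s s7 := hk6'.trans (hk7.mono (by omega) (by omega))
    have e2 : s5.arr 2 = s.arr 2 := by
      rw [a5, hN4, hk3.arr_eq (by omega), a2, hN1, flipEntry_flipEntry]
    have e3 : s2.arr 3 = s.arr 3 := by rw [a2, hr1 3 (by omega) (by omega)]
    have e3' : s5.arr 3 = s.arr 3 := by
      rw [a5, hr4 3 (by omega) (by omega), hk3.arr_eq (by omega), e3]
    have e5 : ∀ q < (2 * p + 1) * (2 * p + 1),
        s6.arr 5 q = tableStep (s.arr 0) (s.arr 1) (s.arr 2) (s.arr 3) p q := fun q hq => by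
      rw [h6' q hq, e2, e3', hk5.arr_eq (by omega), hk5.arr_eq (by omega)]
    ⟨⟨hk7'.base, hk7'.reg, hk7'.low, fun k hk i => ?_⟩, fun q hq => ⟨?_, ?_, ?_⟩⟩)
  · simp only [IntExpr.time]; omega
  · simp only [IntExpr.peak]; omega
  · simp only [IntExpr.peak]; omega
  · by_cases h2 : k = 2
    · subst h2
      rw [hk7.arr_eq (by omega), hk6.arr_eq (by omega), e2]
    · exact hk7'.arr k (by omega) i
  · rw [h7 q hq, e5 q hq]
  · rw [hr7 4 (by omega) (by omega), hk6.arr_eq (by omega), a5, hr4 4 (by omega) (by omega),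
      h3' q hq, e3, a2, a2, a2, hk1.arr_eq (by omega), hk1.arr_eq (by omega), hN1]
  · rw [hr7 5 (by omega) (by omega), e5 q hq]

/-- Arrays 4 and 5 are meaningful only after a round, hence the clause `1 ≤ m` in the invariant. G'
is recomputed in every round although only the last one is used, which merely doubles the number of
steps. -/
theorem iterateProg_ok (hcap : Caps p X C M) (hp : 1 ≤ p) (hφ : ComputesStep φ p C M T) (hs : Env p s)
    (h1s : ∀ q < (2 * p + 1) * (2 * p + 1), s.arr 3 q = 1) :
    Ok C M (.loop 5 (.reg 0) (roundProg φ)) s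
      (2 + p * (1 + (2 * T + 100 * ((2 * p + 1) * (2 * p + 1))))) (fun s' => Keep 5 3 s s' ∧
      ∀ q < (2 * p + 1) * (2 * p + 1),
        s'.arr 4 q = tableG' (s.arr 0) (s.arr 1) (s.arr 2) p p q ∧
        s'.arr 5 q = tableG (s.arr 0) (s.arr 1) (s.arr 2) p p q) := by
  have h1 := le_sq_self p
  have h2 := hcap.sq_le
  have h3 := hcap.cells
  have h4 := hcap.peak
  have hN := Nat.two_pow_pos (2 * p + 1)
  refine (Ok.loop (T := 2 * T + 100 * ((2 * p + 1) * (2 * p + 1))) (n := p)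
    (Inv := fun m s' => Keep 5 3 s s' ∧ ∀ q < (2 * p + 1) * (2 * p + 1),
        s'.arr 3 q = tableG (s.arr 0) (s.arr 1) (s.arr 2) p m q ∧
        (1 ≤ m → s'.arr 4 q = tableG' (s.arr 0) (s.arr 1) (s.arr 2) p m q ∧
        s'.arr 5 q = tableG (s.arr 0) (s.arr 1) (s.arr 2) p m q)) ?_ ?_ ?_ ?_).mono ?_ ?_
  · exact ⟨Keep.refl _ _ _, fun q hq => ⟨h1s q hq, fun h => absurd h (by omega)⟩⟩
  · exact hs.r0
  · simp only [IntExpr.peak, hs.r0]; omega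
  · rintro m hm s' ⟨hk, harr⟩
    have hk1 : Keep 5 3 s (s'.setReg 5 m) := hk.setReg (by omega) (by omega) _
    refine Ok.mono (roundProg_ok hcap hφ (hs.keep hk1 (by omega))) le_rfl fun s2 ⟨hk2, h⟩ =>
      ⟨hk1.trans (hk2.mono (by omega) le_rfl), fun q hq => ?_⟩
    have e := h q hq
    rw [tableStep_congr _ _ _ fun q hq => (congrFun (arr_setReg_eq s' (by omega) m 3) q).trans
      (harr q hq).1, tableStep_congr _ _ _ fun q hq =>
      (congrFun (arr_setReg_eq s' (by omega) m 3) q).trans (harr q hq).1,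
      hk1.arr_eq (by omega), hk1.arr_eq (by omega), hk1.arr_eq (by omega)] at e
    exact ⟨e.1, fun _ => ⟨e.2.1, e.2.2⟩⟩
  · simp only [IntExpr.time]; omega
  · exact fun s' h => ⟨h.1, fun q hq => (h.2 q hq).2 hp⟩

theorem mid_row_lt {j : ℕ} (hj : j < 2 * p + 1) : p * (2 * p + 1) + j < (2 * p + 1) * (2 * p + 1) := by
  nlinarith

theorem energyProg_ok (hcap : Caps p X C M) (hs : Env p s) :
    Ok C M energyProg s (100 * (2 * p + 1)) (fun s' => Keep 5 9 s s' ∧ s'.arr 9 0 =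
      ∑ j ∈ Finset.range (2 * p + 1), s.arr 0 j * (s.arr 5 (p * (2 * p + 1) + j) ^ 2
        - s.arr 4 (p * (2 * p + 1) + j) ^ 2)) := by
  have h1 := le_sq_self p
  have h2 := hcap.sq_le
  have h3 := hcap.cells
  have h4 := hcap.peak
  have h10 := hcap.ten_le
  have hCM := hcap.le
  have h5 := hs.r4
  refine (Ok.seq (Ok.st (k' := 9) (i := 0) (z := 0)
      (Q := fun s' => Keep 5 9 s s' ∧ s'.arr 9 0 = 0) ?_ ?_ ?_ ?_ ?_) fun s2 hs2 =>
    Ok.loop (T := 85) (n := 2 * p + 1)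
      (Inv := fun i s' => Keep 5 9 s s' ∧ s'.arr 9 0 = ∑ j ∈ Finset.range i, s.arr 0 j
        * (s.arr 5 (p * (2 * p + 1) + j) ^ 2 - s.arr 4 (p * (2 * p + 1) + j) ^ 2))
      ?_ ?_ ?_ ?_).mono ?_ ?_
  · simp [IntExpr.eval]
  · simp [IntExpr.eval]
  · simp [CxExpr.eval]
  · simp [fits_rat, fits_ld_lit h10 hCM]; omega
  · exact ⟨(Keep.refl _ _ _).setArr (by omega) (by omega) _ _, by
      rw [arr_setArr _ (by omega) (by omega), if_pos ⟨rfl, rfl⟩]⟩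
  · exact ⟨hs2.1, by simpa using hs2.2⟩
  · exact (hs.keep hs2.1 (by omega)).r1
  · simp only [IntExpr.peak, (hs.keep hs2.1 (by omega)).r1]; omega
  · rintro i hi s' ⟨hk, hsum⟩
    have hrow := mid_row_lt hi
    have hk1 : Keep 5 9 s (s'.setReg 5 i) := hk.setReg (by omega) (by omega) _
    have hs' := hs.keep hk (by omega)
    have hb : s'.reg 4 = s.reg 4 := hk.base
    have hk2 : Keep 5 9 s ((s'.setReg 5 i).setReg 6 (p * (2 * p + 1) + i)) :=
      hk1.setReg (by omega) (by omega) _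
    refine Ok.weaken ?_ (Ok.seq
      (Q := fun s2 => s2 = (s'.setReg 5 i).setReg 6 (p * (2 * p + 1) + i)) (Ok.assign ?_ ?_)
      fun s3 hs3 => Ok.st (k' := 9) (i := 0) (z := s'.arr 9 0 + s.arr 0 i *
        (s.arr 5 (p * (2 * p + 1) + i) ^ 2 - s.arr 4 (p * (2 * p + 1) + i) ^ 2)) ?_ ?_ ?_ ?_ ⟨?_, ?_⟩)
    · simp [CxExpr.time, IntExpr.time]
    · simp [IntExpr.peak, IntExpr.eval, hs'.r0, hs'.r1]; omega
    · simp [IntExpr.eval, hs'.r0, hs'.r1]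
    · simp [IntExpr.eval]
    · simp [IntExpr.eval]
    · have e9 : s3.arr 9 0 = s'.arr 9 0 := by
        rw [hs3, arr_setReg _ (by omega), arr_setReg _ (by omega)]
      rw [← hs3] at hk2
      have r5 : s3.reg 5 = i := by simp [hs3]
      have r6 : s3.reg 6 = p * (2 * p + 1) + i := by simp [hs3]
      simp [CxExpr.eval, IntExpr.eval, hk2.arr_eq (show 0 < 9 by omega),
        hk2.arr_eq (show 5 < 9 by omega), hk2.arr_eq (show 4 < 9 by omega), e9, r5, r6, mul_sub]
      ring
    · simp [fits_add, fits_sub, fits_mul, fits_ld_lit h10 hCM, fits_ld_reg h10 hCM, hs3, hb]; omega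
    · rw [hs3]
      exact hk2.setArr (by omega) (by omega) _ _
    · rw [arr_setArr _ (by omega) (by omega), if_pos ⟨rfl, rfl⟩, Finset.sum_range_succ, hsum]
  · simp [CxExpr.time, IntExpr.time]; omega
  · exact fun s' h => h

/-- The output cells lie in front of the arrays, so writing them does not disturb entries still to
be copied. They overlap the input, which is no longer needed. -/
theorem outputProg_ok (hcap : Caps p X C M) (hs : Env p s) :
    Ok C M outputProg s (100 * ((2 * p + 1) * (2 * p + 1))) (fun s' =>
      s'.mem 0 = Complex.I * (1 / 2) * s.arr 9 0 ∧ ∀ q < (2 * p + 1) * (2 * p + 1),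
        s'.mem (1 + q) = s.arr 5 q ∧
        s'.mem (1 + (2 * p + 1) * (2 * p + 1) + q) = s.arr 4 q) := by
  have h1 := le_sq_self p
  have h2 := hcap.sq_le
  have h3 := hcap.cells
  have h4 := hcap.peak
  have h10 := hcap.ten_le
  have hCM := hcap.le
  have h5 := hs.r4
  refine (Ok.seq (Ok.loop (T := 40) (n := (2 * p + 1) * (2 * p + 1))
    (Inv := fun i s' => Env p s' ∧ (∀ k j, s'.arr k j = s.arr k j) ∧ ∀ q < i,
        s'.mem (1 + q) = s.arr 5 q ∧
        s'.mem (1 + (2 * p + 1) * (2 * p + 1) + q) = s.arr 4 q) ?_ ?_ ?_ ?_) fun s1 hs1 =>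
    Ok.store (i := 0) (z := Complex.I * (1 / 2) * s.arr 9 0) ?_ ?_ ?_ ⟨?_, ?_⟩).mono ?_
      fun s' h => h
  · exact ⟨hs, fun _ _ => rfl, fun _ h => absurd h (Nat.not_lt_zero _)⟩
  · exact hs.r2
  · simp only [IntExpr.peak, hs.r2]; omega
  · rintro i hi s' ⟨hs', harr, hout⟩
    have e2 := hs'.r2
    have e4 := hs'.r4
    refine Ok.weaken ?_ (Ok.seq (Q := fun s2 => s2 = (s'.setReg 5 i).setMem (1 + i) (s.arr 5 i))
      (Ok.store (i := 1 + i) (z := s.arr 5 i) ?_ ?_ ?_ rfl) fun s2 hs2 =>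
      have a2 : ∀ k j, s2.arr k j = s.arr k j := fun k j => by
        rw [hs2, arr_setMem_of_lt _ (by simp [e4]; omega), arr_setReg _ (by omega), harr]
      Ok.store (i := 1 + (2 * p + 1) * (2 * p + 1) + i) (z := s.arr 4 i) ?_ ?_ ?_ ⟨?_, ?_, ?_⟩)
    · simp [CxExpr.time, IntExpr.time]
    · simp [IntExpr.eval]
    · simp [IntExpr.eval, arr_setReg, harr]
    · simp [fits_load, fits_ld_reg h10 hCM, IntExpr.eval, IntExpr.peak, e4]; omega
    · simp [IntExpr.eval, hs2, e2]
    · have e5 : s2.reg 5 = i := by simp [hs2]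
      simp [IntExpr.eval, a2, e5]
    · simp [fits_load, fits_ld_reg h10 hCM, IntExpr.eval, IntExpr.peak, hs2, e2, e4]; omega
    · exact ⟨by simp [hs2, hs'.r0], by simp [hs2, hs'.r1], by simp [hs2, hs'.r2],
        by simp [hs2, hs'.r3], by simp [hs2, hs'.r4]⟩
    · intro k j
      rw [arr_setMem_of_lt _ (by simp [hs2, e4]; omega), a2]
    · intro q hq
      rw [mem_setMem, mem_setMem, hs2, mem_setMem, mem_setMem, mem_setReg]
      by_cases h : q = i
      · subst h
        rw [if_neg (by omega), if_pos rfl, if_pos rfl]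
        exact ⟨rfl, rfl⟩
      · rw [if_neg (by omega), if_neg (by omega), if_neg (by omega), if_neg (by omega)]
        exact hout q (by omega)
  · simp [IntExpr.eval]
  · simp [CxExpr.eval, IntExpr.eval, hs1.2.1]
  · simp [fits_load, fits_mul, fits_imag, fits_rat, fits_ld_lit h10 hCM, IntExpr.eval, IntExpr.peak,
      hs1.1.r4]
    omega
  · simp [CxExpr.time, IntExpr.time]; omega
  · rw [mem_setMem, if_pos rfl]
  · intro q hq
    rw [mem_setMem, mem_setMem, if_neg (by omega), if_neg (by omega)]
    exact hs1.2.2 q hq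

/-- Each of the p rounds uses the step twice; everything else costs O(p) passes over a matrix. The
two complexity bounds differ only in the step that is inserted. -/
theorem evalProg_ok (hcap : Caps p X C M) (hp : 1 ≤ p) (hφ : ComputesStep φ p C M T)
    (γ β : Fin p → ℝ) :
    Ok C M (evalProg φ) (inputState γ β)
      (p * (2 * T) + 1000 * (p * ((2 * p + 1) * (2 * p + 1)))) (HoldsResult γ β) := by
  have h1 := le_sq_self p
  have hγ : ∀ j : Fin p, (inputState γ β).mem j = γ j := fun j => by simp [inputState]
  have hβ : ∀ j : Fin p, (inputState γ β).mem (p + j) = β j := fun j => by simp [inputState]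
  refine Ok.weaken ?_ (Ok.seq (setupProg_ok hcap rfl) fun s1 ⟨hs1, hm1⟩ =>
    Ok.seq (gamProg_ok (γ := γ) hcap hs1 fun j => by rw [hm1, hγ]) fun s2 ⟨hk2, h2⟩ =>
    have hs2 := hs1.keep hk2 le_rfl
    Ok.seq (angleProg_ok (β := β) hcap hs2 fun j => by
      rw [hk2.low _ (by rw [hs1.r4]; omega), hm1, hβ]) fun s3 ⟨hk3, h3⟩ =>
    have hs3 := hs2.keep hk3 le_rfl
    Ok.seq (onesProg_ok hcap hs3) fun s4 ⟨hk4, h4⟩ =>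
    have hs4 := hs3.keep hk4 le_rfl
    Ok.seq (iterateProg_ok hcap hp hφ hs4 h4) fun s5 ⟨hk5, h5⟩ =>
    have hs5 := hs4.keep hk5 le_rfl
    Ok.seq (energyProg_ok hcap hs5) fun s6 ⟨hk6, h6⟩ =>
    Ok.mono (outputProg_ok hcap (hs5.keep hk6 le_rfl)) le_rfl fun s7 ⟨h7, h8⟩ => ?_)
  · generalize (2 * p + 1) * (2 * p + 1) = m at *
    have e : p * (1 + (2 * T + 100 * m)) = p * (2 * T) + p + 100 * (p * m) := by ring
    have h9 : m ≤ p * m := Nat.le_mul_of_pos_left _ hp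
    rw [e]
    omega
  · have htab : Tables γ β (s4.arr 0) (s4.arr 1) (s4.arr 2) := by
      refine ⟨fun j => ?_, fun i hi => ?_, fun i hi => ?_⟩
      · rw [hk4.arr_eq (by omega), hk3.arr_eq (by omega), h2]
      · rw [hk4.arr_eq (by omega), (h3 i hi).1]
      · rw [hk4.arr_eq (by omega), (h3 i hi).2]
    have hG : ∀ j k : Fin (2 * p + 1), s5.arr 5 (j * (2 * p + 1) + k) = GMat γ β p j k ∧
        s5.arr 4 (j * (2 * p + 1) + k) = GMat' γ β p j k := fun j k => by
      have hq : (j : ℕ) * (2 * p + 1) + k < (2 * p + 1) * (2 * p + 1) := by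
        have := j.is_lt
        have := k.is_lt
        nlinarith
      have e1 : ((j : ℕ) * (2 * p + 1) + k) / (2 * p + 1) = j := by
        rw [add_comm, Nat.add_mul_div_right _ _ (by omega), Nat.div_eq_of_lt k.is_lt, zero_add]
      have e2 : ((j : ℕ) * (2 * p + 1) + k) % (2 * p + 1) = k := by
        rw [add_comm, Nat.add_mul_mod_self_right, Nat.mod_eq_of_lt k.is_lt]
      rw [(h5 _ hq).1, (h5 _ hq).2, tableG_eq htab p _ hq, tableG'_eq htab hp hq, e1, e2, entry_coe,
        entry_coe]
      exact ⟨rfl, rfl⟩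
    refine ⟨?_, fun j k => ?_⟩
    · rw [h7, h6, nuXYFormula, Finset.sum_range fun j => s5.arr 0 j *
        (s5.arr 5 (p * (2 * p + 1) + j) ^ 2 - s5.arr 4 (p * (2 * p + 1) + j) ^ 2), mul_one_div]
      congr 1
      refine Finset.sum_congr rfl fun j _ => ?_
      have e := hG (mid p) j
      rw [mid] at e
      simp only at e
      rw [e.1, e.2, hk5.arr_eq (by omega), htab.gam]
      rfl
    · have hq : (j : ℕ) * (2 * p + 1) + k < (2 * p + 1) * (2 * p + 1) := by
        have := j.is_lt
        have := k.is_lt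
        nlinarith
      rw [sq, (h8 _ hq).1, (h8 _ hq).2, hk6.arr_eq (by omega), hk6.arr_eq (by omega)]
      exact hG j k

end

/-! ### Time, space and word size -/

theorem caps_small (p : ℕ) : Caps p ((2 * p + 1) * (2 * p + 1)) (12 * ((2 * p + 1) * (2 * p + 1)) + 11)
    (12 * ((2 * p + 1) * (2 * p + 1)) + 11 + 2 * 2 ^ (2 * p + 1)) :=
  ⟨le_rfl, by omega, by omega⟩

/-- Arrays of twice the number of bitstrings leave room for addresses z + 2^t, so the space bound
does not need these to stay below 2^n. -/
theorem caps_large (p : ℕ) : Caps p (2 * 2 ^ (2 * p + 1)) (24 * 2 ^ (2 * p + 1) + 11)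
    (26 * 2 ^ (2 * p + 1) + 11) := by
  have := sq_le_two_pow p
  exact ⟨this, by omega, by omega⟩

theorem two_pow_odd (p : ℕ) : 2 ^ (2 * p + 1) = 2 * 4 ^ p := by
  rw [pow_succ, pow_mul]
  norm_num
  ring

/-- Since p ≥ 1, a constant factor can be absorbed into the exponent: integers up to a constant
times 4^p have O(p) bits. -/
theorem mul_four_pow_le {p K L : ℕ} (hp : 1 ≤ p) (hL : K ≤ 2 ^ L) : K * 4 ^ p ≤ 2 ^ ((L + 2) * p) := by
  have e : 2 ^ ((L + 2) * p) = 2 ^ (L * p) * 4 ^ p := by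
    rw [add_mul, pow_add, pow_mul 2 2]
    norm_num
  rw [e]
  exact Nat.mul_le_mul_right _ (hL.trans (Nat.pow_le_pow_right (by omega)
    (Nat.le_mul_of_pos_right _ hp)))

theorem odd_sq_le {p : ℕ} (hp : 1 ≤ p) : (2 * p + 1) * (2 * p + 1) ≤ 9 * p ^ 2 := by
  nlinarith

theorem evaluable_fast : EvaluableIn (fun p => p ^ 2 * 4 ^ p) (fun p => 4 ^ p) := by
  refine ⟨evalProg fastStep, 100000, fun p hp γ β => ?_⟩
  have h := evalProg_ok (caps_large p) hp (fastStep_computes (caps_large p) le_rfl) γ β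
  have h4 : 1 ≤ 4 ^ p := Nat.one_le_pow _ _ (by omega)
  refine ⟨h.post, h.time_le.trans ?_, h.cells_le.trans ?_, h.peak_le.trans ?_⟩
  · have h1 : p * (2 * (1300 * ((2 * p + 1) * 2 ^ (2 * p + 1)))) ≤ 15600 * (p ^ 2 * 4 ^ p) := by
      rw [two_pow_odd]
      have : p * (2 * p + 1) ≤ 3 * p ^ 2 := by nlinarith
      calc _ = 5200 * ((p * (2 * p + 1)) * 4 ^ p) := by ring
        _ ≤ 5200 * ((3 * p ^ 2) * 4 ^ p) := by gcongr
        _ = _ := by ring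
    have h2 : p * ((2 * p + 1) * (2 * p + 1)) ≤ 9 * (p ^ 2 * 4 ^ p) := by
      have : p ≤ 4 ^ p := (Nat.lt_pow_self (by omega)).le
      calc _ ≤ p * (9 * p ^ 2) := Nat.mul_le_mul_left _ (odd_sq_le hp)
        _ ≤ 4 ^ p * (9 * p ^ 2) := by gcongr
        _ = _ := by ring
    simp only
    omega
  · rw [two_pow_odd]
    simp only
    omega
  -- As 2^(2p+1) = 2 · 4^p, the peak is at most 52 · 4^p + 11 ≤ 63 · 4^p.
  · refine le_trans ?_ ((mul_four_pow_le (K := 63) (L := 6) hp (by norm_num)).trans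
      (Nat.pow_le_pow_right (by omega) (Nat.mul_le_mul_right _ (by omega))))
    rw [two_pow_odd]
    omega

/-- There are p rounds of O(p² 4^p) steps each, so the time is in fact O(p³ 4^p), within the stated
bound. -/
theorem evaluable_small : EvaluableIn (fun p => p ^ 4 * 4 ^ p) (fun p => p ^ 2) := by
  refine ⟨evalProg smallStep, 100000, fun p hp γ β => ?_⟩
  have h := evalProg_ok (caps_small p) hp (smallStep_computes (caps_small p)) γ β
  have h4 : 1 ≤ 4 ^ p := Nat.one_le_pow _ _ (by omega)
  have hsq := odd_sq_le hp
  have hp2 : 1 ≤ p ^ 2 := Nat.one_le_pow _ _ hp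
  refine ⟨h.post, h.time_le.trans ?_, h.cells_le.trans ?_, h.peak_le.trans ?_⟩
  · have h34 : p ^ 3 ≤ p ^ 4 := Nat.pow_le_pow_right hp (by omega)
    have h1 : p * (2 * (500 * ((2 * p + 1) * (2 * p + 1) * 2 ^ (2 * p + 1))))
        ≤ 18000 * (p ^ 4 * 4 ^ p) := by
      rw [two_pow_odd]
      calc _ = 2000 * (p * ((2 * p + 1) * (2 * p + 1)) * 4 ^ p) := by ring
        _ ≤ 2000 * (p * (9 * p ^ 2) * 4 ^ p) := by gcongr
        _ = 18000 * (p ^ 3 * 4 ^ p) := by ring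
        _ ≤ _ := by gcongr
    have h2 : p * ((2 * p + 1) * (2 * p + 1)) ≤ 9 * (p ^ 4 * 4 ^ p) := by
      calc _ ≤ p * (9 * p ^ 2) := Nat.mul_le_mul_left _ hsq
        _ = 9 * (p ^ 3 * 1) := by ring
        _ ≤ _ := by gcongr
    simp only
    omega
  · simp only
    omega
  · refine le_trans ?_ ((mul_four_pow_le (K := 256) (L := 8) hp (by norm_num)).trans
      (Nat.pow_le_pow_right (by omega) (Nat.mul_le_mul_right _ (by omega))))
    have := sq_le_two_pow p
    rw [two_pow_odd] at this ⊢
    omega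

end MCAnsatz

end

theorem mainTheorem2 :
    (∀ (p : ℕ), 1 ≤ p → ∀ (γ β : Fin p → ℝ),
      (∃ e : ℝ,
        MCAnsatz.IsDegreeLimit.{u} p
          (fun _ _ _ G _ D => MCAnsatz.energyPerEdge MCAnsatz.EPR G (MCAnsatz.mcState G D γ β)) e ∧
        ∀ (V : Type u) [Fintype V] [DecidableEq V] [Nonempty V] (G : SimpleGraph V)
          [DecidableRel G.Adj] (D : ℕ),
          G.IsRegularOfDegree (D + 1) → ((2 * p + 1 : ℕ) : ℕ∞) < G.egirth →
          e ≤ MCAnsatz.energyPerEdge MCAnsatz.EPR G MCAnsatz.zeroState) ∧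
      (∃ (νXY : ℝ) (νQMC : EReal),
        MCAnsatz.IsDegreeLimit.{u} p (fun _ _ _ G _ D => MCAnsatz.nu MCAnsatz.XY G D γ β) νXY ∧
        MCAnsatz.IsDegreeLimit.{u} p (fun _ _ _ G _ D => MCAnsatz.nu MCAnsatz.QMC G D γ β) νQMC ∧
        νQMC ≤ (νXY : EReal) ∧
        (νXY : ℂ) = MCAnsatz.nuXYFormula γ β)) ∧
    MCAnsatz.EvaluableIn (fun p => p ^ 2 * 4 ^ p) (fun p => 4 ^ p) ∧
    MCAnsatz.EvaluableIn (fun p => p ^ 4 * 4 ^ p) (fun p => p ^ 2) := by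
  exact ⟨fun p hp γ β => ⟨MCAnsatz.energy_limit hp γ β, MCAnsatz.nu_limit hp γ β⟩,
    MCAnsatz.evaluable_fast, MCAnsatz.evaluable_small⟩
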